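/- Let $E/F$ be a Galois extension of number fields, unramified at every finite place and split at every infinite place, with $\mathrm{Gal}(E/F)=\langle \iota,\tau\rangle$, where $\iota$ has order $2$ and $\tau$ has odd order, and let $F'$ be the fixed field of $\iota$. Put $G=\mathrm{Res}_{E/F}\mathrm{GL}_2$, so $G(\mathbb{A}_F)=\mathrm{GL}_2(\mathbb{A}_E)$. Let $K=K_\infty K^\infty$, with $K_\infty\le G(F_\infty)$ the standard maximal compact subgroup (orthogonal matrices at real places of $E$, unitary matrices at complex places) and $K^\infty=\mathrm{GL}_2(\widehat{\mathcal O}_E)$. Let $G(\mathbb{A}_F)^1=\{g:|\det g|=1\}$; functions on it are identified with the functions on $G(\mathbb{A}_F)=G(\mathbb{A}_F)^1\times\mathbb{R}_{>0}$ invariant under the scalar matrices $t\in\mathbb{R}_{>0}$ (embedded diagonally at the infinite places). Absolute values are the normalized ones. All Haar measures below are arbitrary but fixed. *The space.* $\mathcal{C}(G(\mathbb{A}_F)^1)$ is the space of smooth, right $K^\infty$-invariant functions $f$ on $G(\mathbb{A}_F)^1$ such that $X*f*Y\in L^1(G(\mathbb{A}_F)^1)$ for all $X,Y\in U(\mathfrak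 g)$, $\mathfrak g=\mathrm{Lie}(G(F_\infty))\otimes_{\mathbb R}\mathbb{C}$. $C_c^\infty(G(\mathbb{A}_F)^1/\!/K)$ is the space of smooth, compactly supported, $K$-bi-invariant functions. *The distributions $\mathbb{W}_h$.* Let $\psi=\psi_{\mathbb Q}\circ\mathrm{tr}_{\mathbb{A}_E/\mathbb{A}_{\mathbb Q}}$, where $\psi_\infty(a)=e^{-2\pi i a}$ and $\psi_p(a)=e^{2\pi i\,\mathrm{pr}(a)}$, with $\mathrm{pr}(a)\in\mathbb{Z}[p^{-1}]$ and $a\equiv\mathrm{pr}(a)$ mod $\mathbb{Z}_p$. Let $\delta$ be a finite idele of $E$, extended by $1$ to the infinite places, whose ideal is the absolute different of $E$. Write $h\in G(\mathbb{A}_F)$ as $h=\left(\begin{smallmatrix}1&t\\&1\end{smallmatrix}\right)\left(\begin{smallmatrix}zm/\delta&\\&z\end{smallmatrix}\right)k$ with $t\in\mathbb{A}_E$, $m,z\in\mathbb{A}_E^\times$, $k\in K$. Then $\mathbb{W}_h=\prod_w\mathbb{W}_{h,w}$ over the places $w$ of $E$, a distribution on $G(\mathbb{A}_F)$, where - for $w$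 finite, $\mathbb{W}_{h,w}$ is the function $g\mapsto \mathbf 1_{\mathcal{O}_{E_w}}(m)\,|m|_w\,\psi_w(t)\,\mathbf 1_m(z^{-1}g)$, where $\mathbf 1_m$ is the characteristic function of $\{x\in M_2(\mathcal{O}_{E_w}):\det(x)\mathcal{O}_{E_w}=m\mathcal{O}_{E_w}\}$; - for $w$ infinite, $\mathbb{W}_{h,w}$ sends $\varphi$ to $\tfrac12\psi_w(t)|m|_w^{1/2}\int_{\mathrm{GL}_2(E_w)^1}\mathcal{F}(rx)\,\varphi(zrx)\,dx$, where $\mathrm{GL}_2(E_w)^1=\{x:|\det x|_w=1\}$, $r=|m|_w^{1/(2[E_w:\mathbb{R}])}$ and $\mathcal{F}(x)=e^{-[E_w:\mathbb{R}]\,\mathrm{tr}(x^*x)}|\det x|_w^{1/2}$. For a function $\Psi$ on $G(\mathbb{A}_F)^1$, $\Psi*\mathbb{W}_h$ is the function $g\mapsto\int\Psi(gx^{-1})\,d\mathbb{W}_h(x)$. *The group $H$.* Let $H(\mathbb{A}_F)=\left\{g\in\mathrm{GL}_2(\mathbb{A}_E): g=\left(\begin{smallmatrix}&1\\1&\end{smallmatrix}\right){}^{\iota}g^{-t}\left(\begin{smallmatrix}&1\\1&\end{smallmatrix}\right)\right\}$,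 the adelic points of $\mathrm{Res}_{F'/F}$ of a quasi-split unitary group in two variables, with $H(F)=H(\mathbb{A}_F)\cap\mathrm{GL}_2(E)$, and let $B_H(\mathbb{A}_F)$ be its subgroup of upper triangular matrices. Let $\mathfrak{F}\subseteq H(\mathbb{A}_F)$ be a measurable set with $H(F)\mathfrak{F}=H(\mathbb{A}_F)$ and $\gamma\mathfrak{F}\cap\mathfrak{F}=\emptyset$ for all $1\neq\gamma\in H(F)$, contained in $$\left\{\omega\left(\begin{smallmatrix}t&\\&t^{-1}\end{smallmatrix}\right)k:\omega\in\Omega,\ t>T,\ k\in K\right\}\cap H(\mathbb{A}_F)$$ for some $T>0$ and some compact $\Omega\subseteq B_H(\mathbb{A}_F)$, where $\left(\begin{smallmatrix}t&\\&t^{-1}\end{smallmatrix}\right)$ is embedded diagonally at the infinite places. **Proposition.** Let $\Psi\in C_c^\infty(G(\mathbb{A}_F)^1/\!/K)$. Then the function $$V_\Psi:=\int_{\mathfrak{F}}\ \sum_{y\in E^\times}\Psi*\mathbb{W}_{\left(\begin{smallmatrix}y&\\&1\end{smallmatrix}\right)h}\,dh$$ is well defined (for every $g$, the integral defining $\Psi*\mathbb{W}_{\left(\begin{smallmatrix}y&\\&1\end{smallmatrix}\right)h}(g)$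 is absolutely convergent for all $y\in E^\times$ and $h\in\mathfrak{F}$, the sum over $y$ is absolutely convergent for all $h\in\mathfrak F$, and its value is integrable in $h$ over $\mathfrak{F}$), and $V_\Psi\in\mathcal{C}(G(\mathbb{A}_F)^1)$. -/

import Mathlib

open NumberField IsDedekindDomain MeasureTheory
open scoped NumberField ContDiff

set_option linter.unusedSectionVars false

noncomputable section

namespace GL2Adelic

/-! ## Matrices over a commutative ring -/

section Matrices

variable {R : Type*} [CommRing R]

/-- The matrix `(a 0; 0 b)`. -/
def diagGL (a b : Rˣ) : GL (Fin 2) R where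
  val := !![(a : R), 0; 0, (b : R)]
  inv := !![((a⁻¹ : Rˣ) : R), 0; 0, ((b⁻¹ : Rˣ) : R)]
  val_inv := by ext i j; fin_cases i <;> fin_cases j <;> simp [Matrix.mul_apply]
  inv_val := by ext i j; fin_cases i <;> fin_cases j <;> simp [Matrix.mul_apply]

/-- The matrix `(1 t; 0 1)`. -/
def unipGL (t : R) : GL (Fin 2) R where
  val := !![1, t; 0, 1]
  inv := !![1, -t; 0, 1]
  val_inv := by ext i j; fin_cases i <;> fin_cases j <;> simp [Matrix.mul_apply]
  inv_val := by ext i j; fin_cases i <;> fin_cases j <;> simp [Matrix.mul_apply]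

/-- The antidiagonal matrix `J = (0 1; 1 0)`. -/
def antiDiag (R : Type*) [CommRing R] : Matrix (Fin 2) (Fin 2) R := !![0, 1; 1, 0]

theorem antiDiag_mul_self : antiDiag R * antiDiag R = 1 := by
  ext i j; fin_cases i <;> fin_cases j <;> simp [antiDiag, Matrix.mul_apply]

/-- For an endomorphism `σ` of `R`, the group of `g ∈ GL₂(R)` with `g = J · ᵗ(σ g)⁻¹ · J`. -/
def unitaryTwo (σ : R →+* R) : Subgroup (GL (Fin 2) R) where
  carrier := {g | (g : Matrix (Fin 2) (Fin 2) R) =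
    antiDiag R * (((Matrix.GeneralLinearGroup.map σ g)⁻¹ : GL (Fin 2) R) :
      Matrix (Fin 2) (Fin 2) R).transpose * antiDiag R}
  one_mem' := by
    simp [antiDiag_mul_self]
  mul_mem' := by
    intro g h hg hh
    simp only [Set.mem_ofPred_eq] at hg hh ⊢
    rw [map_mul, mul_inv_rev, Units.val_mul, Units.val_mul, Matrix.transpose_mul]
    conv_lhs => rw [hg, hh]
    simp only [Matrix.mul_assoc]
    rw [← Matrix.mul_assoc (antiDiag R) (antiDiag R), antiDiag_mul_self, Matrix.one_mul]
  inv_mem' := by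
    intro g hg
    simp only [Set.mem_ofPred_eq] at hg ⊢
    rw [map_inv, inv_inv]
    have h1 : antiDiag R * ((Matrix.GeneralLinearGroup.map σ g : GL (Fin 2) R) :
        Matrix (Fin 2) (Fin 2) R).transpose * antiDiag R * (g : Matrix (Fin 2) (Fin 2) R) = 1 := by
      conv_lhs => rw [hg]
      simp only [Matrix.mul_assoc]
      rw [← Matrix.mul_assoc (antiDiag R) (antiDiag R), antiDiag_mul_self, Matrix.one_mul,
        ← Matrix.mul_assoc (Matrix.transpose _) (Matrix.transpose _), ← Matrix.transpose_mul,
        ← Units.val_mul, inv_mul_cancel, Units.val_one, Matrix.transpose_one, Matrix.one_mul,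
        antiDiag_mul_self]
    calc ((g⁻¹ : GL (Fin 2) R) : Matrix (Fin 2) (Fin 2) R)
        = (antiDiag R * ((Matrix.GeneralLinearGroup.map σ g : GL (Fin 2) R) :
            Matrix (Fin 2) (Fin 2) R).transpose * antiDiag R *
              (g : Matrix (Fin 2) (Fin 2) R)) * ((g⁻¹ : GL (Fin 2) R) : _) := by
          rw [h1, Matrix.one_mul]
      _ = _ := by
          rw [Matrix.mul_assoc _ (g : Matrix (Fin 2) (Fin 2) R), ← Units.val_mul, mul_inv_cancel,
            Units.val_one, Matrix.mul_one]

end Matrices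

variable {E : Type*} [Field E] [NumberField E]

/-! ## The action of the automorphisms of `E` on the adeles of `E` -/

/-- The prime `σ⁻¹(v)`, i.e. the finite place `x ↦ |σ x|_v`. -/
def finPullback (σ : E ≃+* E) (v : HeightOneSpectrum (𝓞 E)) : HeightOneSpectrum (𝓞 E) :=
  HeightOneSpectrum.comap (RingOfIntegers.mapRingEquiv σ : 𝓞 E →+* 𝓞 E)
    (RingOfIntegers.mapRingEquiv σ).surjective v

theorem intValuation_finPullback (σ : E ≃+* E) (v : HeightOneSpectrum (𝓞 E)) (r : 𝓞 E) :
    (finPullback σ v).intValuation r = v.intValuation (RingOfIntegers.mapRingEquiv σ r) := by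
  have key : ∀ n : ℕ, (finPullback σ v).intValuation r ≤ WithZero.exp (-(n : ℤ)) ↔
      v.intValuation (RingOfIntegers.mapRingEquiv σ r) ≤ WithZero.exp (-(n : ℤ)) := by
    intro n
    rw [HeightOneSpectrum.intValuation_le_pow_iff_mem, HeightOneSpectrum.intValuation_le_pow_iff_mem]
    have : (finPullback σ v).asIdeal ^ n
        = (v.asIdeal ^ n).comap (RingOfIntegers.mapRingEquiv σ : 𝓞 E →+* 𝓞 E) := by
      change (v.asIdeal.comap (RingOfIntegers.mapRingEquiv σ)) ^ n
        = (v.asIdeal ^ n).comap (RingOfIntegers.mapRingEquiv σ)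
      rw [← Ideal.map_symm, ← Ideal.map_symm, Ideal.map_pow]
    rw [this, Ideal.mem_comap]; rfl
  by_cases hr : r = 0
  · subst hr; simp
  have hr' : RingOfIntegers.mapRingEquiv σ r ≠ 0 := by simpa using hr
  obtain ⟨a, ha⟩ : ∃ a : ℕ, (finPullback σ v).intValuation r = WithZero.exp (-(a : ℤ)) :=
    ⟨_, HeightOneSpectrum.intValuation_eq_exp_neg_multiplicity _ hr⟩
  obtain ⟨b, hb⟩ : ∃ b : ℕ, v.intValuation (RingOfIntegers.mapRingEquiv σ r)
      = WithZero.exp (-(b : ℤ)) :=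
    ⟨_, HeightOneSpectrum.intValuation_eq_exp_neg_multiplicity _ hr'⟩
  apply le_antisymm
  · rw [hb, key, hb]
  · rw [ha, ← key, ha]

theorem valuation_finPullback (σ : E ≃+* E) (v : HeightOneSpectrum (𝓞 E)) (x : E) :
    (finPullback σ v).valuation E x = v.valuation E (σ x) := by
  obtain ⟨r, s, -, rfl⟩ := IsFractionRing.div_surjective (A := 𝓞 E) x
  have h : ∀ t : 𝓞 E, σ (algebraMap (𝓞 E) E t)
      = algebraMap (𝓞 E) E (RingOfIntegers.mapRingEquiv σ t) := fun _ => rfl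
  rw [map_div₀, map_div₀, map_div₀, h, h]
  simp only [HeightOneSpectrum.valuation_of_algebraMap, intValuation_finPullback]

/-- `σ : E → E`, from the topology of `σ⁻¹(v)` to the topology of `v`. -/
def finLocalHom (σ : E ≃+* E) (v : HeightOneSpectrum (𝓞 E)) :
    WithVal ((finPullback σ v).valuation E) →+* WithVal (v.valuation E) :=
  ((WithVal.equiv (v.valuation E)).symm.toRingHom.comp (σ : E →+* E)).comp
    (WithVal.equiv ((finPullback σ v).valuation E)).toRingHom


theorem continuous_finLocalHom (σ : E ≃+* E) (v : HeightOneSpectrum (𝓞 E)) :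
    Continuous (finLocalHom σ v) := by
  apply continuous_of_continuousAt_zero
  rw [ContinuousAt, map_zero, (Valued.hasBasis_nhds_zero _ _).tendsto_iff
    (Valued.hasBasis_nhds_zero _ _)]
  intro γ _
  obtain ⟨a, ha⟩ := (finPullback σ v).valuation_surjective E
    (MonoidWithZeroHom.ValueGroup₀.embedding γ.1)
  let a' : WithVal ((finPullback σ v).valuation E) := (WithVal.equiv _).symm a
  have ha' : Valued.v a' = MonoidWithZeroHom.ValueGroup₀.embedding γ.1 := ha
  have hne : (Valued.v : Valuation (WithVal ((finPullback σ v).valuation E)) _).restrict a' ≠ 0 := by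
    intro h0
    have := Valuation.embedding_restrict (v := (Valued.v :
      Valuation (WithVal ((finPullback σ v).valuation E)) _)) a'
    rw [h0, map_zero, ha'] at this
    exact γ.ne_zero (MonoidWithZeroHom.ValueGroup₀.embedding_strictMono.injective
      (by rw [← this, map_zero]))
  refine ⟨Units.mk0 _ hne, trivial, fun x hx => ?_⟩
  simp only [Units.val_mk0, Set.mem_ofPred_eq, Valuation.restrict_lt_iff] at hx
  simp only [Set.mem_ofPred_eq, Valuation.restrict_lt_iff_lt_embedding]
  rw [← ha']
  refine lt_of_eq_of_lt ?_ hx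
  exact (valuation_finPullback σ v (WithVal.equiv _ x)).symm

/-- The extension `E_{σ⁻¹ v} → E_v` of `σ` to completions. -/
def finCompletionHom (σ : E ≃+* E) (v : HeightOneSpectrum (𝓞 E)) :
    (finPullback σ v).adicCompletion E →+* v.adicCompletion E :=
  ((HeightOneSpectrum.adicCompletion.equiv E v).symm.toRingHom.comp
    (UniformSpace.Completion.mapRingHom (finLocalHom σ v) (continuous_finLocalHom σ v))).comp
      (HeightOneSpectrum.adicCompletion.equiv E (finPullback σ v)).toRingHom

theorem finCompletionHom_integral (σ : E ≃+* E) (v : HeightOneSpectrum (𝓞 E))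
    (x : (finPullback σ v).adicCompletion E) (hx : Valued.v x ≤ 1) :
    Valued.v (finCompletionHom σ v x) ≤ 1 := by
  suffices H : ∀ y : ((finPullback σ v).valuation E).Completion, Valued.v y ≤ 1 →
      Valued.v (UniformSpace.Completion.mapRingHom (finLocalHom σ v)
        (continuous_finLocalHom σ v) y) ≤ 1 from H x.toCompletion hx
  intro y
  refine UniformSpace.Completion.induction_on y ?_ ?_
  · simp only [imp_iff_not_or]
    have h₁ : IsClopen {y : ((finPullback σ v).valuation E).Completion | Valued.v y ≤ 1} :=
      Valued.isClopen_integer ((finPullback σ v).valuation E).Completion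
    have h₂ : IsClopen {y : (v.valuation E).Completion | Valued.v y ≤ 1} :=
      Valued.isClopen_integer (v.valuation E).Completion
    exact h₁.compl.isClosed.union (h₂.isClosed.preimage UniformSpace.Completion.continuous_map)
  · intro e he
    rw [UniformSpace.Completion.mapRingHom_coe]
    rw [Valued.valuedCompletion_apply] at he ⊢
    refine le_of_eq_of_le ?_ he
    exact (valuation_finPullback σ v (WithVal.equiv _ e)).symm

/-- `σ : E → E`, from the absolute value `x ↦ |σ x|_w` to the absolute value `|·|_w`. -/
def infLocalHom (σ : E ≃+* E) (w : InfinitePlace E) :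
    WithAbs (w.comap (σ : E →+* E)).1 →+* WithAbs w.1 :=
  ((WithAbs.equiv w.1).symm.toRingHom.comp (σ : E →+* E)).comp
    (WithAbs.equiv (w.comap (σ : E →+* E)).1).toRingHom

theorem isometry_infLocalHom (σ : E ≃+* E) (w : InfinitePlace E) :
    Isometry (infLocalHom σ w) :=
  AddMonoidHomClass.isometry_of_norm _ fun _ => rfl

/-- The extension `E_{w ∘ σ} → E_w` of `σ` to completions. -/
def infCompletionHom (σ : E ≃+* E) (w : InfinitePlace E) :
    (w.comap (σ : E →+* E)).Completion →+* w.Completion :=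
  ((InfinitePlace.Completion.equiv w).symm.toRingHom.comp
    (isometry_infLocalHom σ w).mapRingHom).comp
      (InfinitePlace.Completion.equiv (w.comap (σ : E →+* E))).toRingHom

theorem finPullback_injective (σ : E ≃+* E) :
    Function.Injective (finPullback (E := E) σ) :=
  (HeightOneSpectrum.equivOfRingEquiv (RingOfIntegers.mapRingEquiv σ)).symm.injective

/-- The action of `σ` on `E_∞`: `(σ x)_w = σ (x_{w ∘ σ})`. -/
def galInf (σ : E ≃+* E) : InfiniteAdeleRing E →+* InfiniteAdeleRing E :=
  RingHom.pi fun w => (infCompletionHom σ w).comp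
    (Pi.evalRingHom (fun w : InfinitePlace E => w.Completion) (w.comap (σ : E →+* E)))

/-- The action of `σ` on the finite adeles: `(σ x)_v = σ (x_{σ⁻¹ v})`. -/
def galFin (σ : E ≃+* E) : FiniteAdeleRing (𝓞 E) E →+* FiniteAdeleRing (𝓞 E) E :=
  RestrictedProduct.mapAlongRingHom
    (fun v : HeightOneSpectrum (𝓞 E) => v.adicCompletion E)
    (fun v : HeightOneSpectrum (𝓞 E) => v.adicCompletion E)
    (finPullback σ) (finPullback_injective σ).tendsto_cofinite (finCompletionHom σ)
    (Filter.Eventually.of_forall fun v x hx => finCompletionHom_integral σ v x hx)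

/-- The action of a field automorphism `σ` of `E` on the adele ring `𝔸_E`. -/
def galAdele (σ : E ≃+* E) : AdeleRing (𝓞 E) E →+* AdeleRing (𝓞 E) E :=
  RingHom.prodMap (galInf σ) (galFin σ)

/-- On the principal adeles, the action is that of `σ` on `E`. -/
theorem galAdele_algebraMap (σ : E ≃+* E) (x : E) :
    galAdele σ (algebraMap E (AdeleRing (𝓞 E) E) x) = algebraMap E (AdeleRing (𝓞 E) E) (σ x) := by
  refine Prod.ext (funext fun w => ?_) (FiniteAdeleRing.ext E fun v => ?_)
  · exact InfinitePlace.Completion.ext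
      ((isometry_infLocalHom σ w).mapRingHom_coe ((WithAbs.equiv _).symm x))
  · exact congrArg HeightOneSpectrum.adicCompletion.ofCompletion
      (UniformSpace.Completion.mapRingHom_coe (continuous_finLocalHom σ v) ((WithVal.equiv _).symm x))

/-! ## The adelic groups -/

variable (E) in
/-- `G(𝔸_F) = GL₂(𝔸_E)`. -/
abbrev GA : Type _ := GL (Fin 2) (AdeleRing (𝓞 E) E)

instance : MeasurableSpace (GA E) := borel _

instance : BorelSpace (GA E) := ⟨rfl⟩

/-- The component of an adelic matrix in `G(F_∞) = GL₂(E_∞)`. -/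
def toInf : GA E →* GL (Fin 2) (InfiniteAdeleRing E) :=
  Matrix.GeneralLinearGroup.map
    (RingHom.fst (InfiniteAdeleRing E) (FiniteAdeleRing (𝓞 E) E))

/-- The component of an adelic matrix in `GL₂(𝔸_E^∞)`. -/
def toFin : GA E →* GL (Fin 2) (FiniteAdeleRing (𝓞 E) E) :=
  Matrix.GeneralLinearGroup.map
    (RingHom.snd (InfiniteAdeleRing E) (FiniteAdeleRing (𝓞 E) E))

/-- The adelic matrix with infinite part `A` and finite part `B`. -/
def pairMatrix (A : Matrix (Fin 2) (Fin 2) (InfiniteAdeleRing E))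
    (B : Matrix (Fin 2) (Fin 2) (FiniteAdeleRing (𝓞 E) E)) :
    Matrix (Fin 2) (Fin 2) (AdeleRing (𝓞 E) E) :=
  Matrix.of fun i j => (A i j, B i j)

theorem pairMatrix_mul (A A' : Matrix (Fin 2) (Fin 2) (InfiniteAdeleRing E))
    (B B' : Matrix (Fin 2) (Fin 2) (FiniteAdeleRing (𝓞 E) E)) :
    pairMatrix A B * pairMatrix A' B' = pairMatrix (A * A') (B * B') := by
  ext i j
  simp only [Matrix.mul_apply, pairMatrix, Fin.sum_univ_two]
  rfl

theorem pairMatrix_one :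
    pairMatrix (1 : Matrix (Fin 2) (Fin 2) (InfiniteAdeleRing E)) 1 = 1 := by
  ext i j
  fin_cases i <;> fin_cases j <;> rfl

/-- The inclusion `G(F_∞) → G(𝔸_F)`. -/
def ofInf (g : GL (Fin 2) (InfiniteAdeleRing E)) : GA E where
  val := pairMatrix (g : Matrix (Fin 2) (Fin 2) (InfiniteAdeleRing E)) 1
  inv := pairMatrix ((g⁻¹ : GL (Fin 2) (InfiniteAdeleRing E)) :
    Matrix (Fin 2) (Fin 2) (InfiniteAdeleRing E)) 1
  val_inv := by
    rw [pairMatrix_mul, ← Units.val_mul, mul_inv_cancel, Matrix.one_mul, Units.val_one,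
      pairMatrix_one]
  inv_val := by
    rw [pairMatrix_mul, ← Units.val_mul, inv_mul_cancel, Matrix.one_mul, Units.val_one,
      pairMatrix_one]

/-- The inclusion `G(F) = GL₂(E) → G(𝔸_F)`. -/
def ofRat : GL (Fin 2) E →* GA E :=
  Matrix.GeneralLinearGroup.map (algebraMap E (AdeleRing (𝓞 E) E))

/-- The idelic norm of the finite part of an adele (used for ideles only). -/
def finAbs (x : FiniteAdeleRing (𝓞 E) E) : ℝ := ∏ᶠ v : HeightOneSpectrum (𝓞 E), ‖x v‖

theorem finite_norm_ne_one (x : (AdeleRing (𝓞 E) E)ˣ) :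
    (Function.mulSupport fun v : HeightOneSpectrum (𝓞 E) =>
      ‖(x : AdeleRing (𝓞 E) E).2 v‖).Finite := by
  have hu : IsUnit ((x : AdeleRing (𝓞 E) E).2) :=
    x.isUnit.map (RingHom.snd (InfiniteAdeleRing E) (FiniteAdeleRing (𝓞 E) E))
  refine ((FiniteAdeleRing.isUnit_iff.1 hu).2).subset fun v hv hv' => hv ?_
  have h : Valued.v ((x : AdeleRing (𝓞 E) E).2 v) = 1 := hv'
  simp [FinitePlace.norm_def, h]

/-- The idelic norm `|x| = ∏_w |x|_w`, with normalized local absolute values. -/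
def ideleNorm : (AdeleRing (𝓞 E) E)ˣ →* ℝ where
  toFun x := (∏ w : InfinitePlace E, ‖(x : AdeleRing (𝓞 E) E).1 w‖ ^ w.mult) *
    finAbs (x : AdeleRing (𝓞 E) E).2
  map_one' := by
    have h1 : ∀ w : InfinitePlace E, ‖((1 : (AdeleRing (𝓞 E) E)ˣ) : AdeleRing (𝓞 E) E).1 w‖ = 1 :=
      fun w => norm_one (α := w.Completion)
    have h2 : ∀ v : HeightOneSpectrum (𝓞 E),
        ‖((1 : (AdeleRing (𝓞 E) E)ˣ) : AdeleRing (𝓞 E) E).2 v‖ = 1 :=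
      fun v => norm_one (α := v.adicCompletion E)
    simp only [h1, finAbs, h2, one_pow, Finset.prod_const_one, finprod_one, mul_one]
  map_mul' x y := by
    have h1 : ∀ w : InfinitePlace E, ‖((x * y : (AdeleRing (𝓞 E) E)ˣ) : AdeleRing (𝓞 E) E).1 w‖ =
        ‖(x : AdeleRing (𝓞 E) E).1 w‖ * ‖(y : AdeleRing (𝓞 E) E).1 w‖ :=
      fun w => norm_mul (α := w.Completion) _ _
    have h2 : ∀ v : HeightOneSpectrum (𝓞 E),
        ‖((x * y : (AdeleRing (𝓞 E) E)ˣ) : AdeleRing (𝓞 E) E).2 v‖ =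
          ‖(x : AdeleRing (𝓞 E) E).2 v‖ * ‖(y : AdeleRing (𝓞 E) E).2 v‖ :=
      fun v => norm_mul (α := v.adicCompletion E) _ _
    simp only [h1, finAbs, h2, mul_pow, Finset.prod_mul_distrib]
    rw [finprod_mul_distrib (finite_norm_ne_one x) (finite_norm_ne_one y)]
    ring

variable (E) in
/-- `G(𝔸_F)^1`, the group of `g ∈ GL₂(𝔸_E)` with `|det g| = 1`. -/
def GAOne : Subgroup (GA E) := (ideleNorm.comp Matrix.GeneralLinearGroup.det).ker

variable (E) in
/-- The group `∏_{w ∣ ∞} GL₂(E_w)^1 × GL₂(𝔸_E^∞)`: the `g ∈ GL₂(𝔸_E)` such that `|det g|_w = 1`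
for every infinite place `w`. -/
def GAArchOne : Subgroup (GA E) where
  carrier := {g | ∀ w : InfinitePlace E,
    ‖((Matrix.GeneralLinearGroup.det g : (AdeleRing (𝓞 E) E)ˣ) : AdeleRing (𝓞 E) E).1 w‖ = 1}
  one_mem' w := by
    rw [map_one]
    exact norm_one (α := w.Completion)
  mul_mem' {g h} hg hh w := by
    rw [map_mul]
    exact (norm_mul (α := w.Completion) _ _).trans (by rw [hg w, hh w, one_mul])
  inv_mem' {g} hg w := by
    have h : ‖((Matrix.GeneralLinearGroup.det g⁻¹ * Matrix.GeneralLinearGroup.det g :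
        (AdeleRing (𝓞 E) E)ˣ) : AdeleRing (𝓞 E) E).1 w‖ = 1 := by
      rw [← map_mul, inv_mul_cancel, map_one]
      exact norm_one (α := w.Completion)
    have h' := (norm_mul (α := w.Completion) _ _).symm.trans h
    rwa [hg w, mul_one] at h'

/-! ## The group `G(F_∞)` in real coordinates

`ℝ^{r₁} × ℂ^{r₂}` is the real algebra `E_∞ = E ⊗ ℝ`, identified with the product of the
archimedean completions of `E`. -/

open mixedEmbedding in
open scoped Classical in
/-- The element of `G(F_∞)` given by an invertible matrix over `ℝ^{r₁} × ℂ^{r₂}`; by convention,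
the identity if the matrix is not invertible. -/
def glInf (M : Matrix (Fin 2) (Fin 2) (mixedSpace E)) : GL (Fin 2) (InfiniteAdeleRing E) :=
  if h : IsUnit M.det then
    Matrix.GeneralLinearGroup.map
      ((InfiniteAdeleRing.ringEquiv_mixedSpace E).symm : mixedSpace E →+* InfiniteAdeleRing E)
      (Matrix.nonsingInvUnit M h)
  else 1

open mixedEmbedding in
/-- The element of `ℝ^{r₁} × ℂ^{r₂}` with the given real components. -/
def realVec (r : InfinitePlace E → ℝ) : mixedSpace E := (fun w => r w.1, fun w => (r w.1 : ℂ))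

/-- For positive `r_w`, the scalar matrix of `G(F_∞) ⊆ G(𝔸_F)` with component `r_w` at `w ∣ ∞`. -/
def scalarInf (r : InfinitePlace E → ℝ) : GA E :=
  ofInf (glInf (Matrix.diagonal fun _ => realVec r))

/-- For `t > 0`, the matrix `(t 0; 0 t⁻¹)` at every infinite place, as an element of `G(𝔸_F)`. -/
def torusInf (t : ℝ) : GA E :=
  ofInf (glInf (Matrix.diagonal ![realVec fun _ => t, realVec fun _ => t⁻¹]))

variable (E) in
/-- The real Lie algebra `𝔤𝔩₂(E_∞)` of `G(F_∞)`. -/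
abbrev LieInf : Type _ := Matrix (Fin 2) (Fin 2) (mixedEmbedding.mixedSpace E)

/-- The one-parameter subgroup `s ↦ exp(sX)` of `G(F_∞)`, as a subgroup of `G(𝔸_F)`. -/
def expInf (X : LieInf E) (s : ℝ) : GA E := ofInf (glInf (NormedSpace.exp (s • X)))

/-- `(X * f)(g) = d/ds f(exp(-sX) g)` at `s = 0`. -/
def leftDeriv (X : LieInf E) (f : GA E → ℂ) (g : GA E) : ℂ :=
  deriv (fun s : ℝ => f (expInf X (-s) * g)) 0

/-- `(f * Y)(g) = d/ds f(g exp(-sY))` at `s = 0`. -/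
def rightDeriv (Y : LieInf E) (f : GA E → ℂ) (g : GA E) : ℂ :=
  deriv (fun s : ℝ => f (g * expInf Y (-s))) 0

variable (E) in
/-- Formal `ℂ`-linear combinations of words `X₁ X₂ ⋯ X_k` in elements of the real Lie algebra of
`G(F_∞)`. The universal enveloping algebra `U(𝔤)` of the complexified Lie algebra `𝔤` is the
quotient of this space by the relations that hold in it, and `U(𝔤)` acts on smooth functions
through the action of words, so `X * f * Y` below runs over the same functions as it does for
`X, Y ∈ U(𝔤)`. -/
abbrev EnvelopingWords : Type _ := List (LieInf E) →₀ ℂ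

/-- `X * f * Y`, for `X` and `Y` in `U(𝔤)`. -/
def envConv (X : EnvelopingWords E) (f : GA E → ℂ) (Y : EnvelopingWords E) (g : GA E) : ℂ :=
  X.sum fun u a => Y.sum fun u' b => a * b * (u.foldr leftDeriv (u'.reverse.foldr rightDeriv f)) g

open mixedEmbedding in
open scoped Classical in
/-- For every `g ∈ G(𝔸_F)`, the function `x ↦ f(g x)` on the Lie group `G(F_∞)` is smooth. -/
def SmoothAtInf (f : GA E → ℂ) : Prop :=
  ∀ g : GA E, ContDiffOn ℝ ∞
    (fun M : Fin 2 → Fin 2 → mixedSpace E => f (g * ofInf (glInf (Matrix.of M))))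
    {M | IsUnit (Matrix.of M).det}

/-! ## Maximal compact subgroups and function spaces

Functions on `G(𝔸_F)^1` are identified with functions on `G(𝔸_F)` that are invariant under the
group `ℝ_{>0}` of scalar matrices `t ∈ ℝ_{>0} ⊆ E_∞ˣ`, by `G(𝔸_F) = G(𝔸_F)^1 × ℝ_{>0}`. -/

variable (E) in
/-- The standard maximal compact subgroup of `G(F_∞)`: orthogonal matrices at the real places,
unitary matrices at the complex places. -/
def KInf : Set (GL (Fin 2) (InfiniteAdeleRing E)) :=
  {k | ∀ w : InfinitePlace E,
    (Matrix.of fun i j => InfinitePlace.Completion.extensionEmbedding w (k i j w)) ∈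
      Matrix.unitaryGroup (Fin 2) ℂ}

variable (E) in
/-- `GL₂` of the integral finite adeles of `E`. -/
def KFin : Set (GL (Fin 2) (FiniteAdeleRing (𝓞 E) E)) :=
  {k | ∀ (v : HeightOneSpectrum (𝓞 E)) (i j : Fin 2), Valued.v (k i j v) ≤ 1 ∧
    Valued.v ((k⁻¹ : GL (Fin 2) (FiniteAdeleRing (𝓞 E) E)) i j v) ≤ 1}

variable (E) in
/-- `K = K_∞ K^∞` in `G(𝔸_F)`. -/
def KA : Set (GA E) := {k | toInf k ∈ KInf E ∧ toFin k ∈ KFin E}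

/-- The function on `G(𝔸_F)` comes from `G(𝔸_F)^1`, as explained above. -/
def IsScalarInvariant (f : GA E → ℂ) : Prop :=
  ∀ t : ℝ, 0 < t → ∀ g : GA E, f (scalarInf (fun _ => t) * g) = f g

/-- `Ψ ∈ C_c^∞(G(𝔸_F)^1 // K)`. -/
structure IsHeckeFunction (Ψ : GA E → ℂ) : Prop where
  scalar : IsScalarInvariant Ψ
  smooth : SmoothAtInf Ψ
  bi_inv : ∀ k ∈ KA E, ∀ k' ∈ KA E, ∀ g : GA E, Ψ (k * g * k') = Ψ g
  compact_support : HasCompactSupport fun g : GAOne E => Ψ g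

/-- `f ∈ 𝒞(G(𝔸_F)^1) = 𝒞(G(𝔸_F)^1, K^∞)`, where `μ` is a Haar measure on `G(𝔸_F)^1`. -/
structure MemC (μ : Measure (GAOne E)) (f : GA E → ℂ) : Prop where
  scalar : IsScalarInvariant f
  smooth : SmoothAtInf f
  right_inv : ∀ k : GA E, toInf k = 1 → toFin k ∈ KFin E → ∀ g : GA E, f (g * k) = f g
  integrable : ∀ X Y : EnvelopingWords E, Integrable (fun g : GAOne E => envConv X f Y g) μ

/-! ## The additive character and the distributions `𝕎_h` -/

open scoped Classical in
/-- The finite part of `ψ_ℚ ∘ tr`: if `a` is congruent to `e ∈ E` modulo the integral finite adeles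
(such a principal part `e` exists and is unique up to `𝓞 E`), the value is `exp(2πi tr_{E/ℚ} e)`. -/
def psiFin (a : FiniteAdeleRing (𝓞 E) E) : ℂ :=
  if h : ∃ e : E, ∀ v : HeightOneSpectrum (𝓞 E),
      Valued.v ((a - algebraMap E (FiniteAdeleRing (𝓞 E) E) e) v) ≤ 1 then
    Complex.exp (2 * Real.pi * Complex.I * (Algebra.trace ℚ E h.choose : ℚ))
  else 1

/-- The infinite part `a ↦ exp(-2πi tr_{E_∞/ℝ} a)` of `ψ_ℚ ∘ tr`. -/
def psiInf (a : InfiniteAdeleRing E) : ℂ :=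
  Complex.exp (-2 * Real.pi * Complex.I *
    ((∑ w : InfinitePlace E,
      (w.mult : ℝ) * (InfinitePlace.Completion.extensionEmbedding w (a w)).re : ℝ) : ℂ))

/-- The additive character `ψ = ψ_ℚ ∘ tr` of `E \ 𝔸_E`. -/
def psi (a : AdeleRing (𝓞 E) E) : ℂ := psiInf a.1 * psiFin a.2

/-- `δ` is a finite idele (extended by `1` to the infinite places) whose ideal is the absolute
different of `E`. -/
def IsDifferentIdele (δ : (AdeleRing (𝓞 E) E)ˣ) : Prop :=
  (δ : AdeleRing (𝓞 E) E).1 = 1 ∧ ∀ v : HeightOneSpectrum (𝓞 E),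
    Valued.v ((δ : AdeleRing (𝓞 E) E).2 v) =
      WithZero.exp (-(multiplicity v.asIdeal (differentIdeal ℤ (𝓞 E)) : ℤ))

variable (E) in
/-- Coordinates `t`, `m`, `z` for the Iwasawa decomposition `h = (1 t; 0 1)(zm/δ 0; 0 z) k`. -/
structure IwasawaCoord where
  t : AdeleRing (𝓞 E) E
  m : (AdeleRing (𝓞 E) E)ˣ
  z : (AdeleRing (𝓞 E) E)ˣ

instance : Nonempty (IwasawaCoord E) := ⟨⟨0, 1, 1⟩⟩

/-- `h = (1 t; 0 1)(zm/δ 0; 0 z) k` for some `k ∈ K`. -/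
def IwasawaCoord.IsFor (δ : (AdeleRing (𝓞 E) E)ˣ) (h : GA E) (c : IwasawaCoord E) : Prop :=
  ∃ k ∈ KA E, h = unipGL c.t * diagGL (c.z * c.m * δ⁻¹) c.z * k

/-- A choice of Iwasawa coordinates of `h`. They always exist, and `𝕎_h` does not depend on the
choice. -/
def iwasawaCoord (δ : (AdeleRing (𝓞 E) E)ˣ) (h : GA E) : IwasawaCoord E :=
  Classical.epsilon (IwasawaCoord.IsFor δ h)

/-- `∏_{w ∣ ∞} exp(-[E_w:ℝ] tr(g_w^* g_w)) |det g_w|_w^{1/2}`. -/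
def gaussian (g : GL (Fin 2) (InfiniteAdeleRing E)) : ℝ :=
  ∏ w : InfinitePlace E, Real.exp (-(w.mult : ℝ) * ∑ i, ∑ j, ‖g i j w‖ ^ 2) *
    (‖((Matrix.GeneralLinearGroup.det g : (InfiniteAdeleRing E)ˣ) : InfiniteAdeleRing E) w‖ ^
      w.mult) ^ (1 / 2 : ℝ)

open scoped Classical in
/-- The characteristic function of the integral matrices `x` over the finite adeles such that
`det x` and `m` generate the same ideal. -/
def heckeIndicator (m : FiniteAdeleRing (𝓞 E) E) (x : GL (Fin 2) (FiniteAdeleRing (𝓞 E) E)) : ℝ :=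
  if (∀ (v : HeightOneSpectrum (𝓞 E)) (i j : Fin 2), Valued.v (x i j v) ≤ 1) ∧
      ∀ v : HeightOneSpectrum (𝓞 E),
        Valued.v (((Matrix.GeneralLinearGroup.det x : (FiniteAdeleRing (𝓞 E) E)ˣ) :
          FiniteAdeleRing (𝓞 E) E) v) = Valued.v (m v)
  then 1 else 0

open scoped Classical in
/-- The constant in front of `𝕎_h`: the product of `ψ(t)`, of `|m|_w^{1/2} / 2` over the infinite
places `w`, and of `𝟙_{𝓞_w}(m) |m|_w` over the finite places `w`. -/
def IwasawaCoord.coeff (c : IwasawaCoord E) : ℂ :=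
  psi c.t *
    ((∏ w : InfinitePlace E,
      (‖(c.m : AdeleRing (𝓞 E) E).1 w‖ ^ w.mult) ^ (1 / 2 : ℝ) / 2 : ℝ) : ℂ) *
    ((if ∀ v : HeightOneSpectrum (𝓞 E), Valued.v ((c.m : AdeleRing (𝓞 E) E).2 v) ≤ 1
      then finAbs (c.m : AdeleRing (𝓞 E) E).2 else 0 : ℝ) : ℂ)

/-- The scalar matrix of `G(F_∞)` with component `r_w = |m|_w^{1/(2[E_w:ℝ])}` at `w ∣ ∞` (the
normalized absolute value `|m|_w` is the `[E_w:ℝ]`-th power of the norm). -/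
def IwasawaCoord.radius (c : IwasawaCoord E) : GA E :=
  scalarInf fun w => Real.sqrt ‖(c.m : AdeleRing (𝓞 E) E).1 w‖

/-- The integrand of the integral over `∏_{w ∣ ∞} GL₂(E_w)^1 × GL₂(𝔸_E^∞)` that defines `𝕎_h(φ)`.

At an infinite place, `𝕎_h` is a constant times `(𝓕₁ δ_r)(z⁻¹ g)`, that is,
`φ ↦ ∫ 𝓕₁(r x) φ(z r x) dx` over `GL₂(E_w)^1`; at a finite place, it is a constant times
`𝟙_m(z⁻¹ g) dg`, that is, `φ ↦ ∫ 𝟙_m(x) φ(z x) dx` over `GL₂(E_w)`. -/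
def IwasawaCoord.integrand (c : IwasawaCoord E) (φ : GA E → ℂ) (x : GA E) : ℂ :=
  (gaussian (toInf (c.radius * x)) : ℂ) *
    (heckeIndicator (c.m : AdeleRing (𝓞 E) E).2 (toFin x) : ℂ) *
    φ (diagGL c.z c.z * c.radius * x)

/-- The value on `φ` of the distribution `𝕎_h = ∏_w 𝕎_{h_w}` on `G(𝔸_F)`, where `ν` is the Haar
measure used on `∏_{w ∣ ∞} GL₂(E_w)^1 × GL₂(𝔸_E^∞)`. -/
def whittakerDist (δ : (AdeleRing (𝓞 E) E)ˣ) (ν : Measure (GAArchOne E)) (h : GA E)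
    (φ : GA E → ℂ) : ℂ :=
  (iwasawaCoord δ h).coeff * ∫ x : GAArchOne E, (iwasawaCoord δ h).integrand φ x ∂ν

/-- The function `Ψ * 𝕎_h`, i.e. `g ↦ ∫ Ψ(g x⁻¹) d𝕎_h(x)`. -/
def convWhittaker (δ : (AdeleRing (𝓞 E) E)ˣ) (ν : Measure (GAArchOne E)) (Ψ : GA E → ℂ)
    (h g : GA E) : ℂ :=
  whittakerDist δ ν h fun x => Ψ (g * x⁻¹)

/-! ## The unitary group and the function `V` -/

section Unitary

variable {F : Type*} [Field F] [Algebra F E]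

/-- `H(F) = U₂(F')`, where `F'` is the fixed field of `ι`. -/
def HRat (ι : E ≃ₐ[F] E) : Subgroup (GL (Fin 2) E) := unitaryTwo ((ι : E ≃+* E) : E →+* E)

/-- `H(𝔸_F) = U₂(𝔸_{F'})`, a subgroup of `GL₂(𝔸_E)`. -/
def HA (ι : E ≃ₐ[F] E) : Subgroup (GA E) := unitaryTwo (galAdele (ι : E ≃+* E))

/-- `𝔉` is a measurable subset of `H(𝔸_F)` with `H(F) 𝔉 = H(𝔸_F)` whose translates under distinct
elements of `H(F)` are disjoint. -/
structure IsFundamentalDomainH (ι : E ≃ₐ[F] E) (𝔉 : Set (HA ι)) : Prop where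
  measurable : MeasurableSet 𝔉
  cover : ∀ h : HA ι, ∃ γ ∈ HRat ι, ∃ f ∈ 𝔉, (h : GA E) = ofRat γ * (f : GA E)
  disjoint : ∀ γ ∈ HRat ι, γ ≠ 1 → ∀ f ∈ 𝔉, ∀ f' ∈ 𝔉, ofRat γ * (f : GA E) ≠ (f' : GA E)

/-- `𝔉` is contained in `{Ω · (t 0; 0 t⁻¹) · K : t > T} ∩ H(𝔸_F)` for some `T > 0` and some compact
set `Ω` of upper triangular matrices in `H(𝔸_F)`. -/
def IsSiegelContained (ι : E ≃ₐ[F] E) (𝔉 : Set (HA ι)) : Prop :=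
  ∃ T : ℝ, 0 < T ∧ ∃ Ω : Set (GA E), IsCompact Ω ∧
    (∀ b ∈ Ω, b ∈ HA ι ∧ b 1 0 = 0) ∧
    ∀ f ∈ 𝔉, ∃ b ∈ Ω, ∃ t : ℝ, T < t ∧ ∃ k ∈ KA E, (f : GA E) = b * torusInf t * k

/-- The term `Ψ * 𝕎_{(y 0; 0 1) h}` for `y ∈ Eˣ`. -/
def vTerm (δ : (AdeleRing (𝓞 E) E)ˣ) (ν : Measure (GAArchOne E)) (Ψ : GA E → ℂ)
    (y : Eˣ) (h g : GA E) : ℂ :=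
  convWhittaker δ ν Ψ (ofRat (diagGL y 1) * h) g

/-- `V_Ψ = ∫_𝔉 ∑_{y ∈ Eˣ} Ψ * 𝕎_{(y 0; 0 1) h} dh`. -/
def vFunction (ι : E ≃ₐ[F] E) (δ : (AdeleRing (𝓞 E) E)ˣ) (ν : Measure (GAArchOne E))
    (η : Measure (HA ι)) (𝔉 : Set (HA ι)) (Ψ : GA E → ℂ) (g : GA E) : ℂ :=
  ∫ h in 𝔉, ∑' y : Eˣ, vTerm δ ν Ψ y (h : GA E) g ∂η

end Unitary

end GL2Adelic

end

noncomputable section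

namespace GL2Adelic

variable {E : Type*} [Field E] [NumberField E]

/-! ## Finite adeles -/

/-! In Iwasawa coordinates, `Ψ * 𝕎_h` at `g` is an integral of `A · Ψ(g u)` over `x` in `GAArchOne
E`, where `u = (z r x)⁻¹` and `A` is the product of the coefficient of `𝕎_h`, the Gaussian and the
Hecke indicator (`convWhittaker_eq`). Hence `V_Ψ` is one weighted average of right translates of
`Ψ`, over triples `(h, y, x)` in `𝔉 × Eˣ × GAArchOne E`. Everything reduces to a single estimate:
`A` times any power of the archimedean size of `x` is integrable (`IsWeight`).

Why moments suffice. Left derivatives commute with right translations, so they simply fall on `Ψ`. A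
right derivative along `Y` becomes the derivative of `Ψ` at `g u` along `u⁻¹ Y u`; scalars drop out
of this conjugation, and its coordinates are bounded by a multiple of the size of `x`, so they can
be absorbed into the weight. The span of all such averages is therefore stable under both kinds of
derivative (`exists_hasD_of_mem_averages`), which yields smoothness (`smoothAtInf_of_forall_hasD`)
and shows that every `X * V_Ψ * Y` is again a combination of averages. Each average is in `L¹` by
Fubini, because right translation preserves Haar measure on `G(𝔸_F)^1`; unimodularity is proved from
the generation of `GL₂(𝔸_E)` by elementary and diagonal matrices (`isMulRightInvariant_of_det`).

Why the moments are finite. The modulus of `A` is at most a product of factors `|m|_w exp(-[E_w:ℝ]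
‖m‖ ‖x‖²)` times the Hecke indicator. Part of the exponent buys any inverse power of the size of
`x`, and `exp(-∑ ‖m‖_w)` is kept (`pow_mul_exp_le`). The Haar volume of the matrices in the Hecke
set with entries at most `R` is polynomial in `R` and in an integer `n` divisible by `m`, by cutting
the set into cells (`measure_hecke_le`). On the Siegel set, `m` is the product of `y`, of the
coordinate of a point of a compact set, and of `t²`. Integrality of `m` puts `y` in `D⁻¹ 𝓞` for a
fixed `D`; there `n = |N(Dy)|` is polynomial in `y`, the archimedean norm of `m` is bounded below,
and the exponential dominates, leaving a convergent lattice sum and a factor `t^(-2Q)` with `Q ≠ 0`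
(`exists_tsum_lintegral_wWeight_le`). That factor is integrable over the Siegel set, which is
covered by translates of one compact set under the powers of `diag(2, 1/2)`
(`lintegral_siegel_lt_top`).

Measurability. The coordinates in the definition of `𝕎_h` are chosen without any regularity in `h`.
They are replaced by the explicit continuous functions `zAbs`, `mAbs`, `tRe` at infinity and by
`finCoord`, which is constant on cosets of `K^∞`. The replacement changes nothing because `Ψ` is
right `K`-invariant and `ψ` is trivial on the inverse different. -/

open WithZero in
theorem exists_int_valued_sub_le (v : HeightOneSpectrum (𝓞 E)) (x : v.adicCompletion E)
    (hx : Valued.v x ≤ 1) (n : ℕ) :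
    ∃ r : 𝓞 E, Valued.v (x - ((r : E) : v.adicCompletion E)) ≤ WithZero.exp (-(n : ℤ)) := by
  have hopen : IsOpen {y : v.adicCompletion E | Valued.v (x - y) < exp (-(n : ℤ))} := by
    have h : IsOpen {y : v.adicCompletion E | Valued.v y < exp (-(n : ℤ))} := by
      obtain ⟨a, ha⟩ := HeightOneSpectrum.valuedAdicCompletion_surjective E v (exp (-(n : ℤ)))
      rw [← ha]
      have := Valued.isOpen_ball (v.adicCompletion E) (Valued.v.restrict a)
      simpa only [Valuation.restrict_lt_iff] using this
    exact h.preimage (continuous_const.sub continuous_id)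
  -- Two approximations: `x` by `e ∈ E`, by density, and then `e`, which is integral at `v` by the
  -- ultrametric inequality, by an element of `𝓞 E`.
  obtain ⟨e, he⟩ := (v.denseRange_algebraMap E).exists_mem_open hopen ⟨x, by
    simp [exp_ne_zero, zero_lt_iff]⟩
  have he' : Valued.v (x - (e : v.adicCompletion E)) < exp (-(n : ℤ)) := he
  have hle : exp (-(n : ℤ)) ≤ 1 := by
    rw [← exp_zero, exp_le_exp]; simp
  have hint : v.valuation E e ≤ 1 := by
    rw [← HeightOneSpectrum.valuedAdicCompletion_eq_valuation' v e]
    have : (e : v.adicCompletion E) = x - (x - e) := by ring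
    rw [this]
    exact (Valuation.map_sub _ _ _).trans (max_le hx (he'.le.trans hle))
  obtain ⟨r, hr⟩ := HeightOneSpectrum.exists_valuation_sub_lt_of_integer v hint
    (Units.mk0 (exp (-(n : ℤ))) exp_ne_zero)
  refine ⟨r, ?_⟩
  have : x - ((r : E) : v.adicCompletion E)
      = (x - (e : v.adicCompletion E)) - (((algebraMap (𝓞 E) E r - e : E)) : v.adicCompletion E) := by
    have h := map_sub (algebraMap E (v.adicCompletion E)) (r : E) e
    change (((algebraMap (𝓞 E) E r - e : E)) : v.adicCompletion E) = _ at h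
    rw [h]
    change _ = (x - (e : v.adicCompletion E)) -
      (((r : E) : v.adicCompletion E) - (e : v.adicCompletion E))
    ring
  rw [this]
  refine (Valuation.map_sub _ _ _).trans (max_le he'.le ?_)
  rw [HeightOneSpectrum.valuedAdicCompletion_eq_valuation']
  exact hr.le

/-- A closed subset of a complete space is complete. It is totally bounded because representatives
of the finite ring `𝓞 E ⧸ v ^ n` form a finite net of mesh `q ^ (-n)`, with `q` the norm of `v`. -/
theorem isCompact_localIntegers (v : HeightOneSpectrum (𝓞 E)) :
    IsCompact {x : v.adicCompletion E | Valued.v x ≤ 1} := by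
  have hcl : IsClosed {x : v.adicCompletion E | Valued.v x ≤ 1} :=
    (Valued.isClopen_integer (v.adicCompletion E)).isClosed
  refine isCompact_iff_totallyBounded_isComplete.2 ⟨?_, hcl.isComplete⟩
  rw [Metric.totallyBounded_iff]
  intro ε hε
  have hq : 1 < (v.asIdeal.absNorm : ℝ) := by
    exact_mod_cast NumberField.HeightOneSpectrum.one_lt_absNorm v
  obtain ⟨n, hn⟩ := exists_pow_lt_of_lt_one hε (inv_lt_one_of_one_lt₀ hq)
  have hne : v.asIdeal ^ n ≠ ⊥ := pow_ne_zero _ v.ne_bot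
  have : Finite (𝓞 E ⧸ v.asIdeal ^ n) := Ideal.finiteQuotientOfFreeOfNeBot _ hne
  refine ⟨Set.range fun q : 𝓞 E ⧸ v.asIdeal ^ n =>
    (((Quotient.out q : 𝓞 E) : E) : v.adicCompletion E), Set.finite_range _, fun x hx => ?_⟩
  obtain ⟨r, hr⟩ := exists_int_valued_sub_le v x hx n
  simp only [Set.mem_iUnion, exists_prop, Set.exists_range_iff]
  refine ⟨Ideal.Quotient.mk _ r, ?_⟩
  set s : 𝓞 E := Quotient.out (Ideal.Quotient.mk (v.asIdeal ^ n) r) with hs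
  have hmem : r - s ∈ v.asIdeal ^ n := by
    rw [← Ideal.Quotient.eq, hs]; exact (Quotient.out_eq _).symm
  have hv2 : Valued.v (((algebraMap (𝓞 E) E (r - s) : E)) : v.adicCompletion E)
      ≤ WithZero.exp (-(n : ℤ)) := by
    rw [HeightOneSpectrum.valuedAdicCompletion_eq_valuation',
      HeightOneSpectrum.valuation_of_algebraMap, HeightOneSpectrum.intValuation_le_pow_iff_mem]
    exact hmem
  have hv3 : Valued.v (x - ((s : E) : v.adicCompletion E)) ≤ WithZero.exp (-(n : ℤ)) := by
    have : x - ((s : E) : v.adicCompletion E) = (x - ((r : E) : v.adicCompletion E)) +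
        (((algebraMap (𝓞 E) E (r - s) : E)) : v.adicCompletion E) := by
      have h := map_sub (algebraMap E (v.adicCompletion E)) (r : E) (s : E)
      rw [map_sub]
      change (((algebraMap (𝓞 E) E r - algebraMap (𝓞 E) E s : E)) : v.adicCompletion E) = _ at h
      rw [h]
      change _ = (x - ((r : E) : v.adicCompletion E)) +
        (((r : E) : v.adicCompletion E) - ((s : E) : v.adicCompletion E))
      ring
    rw [this]
    exact (Valuation.map_add _ _ _).trans (max_le hr hv2)
  rw [Metric.mem_ball, dist_eq_norm, FinitePlace.norm_def]
  refine lt_of_le_of_lt ?_ hn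
  have hmono := (WithZeroMulInt.toNNReal_strictMono
    (NumberField.HeightOneSpectrum.one_lt_absNorm_nnreal v)).monotone hv3
  have hexp : ((WithZeroMulInt.toNNReal (NumberField.HeightOneSpectrum.absNorm_ne_zero v)
      (WithZero.exp (-(n : ℤ))) : NNReal) : ℝ) = ((v.asIdeal.absNorm : ℝ)⁻¹) ^ n := by
    rw [WithZeroMulInt.toNNReal_neg_apply _ WithZero.exp_ne_zero]
    change (((v.asIdeal.absNorm : NNReal) ^ (-(n : ℤ)) : NNReal) : ℝ) = _
    simp
  rw [← hexp]
  exact_mod_cast hmono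

/-- A finite adele is integral at almost all places, so a product of finitely many local
denominators clears all of them. -/
theorem exists_int_mul_integral (a : FiniteAdeleRing (𝓞 E) E) :
    ∃ d : 𝓞 E, d ≠ 0 ∧ ∀ v : HeightOneSpectrum (𝓞 E),
      Valued.v (((d : E) : v.adicCompletion E) * a v) ≤ 1 := by
  classical
  have hfin : {v | ¬ Valued.v (a v) ≤ 1}.Finite := Filter.eventually_cofinite.1 a.2
  have hloc : ∀ v : HeightOneSpectrum (𝓞 E), ∃ b : 𝓞 E, b ≠ 0 ∧
      Valued.v (((b : E) : v.adicCompletion E) * a v) ≤ 1 := fun v => by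
    obtain ⟨b, hb, hb'⟩ := HeightOneSpectrum.adicCompletion.mul_nonZeroDivisor_mem_adicCompletionIntegers
      v (a v)
    exact ⟨b, nonZeroDivisors.ne_zero hb, by rw [mul_comm]; exact hb'⟩
  choose b hb0 hb using hloc
  refine ⟨∏ v ∈ hfin.toFinset, b v, Finset.prod_ne_zero_iff.2 fun v _ => hb0 v, fun v => ?_⟩
  have hint : ∀ c : 𝓞 E, Valued.v (((c : E) : v.adicCompletion E)) ≤ 1 := fun c =>
    HeightOneSpectrum.coe_mem_adicCompletionIntegers v c
  by_cases hv : Valued.v (a v) ≤ 1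
  · rw [map_mul]; exact mul_le_one' (hint _) hv
  · have hmem : v ∈ hfin.toFinset := by simpa using hv
    rw [← Finset.mul_prod_erase _ _ hmem]
    have h := map_mul (algebraMap E (v.adicCompletion E)) (b v : E)
      ((∏ x ∈ hfin.toFinset.erase v, b x : 𝓞 E) : E)
    have : (((b v * ∏ x ∈ hfin.toFinset.erase v, b x : 𝓞 E) : E) : v.adicCompletion E)
      = ((b v : E) : v.adicCompletion E) *
        (((∏ x ∈ hfin.toFinset.erase v, b x : 𝓞 E) : E) : v.adicCompletion E) := by
      exact h
    rw [this, mul_right_comm, map_mul]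
    exact mul_le_one' (hb v) (hint _)

/-- Every finite adele is congruent to an element of `E` modulo the integral finite adeles. -/
theorem exists_principal_part (a : FiniteAdeleRing (𝓞 E) E) :
    ∃ e : E, ∀ v : HeightOneSpectrum (𝓞 E),
      Valued.v ((a - algebraMap E (FiniteAdeleRing (𝓞 E) E) e) v) ≤ 1 := by
  classical
  obtain ⟨d, hd0, hd⟩ := exists_int_mul_integral a
  have hdE : (d : E) ≠ 0 := by simpa using hd0
  have hsp : Ideal.span {d} ≠ (0 : Ideal (𝓞 E)) := by simpa using hd0
  have hfin : {v : HeightOneSpectrum (𝓞 E) | v.asIdeal ∣ Ideal.span {d}}.Finite :=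
    Ideal.finite_factors hsp
  have hex : ∀ v : HeightOneSpectrum (𝓞 E), ∃ n : ℕ, v.intValuation d = WithZero.exp (-(n : ℤ)) :=
    fun v => ⟨_, v.intValuation_eq_exp_neg_multiplicity hd0⟩
  choose n hn using hex
  have hloc := fun v : HeightOneSpectrum (𝓞 E) =>
    exists_int_valued_sub_le v (((d : E) : v.adicCompletion E) * a v) (hd v) (n v)
  choose r hr using hloc
  -- Chinese remainder theorem: `y` approximates `d a` to the order of `d` at each prime dividing
  -- `d`, so that `y / d` is the wanted principal part. At the other primes `d` is a unit and
  -- integrality of `d a` and `y` is enough.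
  obtain ⟨y, hy⟩ := IsDedekindDomain.exists_forall_sub_mem_ideal (s := hfin.toFinset)
    (fun v : HeightOneSpectrum (𝓞 E) => v.asIdeal) n (fun v _ => v.prime)
    (fun v _ w _ hvw h => hvw (HeightOneSpectrum.ext h)) (fun v => r v)
  refine ⟨(y : E) / d, fun v => ?_⟩
  have hdv : ((d : E) : v.adicCompletion E) ≠ 0 := by
    intro h
    exact hdE ((algebraMap E (v.adicCompletion E)).injective (by rw [map_zero]; exact h))
  have key : Valued.v (((d : E) : v.adicCompletion E) * a v - ((y : E) : v.adicCompletion E))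
      ≤ Valued.v (((d : E) : v.adicCompletion E)) := by
    rw [HeightOneSpectrum.valuedAdicCompletion_eq_valuation',
      HeightOneSpectrum.valuation_of_algebraMap, hn]
    by_cases hv : v.asIdeal ∣ Ideal.span {d}
    · have h1 := hy v (by simpa using hv)
      have h2 : Valued.v ((((algebraMap (𝓞 E) E (y - r v)) : E)) : v.adicCompletion E)
          ≤ WithZero.exp (-(n v : ℤ)) := by
        rw [HeightOneSpectrum.valuedAdicCompletion_eq_valuation',
          HeightOneSpectrum.valuation_of_algebraMap, HeightOneSpectrum.intValuation_le_pow_iff_mem]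
        exact h1
      have h3 : ((d : E) : v.adicCompletion E) * a v - ((y : E) : v.adicCompletion E)
          = (((d : E) : v.adicCompletion E) * a v - ((r v : E) : v.adicCompletion E))
            - ((((algebraMap (𝓞 E) E (y - r v)) : E)) : v.adicCompletion E) := by
        have h := map_sub (algebraMap E (v.adicCompletion E)) (y : E) (r v : E)
        rw [map_sub]
        change (((algebraMap (𝓞 E) E y - algebraMap (𝓞 E) E (r v) : E)) : v.adicCompletion E)
          = ((y : E) : v.adicCompletion E) - ((r v : E) : v.adicCompletion E) at h
        rw [h]; ring
      rw [h3]
      exact (Valuation.map_sub _ _ _).trans (max_le (hr v) h2)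
    · have h1 : v.intValuation d = 1 := by
        refine le_antisymm (v.intValuation_le_one d) ?_
        rw [← not_lt, v.intValuation_lt_one_iff_dvd]; exact hv
      rw [← hn, h1]
      exact (Valuation.map_sub _ _ _).trans
        (max_le (hd v) (HeightOneSpectrum.coe_mem_adicCompletionIntegers v y))
  have heq : (a - algebraMap E (FiniteAdeleRing (𝓞 E) E) ((y : E) / d)) v
      = (((d : E) : v.adicCompletion E) * a v - ((y : E) : v.adicCompletion E))
        / ((d : E) : v.adicCompletion E) := by
    have h := map_div₀ (algebraMap E (v.adicCompletion E)) (y : E) (d : E)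
    change a v - (((y : E) / d : E) : v.adicCompletion E) = _
    change (((y : E) / d : E) : v.adicCompletion E)
      = ((y : E) : v.adicCompletion E) / ((d : E) : v.adicCompletion E) at h
    rw [h]; field_simp
  rw [heq, map_div₀]
  exact div_le_one_of_le₀ key zero_le

/-- The integral finite adeles. -/
def intFin (E : Type*) [Field E] [NumberField E] : Set (FiniteAdeleRing (𝓞 E) E) :=
  {a | ∀ v : HeightOneSpectrum (𝓞 E), Valued.v (a v) ≤ 1}

theorem isOpen_localIntegers (v : HeightOneSpectrum (𝓞 E)) :
    IsOpen (v.adicCompletionIntegers E : Set (v.adicCompletion E)) :=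
  Valued.isOpen_valuationSubring _

theorem isOpen_intFin : IsOpen (intFin E) :=
  RestrictedProduct.isOpen_forall_mem (R := fun v : HeightOneSpectrum (𝓞 E) => v.adicCompletion E)
    (A := fun v => (v.adicCompletionIntegers E : Set (v.adicCompletion E))) isOpen_localIntegers

instance compactSpace_localIntegers (v : HeightOneSpectrum (𝓞 E)) :
    CompactSpace (v.adicCompletionIntegers E : Set (v.adicCompletion E)) :=
  isCompact_iff_compactSpace.1 (isCompact_localIntegers v)

instance : Countable (𝓞 E) := by
  obtain ⟨s⟩ : Nonempty (Module.Basis (Module.Free.ChooseBasisIndex ℤ (𝓞 E)) ℤ (𝓞 E)) :=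
    ⟨Module.Free.chooseBasis ℤ (𝓞 E)⟩
  exact s.equivFun.toEquiv.injective.countable

instance : Countable E := by
  refine Function.Surjective.countable (f := fun p : 𝓞 E × 𝓞 E => (p.1 : E) / p.2) fun x => ?_
  obtain ⟨r, s, -, rfl⟩ := IsFractionRing.div_surjective (A := 𝓞 E) x
  exact ⟨(r, s), rfl⟩

instance : Countable (HeightOneSpectrum (𝓞 E)) := by
  have h1 : Function.Surjective fun s : Finset (𝓞 E) => Ideal.span (s : Set (𝓞 E)) := fun I => by
    obtain ⟨s, hs⟩ := (isNoetherianRing_iff_ideal_fg (𝓞 E)).1 inferInstance I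
    exact ⟨s, hs⟩
  have : Countable (Ideal (𝓞 E)) := h1.countable
  exact Function.Injective.countable (f := fun v : HeightOneSpectrum (𝓞 E) => v.asIdeal)
    fun v w h => HeightOneSpectrum.ext h

theorem range_structureMap_eq : Set.range (RestrictedProduct.structureMap
    (fun v : HeightOneSpectrum (𝓞 E) => v.adicCompletion E)
    (fun v => (v.adicCompletionIntegers E : Set (v.adicCompletion E))) Filter.cofinite)
      = (intFin E : Set (FiniteAdeleRing (𝓞 E) E)) :=
  RestrictedProduct.range_structureMap _ _

theorem isCompact_intFin : IsCompact (intFin E) := by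
  rw [← range_structureMap_eq]
  exact isCompact_range (RestrictedProduct.isEmbedding_structureMap).continuous

instance : T2Space (FiniteAdeleRing (𝓞 E) E) :=
  inferInstanceAs (T2Space (RestrictedProduct
    (fun v : HeightOneSpectrum (𝓞 E) => v.adicCompletion E)
    (fun v => (v.adicCompletionIntegers E : Set (v.adicCompletion E))) Filter.cofinite))

instance : LocallyCompactSpace (FiniteAdeleRing (𝓞 E) E) :=
  isCompact_intFin.locallyCompactSpace_of_mem_nhds_of_addGroup
    (x := 0) (isOpen_intFin.mem_nhds fun v => by
      change Valued.v (0 : v.adicCompletion E) ≤ 1; simp)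

instance secondCountable_localIntegers (v : HeightOneSpectrum (𝓞 E)) :
    SecondCountableTopology (v.adicCompletionIntegers E : Set (v.adicCompletion E)) :=
  inferInstance

instance secondCountable_intFin :
    SecondCountableTopology (intFin E) := by
  rw [← range_structureMap_eq]
  exact (RestrictedProduct.isEmbedding_structureMap
    (R := fun v : HeightOneSpectrum (𝓞 E) => v.adicCompletion E)
    (A := fun v => (v.adicCompletionIntegers E : Set (v.adicCompletion E)))
    (𝓕 := Filter.cofinite)).toHomeomorph.symm.secondCountableTopology

/-- By the existence of principal parts, the finite adeles are covered by the translates of `intFin`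
by elements of the countable field `E`. -/
instance : SecondCountableTopology (FiniteAdeleRing (𝓞 E) E) := by
  have h : ∀ e : E, SecondCountableTopology
      ((fun a : FiniteAdeleRing (𝓞 E) E => a - algebraMap E (FiniteAdeleRing (𝓞 E) E) e) ⁻¹'
        intFin E : Set (FiniteAdeleRing (𝓞 E) E)) := fun e =>
    (((Homeomorph.subRight (algebraMap E (FiniteAdeleRing (𝓞 E) E) e)).isEmbedding.comp
      Topology.IsEmbedding.subtypeVal).codRestrict (intFin E) fun x => x.2).secondCountableTopology
  refine TopologicalSpace.secondCountableTopology_of_countable_cover (ι := E) (U := fun e =>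
    (fun a : FiniteAdeleRing (𝓞 E) E => a - algebraMap E (FiniteAdeleRing (𝓞 E) E) e) ⁻¹'
        intFin E) (fun e => isOpen_intFin.preimage (continuous_id.sub continuous_const)) ?_
  refine Set.eq_univ_of_forall fun a => ?_
  obtain ⟨e, he⟩ := exists_principal_part a
  exact Set.mem_iUnion.2 ⟨e, he⟩

instance (w : InfinitePlace E) : SecondCountableTopology w.Completion :=
  (InfinitePlace.Completion.isometry_extensionEmbedding w).isEmbedding.secondCountableTopology

instance : SecondCountableTopology (InfiniteAdeleRing E) :=
  inferInstanceAs (SecondCountableTopology ((w : InfinitePlace E) → w.Completion))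

instance : T2Space (InfiniteAdeleRing E) :=
  inferInstanceAs (T2Space ((w : InfinitePlace E) → w.Completion))

instance : SecondCountableTopology (AdeleRing (𝓞 E) E) :=
  inferInstanceAs (SecondCountableTopology (InfiniteAdeleRing E × FiniteAdeleRing (𝓞 E) E))

instance : T2Space (AdeleRing (𝓞 E) E) :=
  inferInstanceAs (T2Space (InfiniteAdeleRing E × FiniteAdeleRing (𝓞 E) E))

instance : LocallyCompactSpace (AdeleRing (𝓞 E) E) :=
  inferInstanceAs (LocallyCompactSpace (InfiniteAdeleRing E × FiniteAdeleRing (𝓞 E) E))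

instance : IsTopologicalGroup (GA E) := inferInstance

instance : T2Space (GA E) := inferInstance

instance : LocallyCompactSpace (Matrix (Fin 2) (Fin 2) (AdeleRing (𝓞 E) E)) :=
  inferInstanceAs (LocallyCompactSpace (Fin 2 → Fin 2 → AdeleRing (𝓞 E) E))

instance : SecondCountableTopology (Matrix (Fin 2) (Fin 2) (AdeleRing (𝓞 E) E)) :=
  inferInstanceAs (SecondCountableTopology (Fin 2 → Fin 2 → AdeleRing (𝓞 E) E))

instance : LocallyCompactSpace (GA E) := inferInstance

instance : SecondCountableTopology (GA E) :=
  have := (MulOpposite.opHomeomorph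
    (M := Matrix (Fin 2) (Fin 2) (AdeleRing (𝓞 E) E))).symm.secondCountableTopology
  Units.isEmbedding_embedProduct.secondCountableTopology

theorem continuous_fst_adele : Continuous fun a : AdeleRing (𝓞 E) E => a.1 := continuous_fst

theorem continuous_snd_adele : Continuous fun a : AdeleRing (𝓞 E) E => a.2 := continuous_snd

/-- A closed set of matrices whose entries and whose inverses' entries stay in a compact set is
compact. -/
theorem isCompact_of_matrix_mem {S : Set (GA E)} (hS : IsClosed S)
    {C C' : Set (Matrix (Fin 2) (Fin 2) (AdeleRing (𝓞 E) E))} (hC : IsCompact C)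
    (hC' : IsCompact C') (h : ∀ g ∈ S, (g : Matrix (Fin 2) (Fin 2) (AdeleRing (𝓞 E) E)) ∈ C ∧
      ((g⁻¹ : GA E) : Matrix (Fin 2) (Fin 2) (AdeleRing (𝓞 E) E)) ∈ C') : IsCompact S := by
  have h1 : IsCompact (Units.embedProduct (Matrix (Fin 2) (Fin 2) (AdeleRing (𝓞 E) E)) ⁻¹'
      (C ×ˢ (MulOpposite.unop ⁻¹' C'))) := by
    refine Units.isClosedEmbedding_embedProduct.isCompact_preimage (hC.prod ?_)
    exact MulOpposite.opHomeomorph.symm.isClosedEmbedding.isCompact_preimage hC'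
  exact h1.of_isClosed_subset hS fun g hg => ⟨(h g hg).1, (h g hg).2⟩

/-! ## The topology of the adelic groups -/

theorem continuous_toInf : Continuous (toInf (E := E)) :=
  Continuous.units_map _ (continuous_id.matrix_map continuous_fst_adele)

theorem continuous_toFin : Continuous (toFin (E := E)) :=
  Continuous.units_map _ (continuous_id.matrix_map continuous_snd_adele)

theorem continuous_pairMatrix :
    Continuous fun p : Matrix (Fin 2) (Fin 2) (InfiniteAdeleRing E) ×
      Matrix (Fin 2) (Fin 2) (FiniteAdeleRing (𝓞 E) E) => pairMatrix p.1 p.2 :=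
  continuous_matrix fun i j => Continuous.prodMk (X := InfiniteAdeleRing E)
    (Y := FiniteAdeleRing (𝓞 E) E) (Z := Matrix (Fin 2) (Fin 2) (InfiniteAdeleRing E) ×
    Matrix (Fin 2) (Fin 2) (FiniteAdeleRing (𝓞 E) E)) (continuous_fst.matrix_elem i j) (continuous_snd.matrix_elem i j)

theorem continuous_ofInf : Continuous (ofInf (E := E)) := by
  refine Units.continuous_iff.2 ⟨?_, ?_⟩
  · exact continuous_pairMatrix.comp (Units.continuous_val.prodMk continuous_const)
  · exact continuous_pairMatrix.comp
      ((Units.continuous_val.comp continuous_inv).prodMk continuous_const)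

/-- The inclusion of `GL₂` of the finite adeles. -/
def ofFin (g : GL (Fin 2) (FiniteAdeleRing (𝓞 E) E)) : GA E where
  val := pairMatrix 1 (g : Matrix (Fin 2) (Fin 2) (FiniteAdeleRing (𝓞 E) E))
  inv := pairMatrix 1 ((g⁻¹ : GL (Fin 2) (FiniteAdeleRing (𝓞 E) E)) :
    Matrix (Fin 2) (Fin 2) (FiniteAdeleRing (𝓞 E) E))
  val_inv := by
    rw [pairMatrix_mul, ← Units.val_mul, mul_inv_cancel, Matrix.one_mul, Units.val_one,
      pairMatrix_one]
  inv_val := by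
    rw [pairMatrix_mul, ← Units.val_mul, inv_mul_cancel, Matrix.one_mul, Units.val_one,
      pairMatrix_one]

theorem pairMatrix_toInf_toFin (g : GA E) :
    pairMatrix (toInf g : Matrix (Fin 2) (Fin 2) (InfiniteAdeleRing E))
      (toFin g : Matrix (Fin 2) (Fin 2) (FiniteAdeleRing (𝓞 E) E)) = g := rfl

theorem GA_ext {g h : GA E} (h1 : toInf g = toInf h) (h2 : toFin g = toFin h) : g = h :=
  Units.ext (by rw [← pairMatrix_toInf_toFin g, ← pairMatrix_toInf_toFin h, h1, h2])

@[simp] theorem toInf_ofInf (g : GL (Fin 2) (InfiniteAdeleRing E)) : toInf (ofInf g) = g :=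
  Units.ext rfl

@[simp] theorem toFin_ofFin (g : GL (Fin 2) (FiniteAdeleRing (𝓞 E) E)) : toFin (ofFin g) = g :=
  Units.ext rfl

@[simp] theorem toFin_ofInf (g : GL (Fin 2) (InfiniteAdeleRing E)) : toFin (ofInf g) = 1 :=
  Units.ext (by ext i j; rfl)

@[simp] theorem toInf_ofFin (g : GL (Fin 2) (FiniteAdeleRing (𝓞 E) E)) : toInf (ofFin g) = 1 :=
  Units.ext (by ext i j; rfl)

theorem ofInf_mul (g h : GL (Fin 2) (InfiniteAdeleRing E)) : ofInf (g * h) = ofInf g * ofInf h :=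
  GA_ext (by simp) (by simp)

@[simp] theorem ofInf_one : ofInf (1 : GL (Fin 2) (InfiniteAdeleRing E)) = 1 :=
  GA_ext (by simp) (by simp)

theorem ofFin_mul (g h : GL (Fin 2) (FiniteAdeleRing (𝓞 E) E)) :
    ofFin (g * h) = ofFin g * ofFin h :=
  GA_ext (by simp) (by simp)

@[simp] theorem ofFin_one : ofFin (1 : GL (Fin 2) (FiniteAdeleRing (𝓞 E) E)) = 1 :=
  GA_ext (by simp) (by simp)

theorem ofInf_commute_ofFin (g : GL (Fin 2) (InfiniteAdeleRing E))
    (h : GL (Fin 2) (FiniteAdeleRing (𝓞 E) E)) : ofInf g * ofFin h = ofFin h * ofInf g :=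
  GA_ext (by simp) (by simp)

/-! ### Compact subgroups -/

theorem mem_intFin_mul {a b : FiniteAdeleRing (𝓞 E) E} (ha : a ∈ intFin E) (hb : b ∈ intFin E) :
    a * b ∈ intFin E := fun v =>
  (map_mul (Valued.v : Valuation (v.adicCompletion E) _) (a v) (b v)).trans_le
    (mul_le_one' (ha v) (hb v))

theorem mem_intFin_add {a b : FiniteAdeleRing (𝓞 E) E} (ha : a ∈ intFin E) (hb : b ∈ intFin E) :
    a + b ∈ intFin E := fun v =>
  (Valuation.map_add (Valued.v : Valuation (v.adicCompletion E) _) (a v) (b v)).trans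
    (max_le (ha v) (hb v))

theorem mem_intFin_neg {a : FiniteAdeleRing (𝓞 E) E} (ha : a ∈ intFin E) : -a ∈ intFin E :=
  fun v => (Valuation.map_neg (Valued.v : Valuation (v.adicCompletion E) _) (a v)).trans_le (ha v)

theorem mem_intFin_sub {a b : FiniteAdeleRing (𝓞 E) E} (ha : a ∈ intFin E) (hb : b ∈ intFin E) :
    a - b ∈ intFin E := by
  rw [sub_eq_add_neg]; exact mem_intFin_add ha (mem_intFin_neg hb)

theorem one_mem_intFin : (1 : FiniteAdeleRing (𝓞 E) E) ∈ intFin E := fun v =>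
  (map_one (Valued.v : Valuation (v.adicCompletion E) _)).le

theorem zero_mem_intFin : (0 : FiniteAdeleRing (𝓞 E) E) ∈ intFin E := fun v =>
  (map_zero (Valued.v : Valuation (v.adicCompletion E) _)).trans_le zero_le_one

theorem mem_intFin_algebraMap (r : 𝓞 E) :
    algebraMap E (FiniteAdeleRing (𝓞 E) E) (r : E) ∈ intFin E := fun v =>
  HeightOneSpectrum.coe_mem_adicCompletionIntegers v r

theorem mem_KFin_iff {k : GL (Fin 2) (FiniteAdeleRing (𝓞 E) E)} : k ∈ KFin E ↔
    ∀ i j, k i j ∈ intFin E ∧ (k⁻¹ : GL (Fin 2) (FiniteAdeleRing (𝓞 E) E)) i j ∈ intFin E :=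
  ⟨fun h i j => ⟨fun v => (h v i j).1, fun v => (h v i j).2⟩,
    fun h v i j => ⟨(h i j).1 v, (h i j).2 v⟩⟩

theorem one_mem_KFin : (1 : GL (Fin 2) (FiniteAdeleRing (𝓞 E) E)) ∈ KFin E := by
  have h : ∀ i j, (1 : Matrix (Fin 2) (Fin 2) (FiniteAdeleRing (𝓞 E) E)) i j ∈ intFin E :=
    fun i j => by
      rw [Matrix.one_apply]; split_ifs
      exacts [one_mem_intFin, zero_mem_intFin]
  rw [mem_KFin_iff]
  exact fun i j => ⟨h i j, by rw [inv_one]; exact h i j⟩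

theorem inv_mem_KFin {k : GL (Fin 2) (FiniteAdeleRing (𝓞 E) E)} (hk : k ∈ KFin E) :
    k⁻¹ ∈ KFin E := by
  rw [mem_KFin_iff] at hk ⊢
  exact fun i j => ⟨(hk i j).2, by rw [inv_inv]; exact (hk i j).1⟩

theorem mul_mem_KFin {k l : GL (Fin 2) (FiniteAdeleRing (𝓞 E) E)} (hk : k ∈ KFin E)
    (hl : l ∈ KFin E) : k * l ∈ KFin E := by
  rw [mem_KFin_iff] at hk hl ⊢
  refine fun i j => ⟨?_, ?_⟩
  · rw [Units.val_mul, Matrix.mul_apply, Fin.sum_univ_two]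
    exact mem_intFin_add (mem_intFin_mul (hk _ _).1 (hl _ _).1)
      (mem_intFin_mul (hk _ _).1 (hl _ _).1)
  · rw [mul_inv_rev, Units.val_mul, Matrix.mul_apply, Fin.sum_univ_two]
    exact mem_intFin_add (mem_intFin_mul (hl _ _).2 (hk _ _).2)
      (mem_intFin_mul (hl _ _).2 (hk _ _).2)

theorem KFin_eq_iInter : KFin E = ⋂ i, ⋂ j,
    ((fun k : GL (Fin 2) (FiniteAdeleRing (𝓞 E) E) => k i j) ⁻¹' intFin E ∩
      (fun k : GL (Fin 2) (FiniteAdeleRing (𝓞 E) E) =>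
        (k⁻¹ : GL (Fin 2) (FiniteAdeleRing (𝓞 E) E)) i j) ⁻¹' intFin E) := by
  ext k
  simp only [mem_KFin_iff, Set.mem_iInter, Set.mem_inter_iff, Set.mem_preimage]

theorem isOpen_KFin : IsOpen (KFin E) := by
  rw [KFin_eq_iInter]
  refine isOpen_iInter_of_finite fun i => isOpen_iInter_of_finite fun j => IsOpen.inter ?_ ?_
  · exact isOpen_intFin.preimage (Units.continuous_val.matrix_elem i j)
  · exact isOpen_intFin.preimage ((Units.continuous_val.comp continuous_inv).matrix_elem i j)

theorem isClosed_KFin : IsClosed (KFin E) := by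
  rw [KFin_eq_iInter]
  refine isClosed_iInter fun i => isClosed_iInter fun j => IsClosed.inter ?_ ?_
  · exact isCompact_intFin.isClosed.preimage (Units.continuous_val.matrix_elem i j)
  · exact isCompact_intFin.isClosed.preimage
      ((Units.continuous_val.comp continuous_inv).matrix_elem i j)

/-- The matrix of `g ∈ GL₂(E_∞)` at the place `w`, embedded into `M₂(ℂ)`. -/
def infPlace (w : InfinitePlace E) :
    GL (Fin 2) (InfiniteAdeleRing E) →* GL (Fin 2) ℂ :=
  Matrix.GeneralLinearGroup.map ((InfinitePlace.Completion.extensionEmbedding w).comp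
    (Pi.evalRingHom (fun w : InfinitePlace E => w.Completion) w))

theorem mem_KInf_iff {k : GL (Fin 2) (InfiniteAdeleRing E)} : k ∈ KInf E ↔
    ∀ w, (infPlace w k : Matrix (Fin 2) (Fin 2) ℂ) ∈ Matrix.unitaryGroup (Fin 2) ℂ := Iff.rfl

theorem one_mem_KInf : (1 : GL (Fin 2) (InfiniteAdeleRing E)) ∈ KInf E := by
  rw [mem_KInf_iff]; intro w; rw [map_one]; exact one_mem _

theorem inv_mem_KInf {k : GL (Fin 2) (InfiniteAdeleRing E)} (hk : k ∈ KInf E) :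
    k⁻¹ ∈ KInf E := by
  rw [mem_KInf_iff] at hk ⊢
  intro w
  have h : ((infPlace w k⁻¹ : GL (Fin 2) ℂ) : Matrix (Fin 2) (Fin 2) ℂ)
      = star (infPlace w k : Matrix (Fin 2) (Fin 2) ℂ) := by
    rw [map_inv]
    exact (left_inv_eq_right_inv ((Matrix.mem_unitaryGroup_iff').1 (hk w))
      (by rw [← Units.val_mul, mul_inv_cancel, Units.val_one])).symm
  rw [h]
  exact Unitary.star_mem (hk w)

theorem one_mem_KA : (1 : GA E) ∈ KA E :=
  ⟨by rw [map_one]; exact one_mem_KInf, by rw [map_one]; exact one_mem_KFin⟩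

theorem inv_mem_KA {k : GA E} (hk : k ∈ KA E) : k⁻¹ ∈ KA E :=
  ⟨by rw [map_inv]; exact inv_mem_KInf hk.1, by rw [map_inv]; exact inv_mem_KFin hk.2⟩

theorem ofFin_mem_KA {k : GL (Fin 2) (FiniteAdeleRing (𝓞 E) E)} (hk : k ∈ KFin E) :
    ofFin k ∈ KA E := ⟨by rw [toInf_ofFin]; exact one_mem_KInf, by rwa [toFin_ofFin]⟩

theorem continuous_infPlace (w : InfinitePlace E) : Continuous (infPlace w) :=
  Continuous.units_map _ (continuous_id.matrix_map
    ((InfinitePlace.Completion.isometry_extensionEmbedding w).continuous.comp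
      (continuous_apply w)))

theorem isClosed_KInf : IsClosed (KInf E) := by
  have : KInf E = ⋂ w, (fun k : GL (Fin 2) (InfiniteAdeleRing E) =>
      (infPlace w k : Matrix (Fin 2) (Fin 2) ℂ)) ⁻¹'
        {A | A * star A = 1} := by
    ext k
    simp only [mem_KInf_iff, Matrix.mem_unitaryGroup_iff, Set.mem_iInter, Set.mem_preimage,
      Set.mem_ofPred_eq]
  rw [this]
  refine isClosed_iInter fun w => IsClosed.preimage
    (Units.continuous_val.comp (continuous_infPlace w)) ?_
  exact isClosed_eq (continuous_id.mul continuous_id.star) continuous_const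

theorem isClosed_KA : IsClosed (KA E) :=
  (isClosed_KInf.preimage continuous_toInf).inter (isClosed_KFin.preimage continuous_toFin)

theorem norm_apply_eq (w : InfinitePlace E) (g : GL (Fin 2) (InfiniteAdeleRing E)) (i j : Fin 2) :
    ‖infPlace w g i j‖ = ‖g i j w‖ :=
  (InfinitePlace.Completion.isometry_extensionEmbedding w).norm_map_of_map_zero (map_zero _) _

theorem norm_apply_le_one_of_mem_KInf {k : GL (Fin 2) (InfiniteAdeleRing E)} (hk : k ∈ KInf E)
    (w : InfinitePlace E) (i j : Fin 2) : ‖k i j w‖ ≤ 1 := by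
  rw [← norm_apply_eq]
  exact entry_norm_bound_of_unitary (hk w) i j

/-- The infinite adeles bounded by `R` at each place. -/
def ballInf (E : Type*) [Field E] (R : ℝ) : Set (InfiniteAdeleRing E) :=
  {x | ∀ w : InfinitePlace E, ‖x w‖ ≤ R}

theorem isCompact_ballInf (R : ℝ) : IsCompact (ballInf E R) := by
  have h : ∀ w : InfinitePlace E, IsCompact {x : w.Completion | ‖x‖ ≤ R} := fun w => by
    have := (InfinitePlace.Completion.isometry_extensionEmbedding w).isClosedEmbedding.isCompact_preimage
      (isCompact_closedBall (0 : ℂ) R)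
    convert this using 1
    ext x
    simp only [Set.mem_ofPred_eq, Set.mem_preimage, mem_closedBall_zero_iff]
    rw [(InfinitePlace.Completion.isometry_extensionEmbedding w).norm_map_of_map_zero (map_zero _)]
  have heq : ballInf E R = (Set.univ.pi fun w : InfinitePlace E => {x : w.Completion | ‖x‖ ≤ R} :) :=
    Set.ext fun x => ⟨fun h w _ => h w, fun h w => h w trivial⟩
  rw [heq]
  exact isCompact_univ_pi h

/-- Adelic matrices whose infinite entries are bounded by `R` and whose finite entries are
integral. -/
def matBall (E : Type*) [Field E] [NumberField E] (R : ℝ) :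
    Set (Matrix (Fin 2) (Fin 2) (AdeleRing (𝓞 E) E)) :=
  {A | ∀ i j, (A i j).1 ∈ ballInf E R ∧ (A i j).2 ∈ intFin E}

theorem isCompact_matBall (R : ℝ) : IsCompact (matBall E R) := by
  have h : IsCompact (ballInf E R ×ˢ intFin E : Set (AdeleRing (𝓞 E) E)) :=
    (isCompact_ballInf R).prod isCompact_intFin
  have heq : matBall E R = (Set.univ.pi fun _ : Fin 2 => Set.univ.pi fun _ : Fin 2 =>
      (ballInf E R ×ˢ intFin E : Set (AdeleRing (𝓞 E) E)) :) :=
    Set.ext fun A => ⟨fun h i _ j _ => h i j, fun h i j => h i trivial j trivial⟩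
  rw [heq]
  exact isCompact_univ_pi fun _ => isCompact_univ_pi fun _ => h

theorem isCompact_KA : IsCompact (KA E) :=
  isCompact_of_matrix_mem isClosed_KA (isCompact_matBall 1) (isCompact_matBall 1) fun _ hk =>
    ⟨fun i j => ⟨fun w => norm_apply_le_one_of_mem_KInf hk.1 w i j, fun v => (hk.2 v i j).1⟩,
      fun i j => ⟨fun w => norm_apply_le_one_of_mem_KInf (inv_mem_KA hk).1 w i j,
        fun v => (hk.2 v i j).2⟩⟩

/-! ## Unimodularity -/

section Elementary

variable {R : Type*} [CommRing R]

/-- The matrix `(1 0; t 1)`. -/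
def lowGL (t : R) : GL (Fin 2) R where
  val := !![1, 0; t, 1]
  inv := !![1, 0; -t, 1]
  val_inv := by ext i j; fin_cases i <;> fin_cases j <;> simp [Matrix.mul_apply]
  inv_val := by ext i j; fin_cases i <;> fin_cases j <;> simp [Matrix.mul_apply]

@[simp] theorem coe_unipGL (t : R) : (unipGL t : Matrix (Fin 2) (Fin 2) R) = !![1, t; 0, 1] := rfl

@[simp] theorem coe_lowGL (t : R) : (lowGL t : Matrix (Fin 2) (Fin 2) R) = !![1, 0; t, 1] := rfl

@[simp] theorem coe_diagGL (a b : Rˣ) :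
    (diagGL a b : Matrix (Fin 2) (Fin 2) R) = !![(a : R), 0; 0, (b : R)] := rfl

theorem unipGL_add (s t : R) : unipGL (s + t) = unipGL s * unipGL t :=
  Units.ext (by simp [Matrix.mul_fin_two, add_comm])

theorem lowGL_add (s t : R) : lowGL (s + t) = lowGL s * lowGL t :=
  Units.ext (by simp [Matrix.mul_fin_two])

theorem diagGL_mul (a b c d : Rˣ) : diagGL a b * diagGL c d = diagGL (a * c) (b * d) :=
  Units.ext (by simp [Matrix.mul_fin_two])

@[simp] theorem diagGL_one : diagGL (1 : Rˣ) 1 = 1 :=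
  Units.ext (by simp [Matrix.one_fin_two])

theorem diagGL_inv (a b : Rˣ) : (diagGL a b)⁻¹ = diagGL a⁻¹ b⁻¹ :=
  inv_eq_of_mul_eq_one_right (by rw [diagGL_mul]; simp)

theorem unipGL_inv (t : R) : (unipGL t)⁻¹ = unipGL (-t) := Units.ext rfl

theorem diagGL_mul_unipGL (a b : Rˣ) (t : R) :
    diagGL a b * unipGL t = unipGL (a * t * ((b⁻¹ : Rˣ) : R)) * diagGL a b :=
  Units.ext (by simp [Matrix.mul_fin_two, mul_assoc])

theorem diagGL_mul_lowGL (a b : Rˣ) (t : R) :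
    diagGL a b * lowGL t = lowGL (b * t * ((a⁻¹ : Rˣ) : R)) * diagGL a b :=
  Units.ext (by simp [Matrix.mul_fin_two, mul_assoc])

theorem det_unipGL (t : R) : Matrix.GeneralLinearGroup.det (unipGL t) = 1 :=
  Units.ext (by simp [Matrix.det_fin_two])

theorem det_lowGL (t : R) : Matrix.GeneralLinearGroup.det (lowGL t) = 1 :=
  Units.ext (by simp [Matrix.det_fin_two])

theorem det_diagGL (a b : Rˣ) : Matrix.GeneralLinearGroup.det (diagGL a b) = a * b :=
  Units.ext (by simp [Matrix.det_fin_two])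

theorem diagGL_scalar_comm (a : Rˣ) (g : GL (Fin 2) R) : diagGL a a * g = g * diagGL a a := by
  refine Units.ext ?_
  rw [Units.val_mul, Units.val_mul, coe_diagGL, Matrix.eta_fin_two (g : Matrix (Fin 2) (Fin 2) R)]
  simp [Matrix.mul_fin_two, mul_comm]

/-- After right multiplication by `unipGL s` the lower right entry is the unit `q`, and a matrix
with invertible lower right entry factors as upper unipotent, diagonal, lower unipotent with `q` as
pivot. -/
theorem exists_elementary_factorization (g : GL (Fin 2) R) {s : R}
    (hs : IsUnit (g 1 0 * s + g 1 1)) :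
    ∃ x y : R, ∃ p q : Rˣ, g = unipGL x * diagGL p q * lowGL y * unipGL (-s) := by
  obtain ⟨q, hq⟩ := hs
  set x : R := (g 0 0 * s + g 0 1) * ((q⁻¹ : Rˣ) : R) with hx
  set y : R := ((q⁻¹ : Rˣ) : R) * g 1 0 with hy
  set p : Rˣ := Matrix.GeneralLinearGroup.det g * q⁻¹ with hp
  have hdet : ((Matrix.GeneralLinearGroup.det g : Rˣ) : R) = g 0 0 * g 1 1 - g 0 1 * g 1 0 := by
    rw [Matrix.GeneralLinearGroup.val_det_apply, Matrix.det_fin_two]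
  have hqq : (q : R) * ((q⁻¹ : Rˣ) : R) = 1 := q.mul_inv
  refine ⟨x, y, p, q, ?_⟩
  rw [← unipGL_inv, eq_mul_inv_iff_mul_eq]
  refine Units.ext ?_
  simp only [Units.val_mul, coe_unipGL, coe_diagGL, coe_lowGL]
  rw [Matrix.eta_fin_two (g : Matrix (Fin 2) (Fin 2) R)]
  simp only [Matrix.mul_fin_two, hx, hy, hp, Units.val_mul, hdet]
  congr 1
  ext i j
  fin_cases i <;> fin_cases j <;> simp
  · linear_combination (g 0 0 * ((q⁻¹ : Rˣ) : R)) * hq - g 0 0 * hqq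
  · linear_combination -hq

open scoped NNReal in
/-- A homomorphism to `ℝ≥0` from the subgroup of `GL₂` with a determinant condition is trivial as
soon as it is trivial on the scalar matrices, if every unimodular row can be shortened and `3` is
invertible. -/
theorem hom_eq_one_of_scalar (D : Subgroup Rˣ) (Γ : Subgroup (GL (Fin 2) R))
    (hmemdet : ∀ g, g ∈ Γ ↔ Matrix.GeneralLinearGroup.det g ∈ D) (χ : Γ →* ℝ≥0)
    (hχ : ∀ (a : Rˣ) (ha : diagGL a a ∈ Γ), χ ⟨diagGL a a, ha⟩ = 1)
    (two three : Rˣ) (h2 : (two : R) = 2) (h3 : (three : R) = 3)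
    (hR : ∀ g : GL (Fin 2) R, ∃ s, IsUnit (g 1 0 * s + g 1 1)) : χ = 1 := by
  let N : Subgroup (GL (Fin 2) R) := χ.ker.map Γ.subtype
  have hN : ∀ g (hg : g ∈ Γ), χ ⟨g, hg⟩ = 1 → g ∈ N := fun g hg h => ⟨⟨g, hg⟩, h, rfl⟩
  have hN' : ∀ g (hg : g ∈ Γ), g ∈ N → χ ⟨g, hg⟩ = 1 := by
    rintro g hg ⟨g', h, rfl⟩; exact h
  -- conjugate elements differ by an element of `N`
  have hconj : ∀ a (_ : a ∈ Γ) g (_ : g ∈ Γ), ∀ g', a * g = g' * a → g' * g⁻¹ ∈ N := by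
    intro a ha g hg g' h
    have hg' : g' = a * g * a⁻¹ := by rw [h, mul_inv_cancel_right]
    have hmem : g' ∈ Γ := by rw [hg']; exact Γ.mul_mem (Γ.mul_mem ha hg) (Γ.inv_mem ha)
    refine hN _ (Γ.mul_mem hmem (Γ.inv_mem hg)) ?_
    have : (⟨g' * g⁻¹, Γ.mul_mem hmem (Γ.inv_mem hg)⟩ : Γ)
        = ⟨a, ha⟩ * ⟨g, hg⟩ * (⟨a, ha⟩ : Γ)⁻¹ * (⟨g, hg⟩ : Γ)⁻¹ :=
      Subtype.ext (by simp [hg'])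
    rw [this, map_mul, map_mul, mul_right_comm, ← map_mul, mul_inv_cancel_right, ← map_mul,
      mul_inv_cancel, map_one]
  have hdet1 : ∀ g : GL (Fin 2) R, Matrix.GeneralLinearGroup.det g = 1 → g ∈ Γ := fun g h => by
    rw [hmemdet, h]; exact D.one_mem
  -- Conjugation by `diag(2, 1/2)` multiplies the unipotent coordinate by `4`, so its commutator
  -- with `unipGL u` is `unipGL (3 u)`. As `3` is invertible, every unipotent matrix arises in this
  -- way and `χ` kills it.
  have ha2 : diagGL two two⁻¹ ∈ Γ := hdet1 _ (by rw [det_diagGL, mul_inv_cancel])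
  have hu3 : ∀ t : R, t = 3 * (((three⁻¹ : Rˣ) : R) * t) := fun t => by
    rw [← h3, ← mul_assoc, three.mul_inv, one_mul]
  have hunip : ∀ t : R, unipGL t ∈ N := fun t => by
    rw [hu3 t]
    set u := ((three⁻¹ : Rˣ) : R) * t
    have := hconj _ ha2 (unipGL u) (hdet1 _ (det_unipGL u)) _ (diagGL_mul_unipGL _ _ _)
    rw [unipGL_inv, ← unipGL_add, inv_inv, h2] at this
    convert this using 2; ring
  have hlow : ∀ t : R, lowGL t ∈ N := fun t => by
    rw [hu3 t]
    set u := ((three⁻¹ : Rˣ) : R) * t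
    have ha2' : diagGL two⁻¹ two ∈ Γ := hdet1 _ (by rw [det_diagGL, inv_mul_cancel])
    have := hconj _ ha2' (lowGL u) (hdet1 _ (det_lowGL u)) _ (diagGL_mul_lowGL _ _ _)
    rw [show (lowGL u)⁻¹ = lowGL (-u) from Units.ext rfl, ← lowGL_add, inv_inv, h2] at this
    convert this using 2; ring
  -- A Weyl element of determinant one exchanges the diagonal entries, so `χ` agrees on `diag(a, b)`
  -- and `diag(b, a)`. Their product is scalar, whence `χ ^ 2 = 1` there, and `χ = 1` because values
  -- in `ℝ≥0` are nonnegative.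
  have hdiag : ∀ a b : Rˣ, diagGL a b ∈ Γ → diagGL a b ∈ N := fun a b hab => by
    set w : GL (Fin 2) R := unipGL 1 * lowGL (-1) * unipGL 1 with hw
    have hwΓ : w ∈ Γ := hdet1 _ (by rw [hw, map_mul, map_mul, det_unipGL, det_lowGL]; simp)
    have hba : diagGL b a ∈ Γ := by
      rw [hmemdet, det_diagGL, mul_comm, ← det_diagGL]; exact (hmemdet _).1 hab
    have h1 : w * diagGL a b = diagGL b a * w := by
      refine Units.ext ?_
      simp only [hw, Units.val_mul, coe_unipGL, coe_lowGL, coe_diagGL, Matrix.mul_fin_two]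
      simp
    have h2 := hN' _ (Γ.mul_mem hba (Γ.inv_mem hab)) (hconj w hwΓ _ hab _ h1)
    have h3 : χ ⟨diagGL b a, hba⟩ = χ ⟨diagGL a b, hab⟩ := by
      have : (⟨diagGL b a, hba⟩ : Γ)
        = ⟨diagGL b a * (diagGL a b)⁻¹, Γ.mul_mem hba (Γ.inv_mem hab)⟩ * ⟨diagGL a b, hab⟩ :=
        Subtype.ext (by simp)
      rw [this, map_mul, h2, one_mul]
    have h4 : diagGL (a * b) (a * b) ∈ Γ := by
      have := Γ.mul_mem hab hba
      rwa [diagGL_mul, mul_comm b a] at this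
    have h5 : χ ⟨diagGL a b, hab⟩ * χ ⟨diagGL a b, hab⟩ = 1 := by
      nth_rw 2 [← h3]
      have h6 : (⟨diagGL a b, hab⟩ * ⟨diagGL b a, hba⟩ : Γ) = ⟨diagGL (a * b) (a * b), h4⟩ :=
        Subtype.ext ((diagGL_mul a b b a).trans (by rw [mul_comm b a]))
      rw [← map_mul, h6, hχ]
    exact hN _ hab ((pow_eq_one_iff_of_nonneg zero_le two_ne_zero).1 (by rw [sq]; exact h5))
  ext g
  obtain ⟨s, hs⟩ := hR g
  obtain ⟨x, y, p, q, hg⟩ := exists_elementary_factorization (g : GL (Fin 2) R) hs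
  have hpq : diagGL p q ∈ Γ := by
    have := g.2
    rw [hmemdet, hg] at this
    exact (hmemdet _).2 (by simpa [det_unipGL, det_lowGL] using this)
  have : (g : GL (Fin 2) R) ∈ N := by
    rw [hg]
    exact N.mul_mem (N.mul_mem (N.mul_mem (hunip _) (hdiag _ _ hpq)) (hlow _)) (hunip _)
  exact congrArg NNReal.toReal (hN' _ g.2 this)

end Elementary

theorem isUnit_adele_iff {x : AdeleRing (𝓞 E) E} :
    IsUnit x ↔ (∀ w : InfinitePlace E, x.1 w ≠ 0) ∧ IsUnit x.2 := by
  have h : IsUnit x ↔ IsUnit x.1 ∧ IsUnit x.2 := Prod.isUnit_iff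
  rw [h]
  refine and_congr ?_ Iff.rfl
  have h' : IsUnit x.1 ↔ ∀ w, IsUnit (x.1 w) := Pi.isUnit_iff
  simp only [h', isUnit_iff_ne_zero]

theorem eventually_toFin_integral (g : GL (Fin 2) (FiniteAdeleRing (𝓞 E) E)) :
    ∀ᶠ v : HeightOneSpectrum (𝓞 E) in Filter.cofinite, ∀ i j, Valued.v (g i j v) ≤ 1 :=
  Filter.eventually_all.2 fun i => Filter.eventually_all.2 fun j => (g i j).2

/-- A row of an invertible adelic matrix can be shortened. -/
theorem exists_isUnit_row (g : GA E) : ∃ s, IsUnit (g 1 0 * s + g 1 1) := by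
  classical
  set c := g 1 0 with hc
  set d := g 1 1 with hd
  set c' := (g⁻¹ : GA E) 0 1 with hc'
  set d' := (g⁻¹ : GA E) 1 1 with hd'
  have hrow : c * c' + d * d' = 1 := by
    have h : (g : Matrix (Fin 2) (Fin 2) (AdeleRing (𝓞 E) E)) * (g⁻¹ : GA E) = 1 := by
      rw [← Units.val_mul, mul_inv_cancel, Units.val_one]
    have := congrFun (congrFun h 1) 1
    rwa [Matrix.mul_apply, Fin.sum_univ_two, Matrix.one_apply_eq] at this
  have hinf : ∀ w, c.1 w * c'.1 w + d.1 w * d'.1 w = 1 := fun w =>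
    congrFun (congrArg Prod.fst hrow) w
  have hfin : ∀ v : HeightOneSpectrum (𝓞 E), c.2 v * c'.2 v + d.2 v * d'.2 v = 1 := fun v =>
    DFunLike.congr_fun (congrArg Prod.snd hrow) v
  -- The choice of `0` or `1` makes `|c s + d| = max |c| |d|` at every finite place. This is
  -- nonzero, and it equals `1` at almost all places because the row is unimodular with integral
  -- witnesses there.
  set sf : FiniteAdeleRing (𝓞 E) E := ⟨fun v => if Valued.v (c.2 v) ≤ Valued.v (d.2 v) then 0 else 1,
    Filter.Eventually.of_forall fun v => by
      change Valued.v (if Valued.v (c.2 v) ≤ Valued.v (d.2 v) then 0 else 1 :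
        v.adicCompletion E) ≤ 1
      split_ifs <;> simp⟩ with hsf
  set si : InfiniteAdeleRing E := fun w => if d.1 w = 0 then 1 else 0 with hsi
  have hval : ∀ v : HeightOneSpectrum (𝓞 E), Valued.v (c.2 v * sf v + d.2 v)
      = max (Valued.v (c.2 v)) (Valued.v (d.2 v)) := fun v => by
    have h : sf v = if Valued.v (c.2 v) ≤ Valued.v (d.2 v) then 0 else 1 := rfl
    rw [h]
    split_ifs with h1
    · rw [mul_zero, zero_add, max_eq_right h1]
    · rw [mul_one, max_eq_left (not_le.1 h1).le]
      exact Valuation.map_add_eq_of_lt_left _ (not_le.1 h1)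
  refine ⟨(si, sf), isUnit_adele_iff.2 ⟨fun w => ?_, FiniteAdeleRing.isUnit_iff.2 ⟨fun v => ?_, ?_⟩⟩⟩
  · change c.1 w * si w + d.1 w ≠ 0
    have h : si w = if d.1 w = 0 then 1 else 0 := rfl
    rw [h]
    split_ifs with h1
    · intro h2
      rw [h1, mul_one, add_zero] at h2
      have := hinf w
      simp [h1, h2] at this
    · simpa using h1
  · change c.2 v * sf v + d.2 v ≠ 0
    intro h0
    have h1 := hval v
    rw [h0, map_zero] at h1
    have h2 : Valued.v (c.2 v) = 0 := le_antisymm (h1 ▸ le_max_left _ _) zero_le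
    have h3 : Valued.v (d.2 v) = 0 := le_antisymm (h1 ▸ le_max_right _ _) zero_le
    have h4 := hfin v
    rw [Valuation.zero_iff] at h2 h3
    rw [h2, h3] at h4
    simp at h4
  · filter_upwards [eventually_toFin_integral (toFin g), eventually_toFin_integral (toFin g)⁻¹]
      with v h1 h2
    have h3 : Valued.v (c.2 v) ≤ 1 := h1 1 0
    have h4 : Valued.v (d.2 v) ≤ 1 := h1 1 1
    have h5 : Valued.v (c'.2 v) ≤ 1 := h2 0 1
    have h6 : Valued.v (d'.2 v) ≤ 1 := h2 1 1
    refine (hval v).trans (le_antisymm (max_le h3 h4) ?_)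
    rw [← map_one (Valued.v : Valuation (v.adicCompletion E) _), ← hfin v]
    refine (Valuation.map_add _ _ _).trans (max_le_max ?_ ?_)
    · rw [map_mul]; exact mul_le_of_le_one_right' h5
    · rw [map_mul]; exact mul_le_of_le_one_right' h6

theorem isUnit_natCast_adele (n : ℕ) (hn : n ≠ 0) : IsUnit (n : AdeleRing (𝓞 E) E) := by
  rw [← map_natCast (algebraMap E (AdeleRing (𝓞 E) E))]
  exact (IsUnit.mk0 (n : E) (by exact_mod_cast hn)).map _

/-- Subgroups of `GL₂(𝔸_E)` cut out by a condition on the determinant are unimodular. -/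
theorem isMulRightInvariant_of_det (D : Subgroup (AdeleRing (𝓞 E) E)ˣ) (Γ : Subgroup (GA E))
    (hΓ : ∀ g, g ∈ Γ ↔ Matrix.GeneralLinearGroup.det g ∈ D) (hcl : IsClosed (Γ : Set (GA E)))
    (μ : Measure Γ) [μ.IsHaarMeasure] : μ.IsMulRightInvariant := by
  have : LocallyCompactSpace Γ := hcl.isClosedEmbedding_subtypeVal.locallyCompactSpace
  have hχ : Measure.modularCharacter (G := Γ) = 1 := by
    obtain ⟨two, h2⟩ := isUnit_natCast_adele (E := E) 2 two_ne_zero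
    obtain ⟨three, h3⟩ := isUnit_natCast_adele (E := E) 3 three_ne_zero
    refine hom_eq_one_of_scalar D Γ hΓ _ (fun a ha => ?_) two three (by rw [h2]; norm_num)
      (by rw [h3]; norm_num) exists_isUnit_row
    change Measure.modularCharacterFun _ = 1
    rw [Measure.modularCharacterFun_eq_haarScalarFactor μ]
    -- Scalar matrices are central, so right translation by one is a left translation and preserves
    -- Haar measure; this is the remaining input of `hom_eq_one_of_scalar`.
    have : (fun x : Γ => x * ⟨diagGL a a, ha⟩) = fun x => ⟨diagGL a a, ha⟩ * x :=
      funext fun x => Subtype.ext (diagGL_scalar_comm a x).symm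
    have h1 : μ.map (fun x : Γ => x * ⟨diagGL a a, ha⟩) = μ := by
      rw [this, map_mul_left_eq_self]
    have h2 : ∀ (μ' : Measure Γ) [μ'.IsHaarMeasure], μ' = μ →
        Measure.haarScalarFactor μ' μ = 1 := fun μ' _ h => by
      subst h; exact Measure.haarScalarFactor_self _
    exact h2 _ h1
  have : SecondCountableTopology Γ := TopologicalSpace.Subtype.secondCountableTopology _
  have : SigmaCompactSpace Γ := inferInstance
  have : SigmaFinite μ := inferInstance
  have : TopologicalSpace.PseudoMetrizableSpace Γ := inferInstance
  have : μ.InnerRegular := inferInstance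
  refine ⟨fun g => ?_⟩
  rw [Measure.map_right_mul_eq_modularCharacterFun_smul]
  have := DFunLike.congr_fun hχ g
  change Measure.modularCharacterFun g = 1 at this
  rw [this, one_smul]

/-! ### The closed subgroups in play -/

theorem continuous_det_GA : Continuous fun g : GA E =>
    ((Matrix.GeneralLinearGroup.det g : (AdeleRing (𝓞 E) E)ˣ) : AdeleRing (𝓞 E) E) :=
  Units.continuous_val.matrix_det

theorem continuous_norm_fst (w : InfinitePlace E) :
    Continuous fun x : AdeleRing (𝓞 E) E => ‖x.1 w‖ :=
  continuous_norm.comp ((continuous_apply w).comp continuous_fst_adele)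

theorem isClosed_GAArchOne : IsClosed (GAArchOne E : Set (GA E)) := by
  have : (GAArchOne E : Set (GA E)) = ⋂ w : InfinitePlace E, {g : GA E |
      ‖((Matrix.GeneralLinearGroup.det g : (AdeleRing (𝓞 E) E)ˣ) : AdeleRing (𝓞 E) E).1 w‖ = 1} := by
    ext g
    simp only [Set.mem_iInter]
    exact Iff.rfl
  rw [this]
  exact isClosed_iInter fun w =>
    isClosed_eq ((continuous_norm_fst w).comp continuous_det_GA) continuous_const

theorem finAbs_eq_of_valued_eq {x y : FiniteAdeleRing (𝓞 E) E}
    (h : ∀ v : HeightOneSpectrum (𝓞 E), Valued.v (x v) = Valued.v (y v)) : finAbs x = finAbs y := by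
  unfold finAbs
  exact finprod_congr fun v => by rw [FinitePlace.norm_def, FinitePlace.norm_def, h v]

/-- Ideles are locally constant up to integral units at the finite places. -/
theorem eventually_valued_eq (x : (AdeleRing (𝓞 E) E)ˣ) :
    ∀ᶠ y : (AdeleRing (𝓞 E) E)ˣ in nhds x, ∀ v : HeightOneSpectrum (𝓞 E),
      Valued.v ((y : AdeleRing (𝓞 E) E).2 v) = Valued.v ((x : AdeleRing (𝓞 E) E).2 v) := by
  have h1 : ∀ᶠ y : (AdeleRing (𝓞 E) E)ˣ in nhds x,
      (((x⁻¹ * y : (AdeleRing (𝓞 E) E)ˣ) : AdeleRing (𝓞 E) E).2 ∈ intFin E ∧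
        ((y⁻¹ * x : (AdeleRing (𝓞 E) E)ˣ) : AdeleRing (𝓞 E) E).2 ∈ intFin E) := by
    refine Filter.Eventually.and ?_ ?_
    · have hc : Continuous fun y : (AdeleRing (𝓞 E) E)ˣ =>
          ((x⁻¹ * y : (AdeleRing (𝓞 E) E)ˣ) : AdeleRing (𝓞 E) E).2 :=
        continuous_snd_adele.comp (Units.continuous_val.comp (continuous_const.mul continuous_id))
      refine hc.continuousAt.eventually (isOpen_intFin.mem_nhds ?_)
      change ((x⁻¹ * x : (AdeleRing (𝓞 E) E)ˣ) : AdeleRing (𝓞 E) E).2 ∈ intFin E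
      rw [inv_mul_cancel]; exact one_mem_intFin
    · have hc : Continuous fun y : (AdeleRing (𝓞 E) E)ˣ =>
          ((y⁻¹ * x : (AdeleRing (𝓞 E) E)ˣ) : AdeleRing (𝓞 E) E).2 :=
        continuous_snd_adele.comp (Units.continuous_val.comp (continuous_inv.mul continuous_const))
      refine hc.continuousAt.eventually (isOpen_intFin.mem_nhds ?_)
      change ((x⁻¹ * x : (AdeleRing (𝓞 E) E)ˣ) : AdeleRing (𝓞 E) E).2 ∈ intFin E
      rw [inv_mul_cancel]; exact one_mem_intFin
  filter_upwards [h1] with y hy v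
  have key : ∀ a b : (AdeleRing (𝓞 E) E)ˣ,
      ((a⁻¹ * b : (AdeleRing (𝓞 E) E)ˣ) : AdeleRing (𝓞 E) E).2 ∈ intFin E →
      Valued.v ((b : AdeleRing (𝓞 E) E).2 v) ≤ Valued.v ((a : AdeleRing (𝓞 E) E).2 v) := by
    intro a b hab
    have h : ((b : AdeleRing (𝓞 E) E).2 v)
        = ((a : AdeleRing (𝓞 E) E).2 v) *
          ((a⁻¹ * b : (AdeleRing (𝓞 E) E)ˣ) : AdeleRing (𝓞 E) E).2 v := by
      have : b = a * (a⁻¹ * b) := by group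
      conv_lhs => rw [this]
      rfl
    rw [h, map_mul]
    exact mul_le_of_le_one_right' (hab v)
  exact le_antisymm (key _ _ hy.1) (key _ _ hy.2)

/-- The archimedean factor is a finite product of continuous functions, and the finite factor is
locally constant. -/
theorem continuous_ideleNorm : Continuous (ideleNorm (E := E)) := by
  have h1 : Continuous fun x : (AdeleRing (𝓞 E) E)ˣ =>
      ∏ w : InfinitePlace E, ‖(x : AdeleRing (𝓞 E) E).1 w‖ ^ w.mult :=
    continuous_finsetProd _ fun w _ => ((continuous_norm_fst w).comp Units.continuous_val).pow _
  have h2 : Continuous fun x : (AdeleRing (𝓞 E) E)ˣ => finAbs (x : AdeleRing (𝓞 E) E).2 := by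
    refine continuous_iff_continuousAt.2 fun x => ?_
    refine (continuousAt_const (y := finAbs (x : AdeleRing (𝓞 E) E).2)).congr ?_
    filter_upwards [eventually_valued_eq x] with y hy
    exact (finAbs_eq_of_valued_eq hy).symm
  exact h1.mul h2

theorem continuous_units_det_GA :
    Continuous (Matrix.GeneralLinearGroup.det : GA E →* (AdeleRing (𝓞 E) E)ˣ) := by
  refine Units.continuous_iff.2 ⟨continuous_det_GA, ?_⟩
  have : (fun g : GA E => (((Matrix.GeneralLinearGroup.det g)⁻¹ : (AdeleRing (𝓞 E) E)ˣ) :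
      AdeleRing (𝓞 E) E)) = fun g => ((Matrix.GeneralLinearGroup.det g⁻¹ :
      (AdeleRing (𝓞 E) E)ˣ) : AdeleRing (𝓞 E) E) := by
    ext1 g; rw [map_inv]
  exact this ▸ continuous_det_GA.comp continuous_inv

theorem isClosed_GAOne : IsClosed (GAOne E : Set (GA E)) := by
  have : (GAOne E : Set (GA E)) = {g | ideleNorm (Matrix.GeneralLinearGroup.det g) = 1} := rfl
  rw [this]
  exact isClosed_eq (continuous_ideleNorm.comp continuous_units_det_GA) continuous_const

theorem isMulRightInvariant_GAOne (μ : Measure (GAOne E)) [μ.IsHaarMeasure] :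
    μ.IsMulRightInvariant :=
  isMulRightInvariant_of_det ideleNorm.ker (GAOne E) (fun _ => Iff.rfl) isClosed_GAOne μ

theorem isMulRightInvariant_GAArchOne (ν : Measure (GAArchOne E)) [ν.IsHaarMeasure] :
    ν.IsMulRightInvariant := by
  refine isMulRightInvariant_of_det ((GAArchOne E).map Matrix.GeneralLinearGroup.det) (GAArchOne E)
    (fun g => ⟨fun h => ⟨g, h, rfl⟩, ?_⟩) isClosed_GAArchOne ν
  rintro ⟨g', hg', h⟩ w
  rw [← h]; exact hg' w

instance : LocallyCompactSpace (GAOne E) := isClosed_GAOne.isClosedEmbedding_subtypeVal.locallyCompactSpace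

instance : LocallyCompactSpace (GAArchOne E) :=
  isClosed_GAArchOne.isClosedEmbedding_subtypeVal.locallyCompactSpace

/-! ### The Galois action is continuous -/

theorem continuous_infCompletionHom (σ : E ≃+* E) (w : InfinitePlace E) :
    Continuous (infCompletionHom σ w) :=
  (InfinitePlace.Completion.continuous_ofCompletion _).comp
    ((isometry_infLocalHom σ w).completion_map.continuous.comp
      (InfinitePlace.Completion.continuous_toCompletion _))

theorem continuous_finCompletionHom (σ : E ≃+* E) (v : HeightOneSpectrum (𝓞 E)) :
    Continuous (finCompletionHom σ v) :=
  (HeightOneSpectrum.adicCompletion.continuous_ofCompletion E v).comp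
    (UniformSpace.Completion.continuous_map.comp
      (HeightOneSpectrum.adicCompletion.continuous_toCompletion E _))

theorem continuous_galAdele (σ : E ≃+* E) : Continuous (galAdele (E := E) σ) := by
  have h1 : Continuous (galInf (E := E) σ) :=
    continuous_pi fun w => (continuous_infCompletionHom σ w).comp (continuous_apply _)
  have h2 : Continuous (galFin (E := E) σ) :=
    RestrictedProduct.mapAlong_continuous
      (fun v : HeightOneSpectrum (𝓞 E) => v.adicCompletion E)
      (fun v : HeightOneSpectrum (𝓞 E) => v.adicCompletion E)
      (finPullback σ) (finPullback_injective σ).tendsto_cofinite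
      (fun v => finCompletionHom σ v)
      (Filter.Eventually.of_forall fun v x hx => finCompletionHom_integral σ v x hx)
      (continuous_finCompletionHom σ)
  exact (h1.comp continuous_fst_adele).prodMk (h2.comp continuous_snd_adele)

theorem isClosed_unitaryTwo {σ : AdeleRing (𝓞 E) E →+* AdeleRing (𝓞 E) E} (hσ : Continuous σ) :
    IsClosed (unitaryTwo σ : Set (GA E)) := by
  have hm : Continuous (Matrix.GeneralLinearGroup.map (n := Fin 2) σ) :=
    Continuous.units_map _ (continuous_id.matrix_map hσ)
  exact isClosed_eq Units.continuous_val
    ((continuous_const.mul (Units.continuous_val.comp hm.inv).matrix_transpose).mul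
      continuous_const)

open mixedEmbedding

/-! ## Real coordinates at infinity -/

open scoped Classical in
theorem continuous_ringEquiv_mixedSpace :
    Continuous (InfiniteAdeleRing.ringEquiv_mixedSpace E) := by
  refine Continuous.prodMk (continuous_pi fun w => ?_) (continuous_pi fun w => ?_)
  · exact (InfinitePlace.Completion.isometry_extensionEmbeddingOfIsReal w.2).continuous.comp
      (continuous_apply w.1)
  · exact (InfinitePlace.Completion.isometry_extensionEmbedding w.1).continuous.comp
      (continuous_apply w.1)

open scoped Classical in
theorem continuous_ringEquiv_mixedSpace_symm :
    Continuous (InfiniteAdeleRing.ringEquiv_mixedSpace E).symm := by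
  refine continuous_pi fun w => ?_
  by_cases hw : w.IsReal
  · have h : ∀ x : mixedSpace E, (InfiniteAdeleRing.ringEquiv_mixedSpace E).symm x w
        = (InfinitePlace.Completion.isometryEquivRealOfIsReal hw).symm (x.1 ⟨w, hw⟩) := fun x => by
      rw [IsometryEquiv.eq_symm_apply]
      have := congrFun (congrArg Prod.fst
        ((InfiniteAdeleRing.ringEquiv_mixedSpace E).apply_symm_apply x)) ⟨w, hw⟩
      exact this
    simp only [h]
    exact (IsometryEquiv.continuous _).comp ((continuous_apply _).comp continuous_fst)
  · have hw' := InfinitePlace.not_isReal_iff_isComplex.1 hw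
    have h : ∀ x : mixedSpace E, (InfiniteAdeleRing.ringEquiv_mixedSpace E).symm x w
        = (InfinitePlace.Completion.isometryEquivComplexOfIsComplex hw').symm (x.2 ⟨w, hw'⟩) :=
        fun x => by
      rw [IsometryEquiv.eq_symm_apply]
      have := congrFun (congrArg Prod.snd
        ((InfiniteAdeleRing.ringEquiv_mixedSpace E).apply_symm_apply x)) ⟨w, hw'⟩
      exact this
    simp only [h]
    exact (IsometryEquiv.continuous _).comp ((continuous_apply _).comp continuous_snd)

/-- `2 × 2` matrices over `E_∞` as a normed space. -/
abbrev MatInf (E : Type*) [Field E] : Type _ := Fin 2 → Fin 2 → mixedSpace E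

/-- The projection of `GL₂(𝔸_E)` to `GL₂(E_∞)` in real coordinates. -/
def toMix : GA E →* GL (Fin 2) (mixedSpace E) :=
  (Matrix.GeneralLinearGroup.map
    (InfiniteAdeleRing.ringEquiv_mixedSpace E : InfiniteAdeleRing E →+* mixedSpace E)).comp toInf

/-- The inclusion of `GL₂(E_∞)`, in real coordinates, into `GL₂(𝔸_E)`. -/
def ofMix (U : GL (Fin 2) (mixedSpace E)) : GA E :=
  ofInf (Matrix.GeneralLinearGroup.map
    ((InfiniteAdeleRing.ringEquiv_mixedSpace E).symm : mixedSpace E →+* InfiniteAdeleRing E) U)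

theorem ofMix_mul (U V : GL (Fin 2) (mixedSpace E)) : ofMix (U * V) = ofMix U * ofMix V := by
  rw [ofMix, map_mul, ofInf_mul]; rfl

@[simp] theorem ofMix_one : ofMix (1 : GL (Fin 2) (mixedSpace E)) = 1 := by
  rw [ofMix, map_one, ofInf_one]

@[simp] theorem toMix_ofMix (U : GL (Fin 2) (mixedSpace E)) : toMix (ofMix U) = U := by
  refine Units.ext ?_
  ext1 i j
  exact (InfiniteAdeleRing.ringEquiv_mixedSpace E).apply_symm_apply (U i j)

@[simp] theorem toFin_ofMix (U : GL (Fin 2) (mixedSpace E)) : toFin (ofMix U) = 1 := toFin_ofInf _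

theorem toInf_eq_of_toMix_eq {g h : GA E} (hgh : toMix g = toMix h) : toInf g = toInf h := by
  refine Units.ext ?_
  ext1 i j
  refine (InfiniteAdeleRing.ringEquiv_mixedSpace E).injective ?_
  exact congrFun (congrFun (congrArg (fun U : GL (Fin 2) (mixedSpace E) =>
    (U : Matrix (Fin 2) (Fin 2) (mixedSpace E))) hgh) i) j

theorem GA_ext' {g h : GA E} (h1 : toMix g = toMix h) (h2 : toFin g = toFin h) : g = h :=
  GA_ext (toInf_eq_of_toMix_eq h1) h2

@[simp] theorem toMix_ofFin (k : GL (Fin 2) (FiniteAdeleRing (𝓞 E) E)) :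
    toMix (ofFin k) = 1 := by
  rw [toMix, MonoidHom.comp_apply, toInf_ofFin, map_one]

/-- Archimedean factors commute with finite ones, so only the component at infinity is conjugated.
This is what turns left derivatives, and derivatives inside a right translate, into left-invariant
ones twisted by the adjoint action. -/
theorem ofMix_mul_eq (U : GL (Fin 2) (mixedSpace E)) (g : GA E) :
    ofMix U * g = g * ofMix ((toMix g)⁻¹ * U * toMix g) :=
  GA_ext' (by simp [mul_assoc]) (by simp)

theorem ofMix_toMix_mul_ofFin (g : GA E) : ofMix (toMix g) * ofFin (toFin g) = g :=
  GA_ext' (by simp) (by simp)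

theorem continuous_toMix : Continuous (toMix (E := E)) :=
  (Continuous.units_map _ (continuous_id.matrix_map continuous_ringEquiv_mixedSpace)).comp
    continuous_toInf

theorem continuous_ofMix : Continuous (ofMix (E := E)) :=
  continuous_ofInf.comp
    (Continuous.units_map _ (continuous_id.matrix_map continuous_ringEquiv_mixedSpace_symm))

theorem ofInf_glInf_coe (U : GL (Fin 2) (mixedSpace E)) :
    ofInf (glInf (U : Matrix (Fin 2) (Fin 2) (mixedSpace E))) = ofMix U := by
  have h : IsUnit (U : Matrix (Fin 2) (Fin 2) (mixedSpace E)).det :=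
    (Matrix.isUnit_iff_isUnit_det _).1 U.isUnit
  rw [glInf, dif_pos h]
  have : Matrix.nonsingInvUnit (U : Matrix (Fin 2) (Fin 2) (mixedSpace E)) h = U := Units.ext rfl
  rw [this]; rfl

theorem exists_unit_of_isUnit_det {M : Matrix (Fin 2) (Fin 2) (mixedSpace E)}
    (h : IsUnit M.det) : ∃ U : GL (Fin 2) (mixedSpace E), (U : Matrix _ _ _) = M :=
  ⟨Matrix.nonsingInvUnit M h, rfl⟩

open scoped Classical in
theorem isOpen_isUnit_det : IsOpen {M : MatInf E | IsUnit (Matrix.of M).det} := by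
  have h : Continuous fun M : MatInf E => (Matrix.of M).det :=
    Continuous.matrix_det (continuous_id (X := Matrix (Fin 2) (Fin 2) (mixedSpace E)))
  have h2 : IsOpen {x : mixedSpace E | IsUnit x} := Units.isOpen (R := mixedSpace E)
  exact h2.preimage h

/-! ### Scalar matrices -/

/-- The unit of `E_∞` with positive real components `r`. -/
def realUnit (r : InfinitePlace E → ℝ) (hr : ∀ w, 0 < r w) : (mixedSpace E)ˣ where
  val := realVec r
  inv := realVec fun w => (r w)⁻¹
  val_inv := by
    refine Prod.ext (funext fun w => mul_inv_cancel₀ (hr _).ne') (funext fun w => ?_)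
    change (r w.1 : ℂ) * (((r w.1)⁻¹ : ℝ) : ℂ) = 1
    rw [← Complex.ofReal_mul, mul_inv_cancel₀ (hr _).ne', Complex.ofReal_one]
  inv_val := by
    refine Prod.ext (funext fun w => inv_mul_cancel₀ (hr _).ne') (funext fun w => ?_)
    change (((r w.1)⁻¹ : ℝ) : ℂ) * (r w.1 : ℂ) = 1
    rw [← Complex.ofReal_mul, inv_mul_cancel₀ (hr _).ne', Complex.ofReal_one]

theorem realVec_mul (r s : InfinitePlace E → ℝ) :
    realVec (fun w => r w * s w) = realVec r * realVec s :=
  Prod.ext rfl (funext fun w => Complex.ofReal_mul _ _)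

theorem realVec_one : realVec (fun _ : InfinitePlace E => (1 : ℝ)) = 1 :=
  Prod.ext rfl (funext fun _ => Complex.ofReal_one)

theorem continuous_realVec : Continuous (realVec (E := E)) :=
  (continuous_pi fun w => continuous_apply w.1).prodMk
    (continuous_pi fun w => Complex.continuous_ofReal.comp (continuous_apply w.1))

theorem scalarInf_eq (r : InfinitePlace E → ℝ) (hr : ∀ w, 0 < r w) :
    scalarInf r = ofMix (diagGL (realUnit r hr) (realUnit r hr)) := by
  rw [← ofInf_glInf_coe]
  unfold scalarInf
  congr 2
  ext1 i j
  fin_cases i <;> fin_cases j <;> rfl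

theorem torusInf_eq {t : ℝ} (ht : 0 < t) :
    torusInf (E := E) t = ofMix (diagGL (realUnit (fun _ => t) fun _ => ht)
      (realUnit (fun _ => t⁻¹) fun _ => inv_pos.2 ht)) := by
  rw [← ofInf_glInf_coe]
  unfold torusInf
  congr 2
  ext1 i j
  fin_cases i <;> fin_cases j <;> rfl

theorem scalarInf_mul {r s : InfinitePlace E → ℝ} (hr : ∀ w, 0 < r w) (hs : ∀ w, 0 < s w) :
    scalarInf r * scalarInf s = scalarInf fun w => r w * s w := by
  rw [scalarInf_eq r hr, scalarInf_eq s hs, scalarInf_eq _ fun w => mul_pos (hr w) (hs w),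
    ← ofMix_mul, diagGL_mul]
  congr 2 <;> exact Units.ext (realVec_mul r s).symm

theorem scalarInf_one : scalarInf (E := E) (fun _ => 1) = 1 := by
  rw [scalarInf_eq _ fun _ => one_pos]
  have : realUnit (E := E) (fun _ => 1) (fun _ => one_pos) = 1 := Units.ext realVec_one
  rw [this, diagGL_one, ofMix_one]

theorem scalarInf_comm {r : InfinitePlace E → ℝ} (hr : ∀ w, 0 < r w) (g : GA E) :
    scalarInf r * g = g * scalarInf r := by
  rw [scalarInf_eq r hr, ofMix_mul_eq, mul_assoc, diagGL_scalar_comm, inv_mul_cancel_left]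

theorem scalarInf_inv {r : InfinitePlace E → ℝ} (hr : ∀ w, 0 < r w) :
    (scalarInf r)⁻¹ = scalarInf fun w => (r w)⁻¹ := by
  rw [inv_eq_iff_mul_eq_one, scalarInf_mul hr fun w => inv_pos.2 (hr w)]
  simp only [mul_inv_cancel₀ (hr _).ne', scalarInf_one]

theorem continuous_scalarInf {X : Type*} [TopologicalSpace X] {r : X → InfinitePlace E → ℝ}
    (hr : ∀ x w, 0 < r x w) (hc : Continuous r) : Continuous fun x => scalarInf (r x) := by
  have h : (fun x => scalarInf (r x))
      = fun x => ofMix (diagGL (realUnit (r x) (hr x)) (realUnit (r x) (hr x))) :=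
    funext fun x => scalarInf_eq _ _
  rw [h]
  refine continuous_ofMix.comp (Units.continuous_iff.2 ⟨?_, ?_⟩)
  · have h1 : Continuous fun x => realVec (r x) := continuous_realVec.comp hc
    refine continuous_matrix fun i j => ?_
    fin_cases i <;> fin_cases j
    exacts [h1, continuous_const, continuous_const, h1]
  · have h1 : Continuous fun x => realVec fun w => (r x w)⁻¹ :=
      continuous_realVec.comp (continuous_pi fun w =>
        ((continuous_apply w).comp hc).inv₀ fun x => (hr x w).ne')
    refine continuous_matrix fun i j => ?_
    fin_cases i <;> fin_cases j
    exacts [h1, continuous_const, continuous_const, h1]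

/-! ### The projection to `G(𝔸_F)^1` -/

theorem extensionEmbedding_symm_realVec (r : InfinitePlace E → ℝ) (w : InfinitePlace E) :
    InfinitePlace.Completion.extensionEmbedding w
      ((InfiniteAdeleRing.ringEquiv_mixedSpace E).symm (realVec r) w) = (r w : ℂ) := by
  classical
  set x := (InfiniteAdeleRing.ringEquiv_mixedSpace E).symm (realVec r) with hx
  have h : InfiniteAdeleRing.ringEquiv_mixedSpace E x = realVec r := by
    rw [hx, RingEquiv.apply_symm_apply]
  by_cases hw : w.IsReal
  · have h1 := congrFun (congrArg Prod.fst h) ⟨w, hw⟩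
    rw [← InfinitePlace.Completion.extensionEmbeddingOfIsReal_apply hw]
    exact congrArg Complex.ofReal h1
  · exact congrFun (congrArg Prod.snd h) ⟨w, InfinitePlace.not_isReal_iff_isComplex.1 hw⟩

theorem norm_symm_realVec (r : InfinitePlace E → ℝ) (w : InfinitePlace E) :
    ‖(InfiniteAdeleRing.ringEquiv_mixedSpace E).symm (realVec r) w‖ = |r w| := by
  rw [← (InfinitePlace.Completion.isometry_extensionEmbedding w).norm_map_of_map_zero (map_zero _),
    extensionEmbedding_symm_realVec, Complex.norm_real, Real.norm_eq_abs]

theorem finAbs_one : finAbs (1 : FiniteAdeleRing (𝓞 E) E) = 1 := by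
  unfold finAbs
  have h2 : ∀ v : HeightOneSpectrum (𝓞 E), ‖(1 : FiniteAdeleRing (𝓞 E) E) v‖ = 1 :=
    fun v => norm_one (α := v.adicCompletion E)
  simp only [h2, finprod_one]

theorem toInf_scalarInf_apply {r : InfinitePlace E → ℝ} (hr : ∀ w, 0 < r w) (i j : Fin 2) :
    toInf (scalarInf r) i j
      = if i = j then (InfiniteAdeleRing.ringEquiv_mixedSpace E).symm (realVec r) else 0 := by
  rw [scalarInf_eq r hr, ofMix, toInf_ofInf]
  change (InfiniteAdeleRing.ringEquiv_mixedSpace E).symm (diagGL _ _ i j) = _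
  fin_cases i <;> fin_cases j <;> simp [realUnit]

theorem toFin_scalarInf {r : InfinitePlace E → ℝ} (hr : ∀ w, 0 < r w) :
    toFin (scalarInf r) = 1 := by
  rw [scalarInf_eq r hr, toFin_ofMix]

theorem fst_det (g : GA E) :
    ((Matrix.GeneralLinearGroup.det g : (AdeleRing (𝓞 E) E)ˣ) : AdeleRing (𝓞 E) E).1
      = (Matrix.GeneralLinearGroup.det (toInf g) : (InfiniteAdeleRing E)ˣ) := by
  simp only [Matrix.GeneralLinearGroup.val_det_apply, Matrix.det_fin_two]; rfl

theorem snd_det (g : GA E) :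
    ((Matrix.GeneralLinearGroup.det g : (AdeleRing (𝓞 E) E)ˣ) : AdeleRing (𝓞 E) E).2
      = (Matrix.GeneralLinearGroup.det (toFin g) : (FiniteAdeleRing (𝓞 E) E)ˣ) := by
  simp only [Matrix.GeneralLinearGroup.val_det_apply, Matrix.det_fin_two]; rfl

theorem norm_det_scalarInf {r : InfinitePlace E → ℝ} (hr : ∀ w, 0 < r w) (w : InfinitePlace E) :
    ‖((Matrix.GeneralLinearGroup.det (scalarInf r) : (AdeleRing (𝓞 E) E)ˣ) :
      AdeleRing (𝓞 E) E).1 w‖ = r w ^ 2 := by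
  rw [fst_det, Matrix.GeneralLinearGroup.val_det_apply, Matrix.det_fin_two,
    toInf_scalarInf_apply hr, toInf_scalarInf_apply hr, toInf_scalarInf_apply hr]
  simp only [if_true, zero_ne_one, if_false, zero_mul, sub_zero]
  refine (norm_mul (α := w.Completion) _ _).trans ?_
  rw [norm_symm_realVec, abs_of_pos (hr w), sq]

/-- The determinant is `t ^ 2` at each infinite place and the local degrees sum to `[E:ℚ]`. This
accounts for the exponent in `normFactor`. -/
theorem ideleNorm_det_scalarInf {t : ℝ} (ht : 0 < t) :
    ideleNorm (Matrix.GeneralLinearGroup.det (scalarInf (E := E) fun _ => t))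
      = t ^ (2 * Module.finrank ℚ E) := by
  change (∏ w : InfinitePlace E, ‖_‖ ^ w.mult) * finAbs _ = _
  have h1 : finAbs ((Matrix.GeneralLinearGroup.det (scalarInf (E := E) fun _ => t) :
      (AdeleRing (𝓞 E) E)ˣ) : AdeleRing (𝓞 E) E).2 = 1 := by
    rw [snd_det, toFin_scalarInf fun _ => ht, map_one]; exact finAbs_one
  rw [h1, mul_one]
  simp only [norm_det_scalarInf fun _ => ht, ← pow_mul]
  rw [Finset.prod_pow_eq_pow_sum, ← Finset.mul_sum, InfinitePlace.sum_mult_eq]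

theorem ideleNorm_pos (x : (AdeleRing (𝓞 E) E)ˣ) : 0 < ideleNorm x := by
  have h0 : ideleNorm x ≠ 0 := by
    intro h
    have := map_mul ideleNorm x x⁻¹
    rw [mul_inv_cancel, map_one, h, zero_mul] at this
    exact one_ne_zero this
  refine lt_of_le_of_ne ?_ h0.symm
  refine mul_nonneg (Finset.prod_nonneg fun w _ => by positivity) ?_
  exact finprod_nonneg fun v => norm_nonneg _

/-- The scaling factor that makes the determinant of `g` have idelic norm one. -/
def normFactor (g : GA E) : ℝ :=
  ideleNorm (Matrix.GeneralLinearGroup.det g) ^ (-(1 / (2 * Module.finrank ℚ E : ℝ)))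

theorem normFactor_pos (g : GA E) : 0 < normFactor g := Real.rpow_pos_of_pos (ideleNorm_pos _) _

theorem normFactor_mul (g h : GA E) : normFactor (g * h) = normFactor g * normFactor h := by
  unfold normFactor
  rw [map_mul, map_mul, Real.mul_rpow (ideleNorm_pos _).le (ideleNorm_pos _).le]

theorem continuous_normFactor : Continuous (normFactor (E := E)) :=
  (continuous_ideleNorm.comp continuous_units_det_GA).rpow_const
    fun g => Or.inl (ideleNorm_pos _).ne'

/-- The projection `G(𝔸_F) = G(𝔸_F)^1 × ℝ_{>0} → G(𝔸_F)^1`. -/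
def projOne (g : GA E) : GAOne E :=
  ⟨scalarInf (fun _ => normFactor g) * g, by
    change ideleNorm (Matrix.GeneralLinearGroup.det _) = 1
    rw [map_mul, map_mul, ideleNorm_det_scalarInf (normFactor_pos g)]
    have hd : (0 : ℝ) < Module.finrank ℚ E := by exact_mod_cast Module.finrank_pos
    unfold normFactor
    rw [← Real.rpow_natCast, ← Real.rpow_mul (ideleNorm_pos _).le]
    push_cast
    have : -(1 / (2 * Module.finrank ℚ E : ℝ)) * (2 * Module.finrank ℚ E : ℝ) = -1 := by
      field_simp
    rw [this, Real.rpow_neg_one, inv_mul_cancel₀ (ideleNorm_pos _).ne']⟩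

theorem coe_projOne (g : GA E) :
    (projOne g : GA E) = scalarInf (fun _ => normFactor g) * g := rfl

theorem continuous_projOne : Continuous (projOne (E := E)) :=
  Continuous.subtype_mk ((continuous_scalarInf (fun g _ => normFactor_pos g)
    (continuous_pi fun _ => continuous_normFactor)).mul continuous_id) _

theorem normFactor_coe (g : GAOne E) : normFactor (g : GA E) = 1 := by
  have : ideleNorm (Matrix.GeneralLinearGroup.det (g : GA E)) = 1 := g.2
  rw [normFactor, this, Real.one_rpow]

theorem projOne_coe (g : GAOne E) : projOne (g : GA E) = g :=
  Subtype.ext (by rw [coe_projOne, normFactor_coe, scalarInf_one, one_mul])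

theorem projOne_mul (g h : GA E) : projOne (g * h) = projOne g * projOne h := by
  refine Subtype.ext ?_
  rw [Subgroup.coe_mul, coe_projOne, coe_projOne, coe_projOne, normFactor_mul,
    ← scalarInf_mul (fun _ => normFactor_pos g) fun _ => normFactor_pos h, mul_assoc, mul_assoc,
    ← mul_assoc (scalarInf fun _ => normFactor h),
    scalarInf_comm (fun _ => normFactor_pos h) g, mul_assoc]

theorem apply_projOne {f : GA E → ℂ} (hf : IsScalarInvariant f) (g : GA E) :
    f (projOne g) = f g := hf _ (normFactor_pos g) g

/-! ### Derivatives along `G(F_∞)` in left-invariant coordinates -/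

section Derivatives

open scoped Classical

/-- The map `M ↦ M` from `2 × 2` matrices over `E_∞` to `GL₂(𝔸_E)`. -/
def rho (M : MatInf E) : GA E := ofInf (glInf (Matrix.of M))

/-- A matrix as a point of the normed space of matrices. -/
def vecM (A : Matrix (Fin 2) (Fin 2) (mixedSpace E)) : MatInf E := fun i j => A i j

/-- An invertible matrix as a point of the normed space of matrices. -/
def vec (U : GL (Fin 2) (mixedSpace E)) : MatInf E :=
  vecM (U : Matrix (Fin 2) (Fin 2) (mixedSpace E))

theorem rho_vec (U : GL (Fin 2) (mixedSpace E)) : rho (vec U) = ofMix U := ofInf_glInf_coe U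

theorem isUnit_det_vec (U : GL (Fin 2) (mixedSpace E)) : IsUnit (Matrix.of (vec U)).det := by
  have h : IsUnit (U : Matrix (Fin 2) (Fin 2) (mixedSpace E)).det :=
    (Matrix.isUnit_iff_isUnit_det (n := Fin 2) _).1 (Units.isUnit U)
  exact h

theorem eventually_isUnit_det (U : GL (Fin 2) (mixedSpace E)) :
    ∀ᶠ M : MatInf E in nhds (vec U), IsUnit (Matrix.of M).det :=
  isOpen_isUnit_det.mem_nhds (isUnit_det_vec U)

theorem exists_vec_eq {M : MatInf E} (h : IsUnit (Matrix.of M).det) :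
    ∃ U : GL (Fin 2) (mixedSpace E), vec U = M := exists_unit_of_isUnit_det h

theorem continuous_vec : Continuous (vec (E := E)) := by
  have h : Continuous fun U : GL (Fin 2) (mixedSpace E) =>
    (U : Matrix (Fin 2) (Fin 2) (mixedSpace E)) := Units.continuous_val
  exact h

/-- The linear map `M ↦ A M B`. -/
def mulLR (A B : Matrix (Fin 2) (Fin 2) (mixedSpace E)) : MatInf E →L[ℝ] MatInf E :=
  LinearMap.toContinuousLinearMap
    { toFun := fun M => vecM (A * Matrix.of M * B)
      map_add' := fun M N => by
        change vecM (A * (Matrix.of M + Matrix.of N) * B) = _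
        rw [mul_add, add_mul]; rfl
      map_smul' := fun c M => by
        change vecM (A * (c • Matrix.of M) * B) = _
        rw [Matrix.mul_smul, Matrix.smul_mul]; rfl }

theorem mulLR_apply (A B : Matrix (Fin 2) (Fin 2) (mixedSpace E)) (M : MatInf E) :
    mulLR A B M = vecM (A * Matrix.of M * B) := rfl

/-- The map `X ↦ x⁻¹ X x` on the Lie algebra of `G(F_∞)`. -/
def adInv (x : GA E) : MatInf E →L[ℝ] MatInf E :=
  mulLR ((toMix x)⁻¹ : GL (Fin 2) (mixedSpace E)) (toMix x)

@[simp] theorem adInv_one (X : MatInf E) : adInv 1 X = X := by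
  rw [adInv, map_one, inv_one, mulLR_apply, Units.val_one, one_mul, mul_one]; rfl

/-- `D` is the derivative of `f` along `G(F_∞)`, in left-invariant coordinates. -/
def HasD (f : GA E → ℂ) (D : GA E → MatInf E →L[ℝ] ℂ) : Prop :=
  ∀ g, HasFDerivAt (fun M : MatInf E => f (g * rho M)) (D g) (vec 1)

/-- Writing `g M x = (g U x) · (x⁻¹ U⁻¹ M x)` for `M` near `U` reduces the derivative at any base
point, with a right factor `x`, to the derivative at the identity composed with a linear map. -/
theorem HasD.hasFDerivAt {f : GA E → ℂ} {D : GA E → MatInf E →L[ℝ] ℂ} (h : HasD f D) (g x : GA E)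
    (U : GL (Fin 2) (mixedSpace E)) :
    HasFDerivAt (fun M : MatInf E => f (g * rho M * x))
      ((D (g * ofMix U * x)).comp (mulLR (((toMix x)⁻¹ * U⁻¹ : GL (Fin 2) (mixedSpace E)) :
        Matrix (Fin 2) (Fin 2) (mixedSpace E)) (toMix x))) (vec U) := by
  set L := mulLR (((toMix x)⁻¹ * U⁻¹ : GL (Fin 2) (mixedSpace E)) :
        Matrix (Fin 2) (Fin 2) (mixedSpace E)) (toMix x) with hL
  have hLv : ∀ V : GL (Fin 2) (mixedSpace E),
      L (vec V) = vec ((toMix x)⁻¹ * U⁻¹ * V * toMix x) := fun V => by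
    rw [hL, mulLR_apply]; rfl
  have h1 : L (vec U) = vec 1 := by
    rw [hLv]; congr 1; group
  have h2 := h (g * ofMix U * x)
  rw [← h1] at h2
  refine (h2.comp (vec U) L.hasFDerivAt).congr_of_eventuallyEq ?_
  filter_upwards [eventually_isUnit_det U] with M hM
  obtain ⟨V, rfl⟩ := exists_vec_eq hM
  simp only [Function.comp_apply, hLv, rho_vec]
  congr 1
  rw [mul_assoc g, ofMix_mul_eq V x, mul_assoc g, ofMix_mul_eq U x, mul_assoc g, mul_assoc x,
    ← ofMix_mul]
  congr 3
  group

theorem expInf_eq (X : LieInf E) (s : ℝ) : expInf X s = rho (vecM (NormedSpace.exp (s • X))) := rfl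

theorem exists_coe_eq_exp (X : LieInf E) :
    ∃ U : GL (Fin 2) (mixedSpace E),
      (U : Matrix (Fin 2) (Fin 2) (mixedSpace E)) = NormedSpace.exp X :=
  ⟨(Matrix.isUnit_exp X).unit, rfl⟩

attribute [local instance] Matrix.linftyOpNormedRing Matrix.linftyOpNormedAlgebra in
theorem hasDerivAt_exp (X : LieInf E) (s : ℝ) :
    HasDerivAt (fun s : ℝ => vecM (NormedSpace.exp (s • X)))
      (vecM (NormedSpace.exp (s • X) * X)) s :=
  hasDerivAt_exp_smul_const X s

/-- The velocity of the curve at time `s` is `exp(sX) X`; in left-invariant form, moved to the right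
of `x`, it is `x⁻¹ X x` for every `s`. -/
theorem HasD.hasDerivAt_expInf {f : GA E → ℂ} {D : GA E → MatInf E →L[ℝ] ℂ} (h : HasD f D)
    (g x : GA E) (X : LieInf E) (s : ℝ) :
    HasDerivAt (fun s => f (g * expInf X s * x))
      (D (g * expInf X s * x) (adInv x (vecM X))) s := by
  obtain ⟨U, hU⟩ := exists_coe_eq_exp (s • X)
  have h1 := h.hasFDerivAt g x U
  have e : expInf X s = ofMix U := by rw [expInf_eq, ← hU]; exact rho_vec U
  have hv : vec U = vecM (NormedSpace.exp (s • X)) := by rw [← hU]; rfl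
  rw [hv] at h1
  have h2 := HasFDerivAt.comp_hasDerivAt s h1 (hasDerivAt_exp X s)
  rw [e]
  refine h2.congr_deriv ?_
  rw [ContinuousLinearMap.comp_apply]
  congr 1
  rw [← hU, adInv, mulLR_apply, mulLR_apply]
  congr 1
  change _ * ((U : Matrix (Fin 2) (Fin 2) (mixedSpace E)) * X) * _ = _ * X * _
  rw [Units.val_mul, mul_assoc _ _ ((U : Matrix (Fin 2) (Fin 2) (mixedSpace E)) * X),
    ← mul_assoc _ (U : Matrix (Fin 2) (Fin 2) (mixedSpace E)), Units.inv_mul, one_mul]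

theorem expInf_zero (X : LieInf E) : expInf X 0 = 1 := by
  have : NormedSpace.exp ((0 : ℝ) • X)
      = ((1 : GL (Fin 2) (mixedSpace E)) : Matrix (Fin 2) (Fin 2) (mixedSpace E)) := by
    rw [zero_smul, NormedSpace.exp_zero]; rfl
  rw [expInf_eq, this]
  exact (rho_vec 1).trans ofMix_one

theorem HasD.rightDeriv_eq {f : GA E → ℂ} {D : GA E → MatInf E →L[ℝ] ℂ} (h : HasD f D)
    (Y : LieInf E) (g : GA E) : rightDeriv Y f g = -D g (vecM Y) := by
  -- The base point is written as `-0` because the chain rule below is applied to the inner map `s ↦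
  -- -s` at `0`.
  have h1 := h.hasDerivAt_expInf g 1 Y (-0)
  simp only [mul_one, neg_zero, expInf_zero, adInv_one] at h1
  rw [← neg_zero] at h1
  have h2 := HasDerivAt.scomp (0 : ℝ) h1 (hasDerivAt_neg (0 : ℝ))
  refine h2.deriv.trans ?_
  simp

/-- The derivative of `s ↦ f(exp(-sX) g)`. -/
theorem HasD.hasDerivAt_left {f : GA E → ℂ} {D : GA E → MatInf E →L[ℝ] ℂ} (h : HasD f D)
    (X : LieInf E) (g : GA E) (s : ℝ) :
    HasDerivAt (fun s => f (expInf X (-s) * g))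
      (-D (expInf X (-s) * g) (adInv g (vecM X))) s := by
  have h1 := h.hasDerivAt_expInf 1 g X (-s)
  simp only [one_mul] at h1
  refine (HasDerivAt.scomp s h1 (hasDerivAt_neg s)).congr_deriv ?_
  rw [neg_one_smul]

theorem HasD.leftDeriv_eq {f : GA E → ℂ} {D : GA E → MatInf E →L[ℝ] ℂ} (h : HasD f D)
    (X : LieInf E) (g : GA E) : leftDeriv X f g
      = -D g (adInv g (vecM X)) := by
  refine (h.hasDerivAt_left X g 0).deriv.trans ?_
  rw [neg_zero, expInf_zero, one_mul]

/-- Cramer's rule: the inverse is the adjugate, whose entries are polynomial, divided by the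
determinant, which is a unit at the base point. -/
theorem contDiffAt_matrix_inv (U : GL (Fin 2) (mixedSpace E)) :
    ContDiffAt ℝ ∞ (fun M : MatInf E => vecM (Matrix.of M)⁻¹) (vec U) := by
  have happ : ∀ i j : Fin 2, ContDiff ℝ ∞ (fun M : MatInf E => M i j) := fun i j =>
    contDiff_apply_apply ℝ _ i j
  have hdet : ContDiff ℝ ∞ (fun M : MatInf E => (Matrix.of M).det) := by
    simp only [Matrix.det_fin_two]
    exact ((happ 0 0).mul (happ 1 1)).sub ((happ 0 1).mul (happ 1 0))
  have hinv : ContDiffAt ℝ ∞ (fun M : MatInf E => Ring.inverse (Matrix.of M).det) (vec U) := by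
    have h := contDiffAt_ringInverse ℝ (n := ∞) (isUnit_det_vec U).unit
    exact h.comp (vec U) hdet.contDiffAt
  refine contDiffAt_pi.2 fun i => contDiffAt_pi.2 fun j => ?_
  have hadj : ContDiff ℝ ∞ (fun M : MatInf E => (Matrix.of M).adjugate i j) := by
    simp only [Matrix.adjugate_fin_two]
    fin_cases i <;> fin_cases j
    exacts [happ 1 1, (happ 0 1).neg, (happ 1 0).neg, happ 0 0]
  exact hinv.mul hadj.contDiffAt

theorem contDiff_matrix_mul {F : Type*} [NormedAddCommGroup F] [NormedSpace ℝ F] {n : WithTop ℕ∞}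
    {a b : F → MatInf E} {x : F} (ha : ContDiffAt ℝ n a x) (hb : ContDiffAt ℝ n b x) :
    ContDiffAt ℝ n (fun y => vecM (Matrix.of (a y) * Matrix.of (b y))) x := by
  refine contDiffAt_pi.2 fun i => contDiffAt_pi.2 fun j => ?_
  have ha' : ∀ i j, ContDiffAt ℝ n (fun y => a y i j) x := fun i j =>
    contDiffAt_pi.1 (contDiffAt_pi.1 ha i) j
  have hb' : ∀ i j, ContDiffAt ℝ n (fun y => b y i j) x := fun i j =>
    contDiffAt_pi.1 (contDiffAt_pi.1 hb i) j
  change ContDiffAt ℝ n (fun y => (Matrix.of (a y) * Matrix.of (b y)) i j) x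
  simp only [Matrix.mul_apply, Fin.sum_univ_two]
  exact ((ha' i 0).mul (hb' 0 j)).add ((ha' i 1).mul (hb' 1 j))

end Derivatives

/-! ### Smoothness criteria and test functions -/

section TestFunctions

open scoped Classical

variable (E) in
/-- A real basis of the space of `2 × 2` matrices over `E_∞`. -/
def matBasis : Module.Basis (Fin (Module.finrank ℝ (MatInf E))) ℝ (MatInf E) :=
  Module.finBasis ℝ (MatInf E)

/-- Coordinates with respect to `matBasis`. -/
def matCoord (i : Fin (Module.finrank ℝ (MatInf E))) : MatInf E →L[ℝ] ℝ :=
  LinearMap.toContinuousLinearMap ((matBasis E).coord i)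

theorem apply_eq_sum_matCoord (L : MatInf E →L[ℝ] ℂ) (V : MatInf E) :
    L V = ∑ i, (matCoord i V : ℂ) * L (matBasis E i) := by
  conv_lhs => rw [← (matBasis E).sum_repr V]
  rw [map_sum]
  refine Finset.sum_congr rfl fun i _ => ?_
  rw [map_smul, Complex.real_smul]; rfl

theorem HasD.hasFDerivAt_right {f : GA E → ℂ} {D : GA E → MatInf E →L[ℝ] ℂ} (h : HasD f D)
    (g : GA E) (U : GL (Fin 2) (mixedSpace E)) :
    HasFDerivAt (fun M : MatInf E => f (g * rho M))
      ((D (g * ofMix U)).comp (mulLR (U⁻¹ : GL (Fin 2) (mixedSpace E)) 1)) (vec U) := by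
  have := h.hasFDerivAt g 1 U
  simpa only [mul_one, map_one, inv_one, one_mul, Units.val_one] using this

theorem coe_inv_eq_of_vec (U : GL (Fin 2) (mixedSpace E)) :
    ((U⁻¹ : GL (Fin 2) (mixedSpace E)) : Matrix (Fin 2) (Fin 2) (mixedSpace E))
      = (Matrix.of (vec U))⁻¹ := Matrix.coe_units_inv U

/-- Induction on the order of differentiability. The derivative at `M` in direction `V` is the
left-invariant derivative along `M⁻¹ V`, that is, a finite sum of smooth coordinates of `M⁻¹ V`
times left-invariant derivatives along basis vectors, and these belong to the same class. -/
theorem smoothAtInf_of_forall_hasD (𝒞 : Set (GA E → ℂ))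
    (h : ∀ f ∈ 𝒞, ∃ D, HasD f D ∧ ∀ Y, (fun g => D g Y) ∈ 𝒞) :
    ∀ f ∈ 𝒞, SmoothAtInf f := by
  have diff : ∀ f ∈ 𝒞, ∀ g : GA E, DifferentiableOn ℝ (fun M : MatInf E => f (g * rho M))
      {M | IsUnit (Matrix.of M).det} := by
    intro f hf g M hM
    obtain ⟨U, rfl⟩ := exists_vec_eq hM
    obtain ⟨D, hD, -⟩ := h f hf
    exact (hD.hasFDerivAt_right g U).differentiableAt.differentiableWithinAt
  have key : ∀ n : ℕ, ∀ f ∈ 𝒞, ∀ g : GA E, ContDiffOn ℝ n (fun M : MatInf E => f (g * rho M))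
      {M | IsUnit (Matrix.of M).det} := by
    intro n
    induction n with
    | zero => exact fun f hf g => contDiffOn_zero.2 (diff f hf g).continuousOn
    | succ n ih =>
      intro f hf g
      push_cast
      rw [contDiffOn_succ_iff_fderiv_of_isOpen isOpen_isUnit_det]
      refine ⟨diff f hf g, by simp, contDiffOn_clm_apply.2 fun V => ?_⟩
      obtain ⟨D, hD, hD'⟩ := h f hf
      have hc : ∀ i, ContDiffOn ℝ n (fun M : MatInf E =>
          matCoord i (vecM ((Matrix.of M)⁻¹ * Matrix.of V)))
          {M | IsUnit (Matrix.of M).det} := by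
        intro i M hM
        obtain ⟨U, rfl⟩ := exists_vec_eq hM
        refine ContDiffAt.contDiffWithinAt ?_
        refine ((matCoord i).contDiff.contDiffAt).comp _ ?_
        exact contDiff_matrix_mul ((contDiffAt_matrix_inv U).of_le (by exact_mod_cast le_top))
          contDiffAt_const
      refine ContDiffOn.congr (f := fun M : MatInf E => ∑ i,
        ((matCoord i (vecM ((Matrix.of M)⁻¹ * Matrix.of V)) : ℝ) : ℂ) *
          D (g * rho M) (matBasis E i)) ?_ ?_
      · refine ContDiffOn.sum fun i _ => ?_
        exact (Complex.ofRealCLM.contDiff.comp_contDiffOn (hc i)).mul (ih _ (hD' _) g)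
      · intro M hM
        obtain ⟨U, rfl⟩ := exists_vec_eq hM
        rw [(hD.hasFDerivAt_right g U).fderiv, ContinuousLinearMap.comp_apply, mulLR_apply, mul_one,
          coe_inv_eq_of_vec, rho_vec]
        exact apply_eq_sum_matCoord _ _
  exact fun f hf g => contDiffOn_infty.2 fun n => key n f hf g

/-- The derivative of `f` along `G(F_∞)`, in left-invariant coordinates. -/
def dD (f : GA E → ℂ) (g : GA E) : MatInf E →L[ℝ] ℂ :=
  fderiv ℝ (fun M : MatInf E => f (g * rho M)) (vec 1)

theorem _root_.GL2Adelic.SmoothAtInf.hasD {f : GA E → ℂ} (h : SmoothAtInf f) : HasD f (dD f) :=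
  fun g => (((h g).contDiffAt (isOpen_isUnit_det.mem_nhds (isUnit_det_vec 1))).differentiableAt
    (by simp)).hasFDerivAt

theorem contDiffOn_adInv (g : GA E) (X : MatInf E) :
    ContDiffOn ℝ ∞ (fun M : MatInf E => adInv (g * rho M) X) {M | IsUnit (Matrix.of M).det} := by
  refine ContDiffOn.congr (f := fun M : MatInf E =>
    vecM ((Matrix.of M)⁻¹ * Matrix.of (vecM (Matrix.of (adInv g X) * Matrix.of M)))) ?_ ?_
  · intro M hM
    obtain ⟨U, rfl⟩ := exists_vec_eq hM
    exact (contDiff_matrix_mul (contDiffAt_matrix_inv U)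
      (contDiff_matrix_mul contDiffAt_const contDiffAt_id)).contDiffWithinAt
  · intro M hM
    obtain ⟨U, rfl⟩ := exists_vec_eq hM
    rw [rho_vec, ← coe_inv_eq_of_vec, adInv, adInv, mulLR_apply, mulLR_apply, map_mul, toMix_ofMix,
      mul_inv_rev, Units.val_mul, Units.val_mul]
    congr 1
    change _ = _ * (_ * _ * _ * (U : Matrix (Fin 2) (Fin 2) (mixedSpace E)))
    simp only [mul_assoc]

/-- At `g M`, the left-invariant derivative along `Y` is the ordinary derivative of the smooth
function `M ↦ f(g M)` in the direction `M Y`, which depends smoothly on `M`. -/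
theorem SmoothAtInf.dD_apply {f : GA E → ℂ} (h : SmoothAtInf f) (Y : MatInf E) :
    SmoothAtInf fun g => dD f g Y := by
  intro g
  refine ContDiffOn.congr (f := fun M : MatInf E =>
    fderiv ℝ (fun M : MatInf E => f (g * rho M)) M (vecM (Matrix.of M * Matrix.of Y))) ?_ ?_
  · refine ContDiffOn.clm_apply ((h g).fderiv_of_isOpen isOpen_isUnit_det (m := ∞) (by simp)) ?_
    exact fun M _ => (contDiff_matrix_mul contDiffAt_id contDiffAt_const).contDiffWithinAt
  · intro M hM
    obtain ⟨U, rfl⟩ := exists_vec_eq hM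
    rw [(h.hasD.hasFDerivAt_right g U).fderiv, ContinuousLinearMap.comp_apply, mulLR_apply, mul_one]
    change dD f (g * rho (vec U)) Y = _
    rw [rho_vec]
    congr 1
    change Y = vecM (((U⁻¹ : GL (Fin 2) (mixedSpace E)) : Matrix (Fin 2) (Fin 2) (mixedSpace E)) *
      ((U : Matrix (Fin 2) (Fin 2) (mixedSpace E)) * Matrix.of Y))
    rw [← mul_assoc, Units.inv_mul, one_mul]
    rfl

attribute [local instance] Matrix.linftyOpNormedRing Matrix.linftyOpNormedAlgebra in
theorem isOpenMap_coe_GL : IsOpenMap fun U : GL (Fin 2) (mixedSpace E) =>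
    (U : Matrix (Fin 2) (Fin 2) (mixedSpace E)) :=
  Units.isOpenMap_val (R := Matrix (Fin 2) (Fin 2) (mixedSpace E))

theorem isOpenMap_vec : IsOpenMap (vec (E := E)) := isOpenMap_coe_GL

theorem adInv_mul (x y : GA E) (X : MatInf E) : adInv (x * y) X = adInv y (adInv x X) := by
  rw [adInv, adInv, adInv, mulLR_apply, mulLR_apply, mulLR_apply, map_mul, mul_inv_rev,
    Units.val_mul, Units.val_mul]
  congr 1
  change _ = _ * (_ * Matrix.of X * _) * _
  simp only [mul_assoc]

theorem adInv_scalarInf {r : InfinitePlace E → ℝ} (hr : ∀ w, 0 < r w) (X : MatInf E) :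
    adInv (scalarInf r) X = X := by
  rw [adInv, scalarInf_eq r hr, toMix_ofMix, mulLR_apply, mul_assoc]
  have h : Matrix.of X * (diagGL (realUnit r hr) (realUnit r hr) :
      Matrix (Fin 2) (Fin 2) (mixedSpace E))
      = (diagGL (realUnit r hr) (realUnit r hr) : Matrix (Fin 2) (Fin 2) (mixedSpace E)) *
        Matrix.of X := by
    rw [coe_diagGL, Matrix.eta_fin_two (Matrix.of X)]
    simp [Matrix.mul_fin_two, mul_comm]
  rw [h, ← mul_assoc, Units.inv_mul, one_mul]
  rfl

/-- Smooth functions on `GL₂(𝔸_E)` that are invariant under `ℝ_{>0}` and under right translation by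
`K^∞`, with compact support modulo `ℝ_{>0}`. -/
structure IsTest (f : GA E → ℂ) : Prop where
  scalar : IsScalarInvariant f
  smooth : SmoothAtInf f
  right_inv : ∀ k ∈ KFin E, ∀ g, f (g * ofFin k) = f g
  support : ∃ C : Set (GAOne E), IsCompact C ∧ ∀ g, f g ≠ 0 → projOne g ∈ C

theorem SmoothAtInf.add {f₁ f₂ : GA E → ℂ} (h₁ : SmoothAtInf f₁) (h₂ : SmoothAtInf f₂) :
    SmoothAtInf fun g => f₁ g + f₂ g := fun g => (h₁ g).add (h₂ g)

theorem IsTest.zero : IsTest fun _ : GA E => (0 : ℂ) where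
  scalar _ _ _ := rfl
  smooth _ := contDiffOn_const
  right_inv _ _ _ := rfl
  support := ⟨∅, isCompact_empty, fun _ h => (h rfl).elim⟩

theorem IsTest.add {f₁ f₂ : GA E → ℂ} (h₁ : IsTest f₁) (h₂ : IsTest f₂) :
    IsTest fun g => f₁ g + f₂ g where
  scalar t ht g := by simp only [h₁.scalar t ht, h₂.scalar t ht]
  smooth := h₁.smooth.add h₂.smooth
  right_inv k hk g := by rw [h₁.right_inv k hk, h₂.right_inv k hk]
  support := by
    obtain ⟨C₁, hC₁, h₁'⟩ := h₁.support
    obtain ⟨C₂, hC₂, h₂'⟩ := h₂.support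
    refine ⟨C₁ ∪ C₂, hC₁.union hC₂, fun g hg => ?_⟩
    by_contra h
    rw [Set.mem_union, not_or] at h
    exact hg (by rw [not_not.1 (mt (h₁' g) h.1), not_not.1 (mt (h₂' g) h.2), add_zero])

theorem IsTest.sum {ι : Type*} (s : Finset ι) {f : ι → GA E → ℂ} (h : ∀ i ∈ s, IsTest (f i)) :
    IsTest fun g => ∑ i ∈ s, f i g := by
  induction s using Finset.induction_on with
  | empty => simpa using IsTest.zero
  | insert a s ha ih =>
    simp only [Finset.sum_insert ha]
    exact (h a (Finset.mem_insert_self a s)).add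
      (ih fun i hi => h i (Finset.mem_insert_of_mem hi))

theorem IsTest.neg {f : GA E → ℂ} (h : IsTest f) : IsTest fun g => -f g where
  scalar t ht g := by simp only [h.scalar t ht]
  smooth g := (h.smooth g).neg
  right_inv k hk g := by rw [h.right_inv k hk]
  support := by
    obtain ⟨C, hC, h'⟩ := h.support
    exact ⟨C, hC, fun g hg => h' g (neg_ne_zero.1 hg)⟩

theorem rho_mul_ofFin (M : MatInf E) (k : GL (Fin 2) (FiniteAdeleRing (𝓞 E) E)) :
    rho M * ofFin k = ofFin k * rho M := ofInf_commute_ofFin _ _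

theorem IsTest.dD_apply {f : GA E → ℂ} (h : IsTest f) (Y : MatInf E) :
    IsTest fun g => dD f g Y where
  scalar t ht g := by
    simp only [dD, mul_assoc, h.scalar t ht]
  smooth := h.smooth.dD_apply Y
  right_inv k hk g := by
    simp only [dD, mul_assoc, ← rho_mul_ofFin]
    simp only [← mul_assoc, h.right_inv k hk]
  support := by
    obtain ⟨C, hC, h'⟩ := h.support
    refine ⟨C, hC, fun g hg => ?_⟩
    by_contra hgC
    refine hg ?_
    -- If the projection of `g` avoids the compact, hence closed, set `C`, so do the projections of
    -- nearby points, and `f` vanishes around `g` along `G(F_∞)`.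
    have hev : (fun M : MatInf E => f (g * rho M)) =ᶠ[nhds (vec 1)] fun _ => 0 := by
      have hU : ∀ᶠ U : GL (Fin 2) (mixedSpace E) in nhds 1, projOne (g * ofMix U) ∉ C := by
        have hc : Continuous fun U : GL (Fin 2) (mixedSpace E) => projOne (g * ofMix U) :=
          continuous_projOne.comp (continuous_const.mul continuous_ofMix)
        refine hc.continuousAt.eventually (hC.isClosed.isOpen_compl.mem_nhds ?_)
        simpa using hgC
      filter_upwards [isOpenMap_vec.image_mem_nhds hU] with M hM
      obtain ⟨U, hU', rfl⟩ := hM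
      by_contra h0
      rw [rho_vec] at h0
      exact hU' (h' _ h0)
    rw [dD, hev.fderiv_eq]
    simp

theorem IsTest.matCoord_mul {f : GA E → ℂ} (h : IsTest f) (ℓ : MatInf E →L[ℝ] ℝ) (X : MatInf E) :
    IsTest fun g => (ℓ (adInv g X) : ℂ) * f g where
  scalar t ht g := by
    simp only [h.scalar t ht, adInv_mul, adInv_scalarInf fun _ => ht]
  smooth g := ContDiffOn.mul (Complex.ofRealCLM.contDiff.comp_contDiffOn
    (ℓ.contDiff.comp_contDiffOn (contDiffOn_adInv g X))) (h.smooth g)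
  right_inv k hk g := by
    rw [h.right_inv k hk, adInv, map_mul, toMix_ofFin, mul_one]; rfl
  support := by
    obtain ⟨C, hC, h'⟩ := h.support
    exact ⟨C, hC, fun g hg => h' g (right_ne_zero_of_mul hg)⟩

/-- The left derivative along `X` is minus the left-invariant derivative along `g⁻¹ X g`. The
coordinates of this vector are smooth in `g` and invariant under scalars and `K^∞`, so multiplying
by them keeps the class of test functions. -/
theorem IsTest.leftDeriv {f : GA E → ℂ} (h : IsTest f) (X : LieInf E) :
    IsTest (GL2Adelic.leftDeriv X f) := by
  have : GL2Adelic.leftDeriv X f = fun g => -∑ i, (matCoord i (adInv g (vecM X)) : ℂ) *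
      dD f g (matBasis E i) := by
    funext g
    rw [h.smooth.hasD.leftDeriv_eq, apply_eq_sum_matCoord]
  rw [this]
  exact (IsTest.sum _ fun i _ => (h.dD_apply _).matCoord_mul _ _).neg

/-- Near `g₀` the finite part stays in `g₀ K^∞`, where right `K^∞`-invariance makes `f` depend on
the archimedean variable alone, and there `f` is differentiable. -/
theorem IsTest.continuous {f : GA E → ℂ} (h : IsTest f) : Continuous f := by
  refine continuous_iff_continuousAt.2 fun g₀ => ?_
  have h1 : ContinuousAt (fun M : MatInf E => f (g₀ * rho M)) (vec 1) :=
    (h.smooth.hasD g₀).continuousAt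
  have h2 : ContinuousAt (fun g : GA E => f (g₀ * rho (vec (toMix (g₀⁻¹ * g))))) g₀ := by
    have h3 : Continuous fun g : GA E => vec (toMix (g₀⁻¹ * g)) :=
      continuous_vec.comp (continuous_toMix.comp (continuous_const.mul continuous_id))
    refine ContinuousAt.comp (g := fun M : MatInf E => f (g₀ * rho M))
      (f := fun g : GA E => vec (toMix (g₀⁻¹ * g))) ?_ h3.continuousAt
    simpa using h1
  refine h2.congr ?_
  have h4 : ∀ᶠ g in nhds g₀, toFin (g₀⁻¹ * g) ∈ KFin E := by
    have h3 : Continuous fun g : GA E => toFin (g₀⁻¹ * g) :=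
      continuous_toFin.comp (continuous_const.mul continuous_id)
    refine h3.continuousAt.eventually (isOpen_KFin.mem_nhds ?_)
    simpa using one_mem_KFin
  filter_upwards [h4] with g hg
  rw [rho_vec, ← h.right_inv _ hg, mul_assoc, ofMix_toMix_mul_ofFin, mul_inv_cancel_left]

theorem IsTest.hasCompactSupport {f : GA E → ℂ} (h : IsTest f) :
    HasCompactSupport fun g : GAOne E => f g := by
  obtain ⟨C, hC, h'⟩ := h.support
  refine HasCompactSupport.intro hC fun g hg => ?_
  by_contra h0
  exact hg (projOne_coe g ▸ h' g h0)

theorem IsTest.exists_bound {f : GA E → ℂ} (h : IsTest f) : ∃ B : ℝ, ∀ g, ‖f g‖ ≤ B := by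
  obtain ⟨B, hB⟩ := (h.continuous.comp continuous_subtype_val).bounded_above_of_compact_support
    h.hasCompactSupport
  exact ⟨B, fun g => by rw [← apply_projOne h.scalar]; exact hB _⟩

theorem IsTest.integrable {f : GA E → ℂ} (h : IsTest f) (μ : Measure (GAOne E))
    [IsFiniteMeasureOnCompacts μ] : Integrable (fun g : GAOne E => f g) μ :=
  (h.continuous.comp continuous_subtype_val).integrable_of_hasCompactSupport h.hasCompactSupport

end TestFunctions

/-! ### Weighted averages of right translates -/

section Averages

open scoped Classical

/-- In the sup norm on entries a product of two `2 × 2` matrices costs a factor `2`; there are two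
products, hence `4`. -/
theorem norm_mulLR_apply_le (A B : Matrix (Fin 2) (Fin 2) (mixedSpace E)) (V : MatInf E) :
    ‖mulLR A B V‖ ≤ 4 * ‖vecM A‖ * ‖vecM B‖ * ‖V‖ := by
  have hent : ∀ (M : MatInf E) (i j : Fin 2), ‖M i j‖ ≤ ‖M‖ := fun M i j =>
    (norm_le_pi_norm (M i) j).trans (norm_le_pi_norm M i)
  have hmul : ∀ A B : Matrix (Fin 2) (Fin 2) (mixedSpace E),
      ‖vecM (A * B)‖ ≤ 2 * ‖vecM A‖ * ‖vecM B‖ := by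
    intro A B
    refine (pi_norm_le_iff_of_nonneg (by positivity)).2 fun i =>
      (pi_norm_le_iff_of_nonneg (by positivity)).2 fun j => ?_
    change ‖(A * B) i j‖ ≤ _
    rw [Matrix.mul_apply, Fin.sum_univ_two]
    have h : ∀ k, ‖A i k * B k j‖ ≤ ‖vecM A‖ * ‖vecM B‖ := fun k =>
      (norm_mul_le _ _).trans (mul_le_mul (hent (vecM A) i k) (hent (vecM B) k j)
        (norm_nonneg _) (norm_nonneg _))
    calc _ ≤ ‖A i 0 * B 0 j‖ + ‖A i 1 * B 1 j‖ := norm_add_le _ _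
      _ ≤ _ := by linarith [h 0, h 1]
  rw [mulLR_apply]
  refine (hmul _ _).trans ?_
  have h2 : ‖vecM (A * Matrix.of V)‖ ≤ 2 * ‖vecM A‖ * ‖V‖ := hmul A (Matrix.of V)
  nlinarith [mul_le_mul_of_nonneg_right h2 (norm_nonneg (vecM B))]

theorem norm_mulLR_le (A B : Matrix (Fin 2) (Fin 2) (mixedSpace E)) :
    ‖mulLR A B‖ ≤ 4 * ‖vecM A‖ * ‖vecM B‖ :=
  ContinuousLinearMap.opNorm_le_bound _ (by positivity) (norm_mulLR_apply_le A B)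

theorem continuous_adInv_apply (Y : MatInf E) : Continuous fun g : GA E => adInv g Y := by
  have h1 : Continuous fun g : GA E =>
      ((toMix g : GL (Fin 2) (mixedSpace E)) : Matrix (Fin 2) (Fin 2) (mixedSpace E)) :=
    Units.continuous_val.comp continuous_toMix
  have h2 : Continuous fun g : GA E =>
      (((toMix g)⁻¹ : GL (Fin 2) (mixedSpace E)) : Matrix (Fin 2) (Fin 2) (mixedSpace E)) :=
    Units.continuous_val.comp (continuous_inv.comp continuous_toMix)
  have h3 : Continuous fun g : GA E =>
      (((toMix g)⁻¹ : GL (Fin 2) (mixedSpace E)) : Matrix (Fin 2) (Fin 2) (mixedSpace E)) *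
        Matrix.of Y * (toMix g : GL (Fin 2) (mixedSpace E)) :=
    (h2.matrix_mul continuous_const).matrix_mul h1
  exact h3

/-- In a basis of the Lie algebra, the finitely many coefficients of `dD f` are themselves test
functions and so are bounded. -/
theorem IsTest.exists_bound_dD {f : GA E → ℂ} (h : IsTest f) : ∃ B : ℝ, 0 ≤ B ∧ ∀ g, ‖dD f g‖ ≤ B := by
  choose b hb using fun i => (h.dD_apply (matBasis E i)).exists_bound
  have hb0 : ∀ i, 0 ≤ b i := fun i => (norm_nonneg _).trans (hb i 1)
  have h0 : 0 ≤ ∑ i, ‖matCoord (E := E) i‖ * b i :=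
    Finset.sum_nonneg fun i _ => mul_nonneg (norm_nonneg _) (hb0 i)
  refine ⟨∑ i, ‖matCoord (E := E) i‖ * b i, h0, fun g => ?_⟩
  refine ContinuousLinearMap.opNorm_le_bound _ h0 fun V => ?_
  rw [apply_eq_sum_matCoord, Finset.sum_mul]
  refine (norm_sum_le _ _).trans (Finset.sum_le_sum fun i _ => ?_)
  rw [norm_mul, Complex.norm_real]
  calc _ ≤ ‖matCoord (E := E) i‖ * ‖V‖ * b i :=
        mul_le_mul ((matCoord i).le_opNorm V) (hb i g) (norm_nonneg _) (by positivity)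
    _ = _ := by ring

/-- In a finite basis, `L` is a sum of fixed functionals with measurable scalar coefficients. -/
theorem stronglyMeasurable_of_apply {Ω : Type*} [MeasurableSpace Ω] {L : Ω → MatInf E →L[ℝ] ℂ}
    (h : ∀ Y, Measurable fun q => L q Y) : StronglyMeasurable L := by
  have : L = fun q => ∑ i, ContinuousLinearMap.smulRightL ℝ (MatInf E) ℂ (matCoord i)
      (L q (matBasis E i)) := by
    funext q
    refine ContinuousLinearMap.ext fun V => ?_
    rw [apply_eq_sum_matCoord, ContinuousLinearMap.sum_apply]
    refine Finset.sum_congr rfl fun i _ => ?_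
    exact (Complex.real_smul ..).symm
  rw [this]
  exact Finset.stronglyMeasurable_fun_sum _ fun i _ =>
    (ContinuousLinearMap.continuous _).comp_stronglyMeasurable (h _).stronglyMeasurable

variable {Ω : Type*} [MeasurableSpace Ω]

/-- A measurable map `u : Ω → GL₂(𝔸_E)` whose adjoint action is controlled by `X ≥ 1`. -/
structure IsControlled (u : Ω → GA E) (X : Ω → ℝ) : Prop where
  measurable : Measurable u
  one_le : ∀ q, 1 ≤ X q
  measurable_bound : Measurable X
  bound : ∃ C : ℝ, 0 ≤ C ∧ ∀ q V, ‖adInv (u q) V‖ ≤ C * X q * ‖V‖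

/-- Weights decaying faster than all powers of `X`. -/
structure IsWeight (P : Measure Ω) (X : Ω → ℝ) (A : Ω → ℂ) : Prop where
  measurable : Measurable A
  integrable : ∀ N : ℕ, Integrable (fun q => ‖A q‖ * X q ^ N) P

/-- A weighted average of right translates of a function. -/
def average (P : Measure Ω) (u : Ω → GA E) (A : Ω → ℂ) (f : GA E → ℂ) (g : GA E) : ℂ :=
  ∫ q, A q * f (g * u q) ∂P

variable {P : Measure Ω} {u : Ω → GA E} {X : Ω → ℝ} {A : Ω → ℂ} {f : GA E → ℂ}

theorem IsWeight.integrable_norm (hA : IsWeight P X A) : Integrable (fun q => ‖A q‖) P := by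
  simpa using hA.integrable 0

theorem IsControlled.measurable_mul (hu : IsControlled u X) (hf : IsTest f) (g x : GA E) :
    Measurable fun q => f (g * u q * x) :=
  (hf.continuous.comp ((continuous_const.mul continuous_id).mul continuous_const)).measurable.comp
    hu.measurable

theorem integrable_average (hu : IsControlled u X) (hA : IsWeight P X A) (hf : IsTest f)
    (g : GA E) : Integrable (fun q => A q * f (g * u q)) P := by
  obtain ⟨B, hB⟩ := hf.exists_bound
  refine Integrable.mono' (hA.integrable_norm.mul_const B) ?_ (Filter.Eventually.of_forall fun q => ?_)
  · have := hu.measurable_mul hf g 1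
    simp only [mul_one] at this
    exact (hA.measurable.mul this).aestronglyMeasurable
  · rw [norm_mul]
    exact mul_le_mul_of_nonneg_left (hB _) (norm_nonneg _)

/-- A coordinate of the adjoint action costs one factor of `X`, so the `N`-th moment of the new
weight is controlled by the moment of order `N + 1`. Repeated differentiation is the reason for
asking for all moments. -/
theorem IsWeight.mul_matCoord (hu : IsControlled u X) (hA : IsWeight P X A)
    (i : Fin (Module.finrank ℝ (MatInf E))) (Y : MatInf E) :
    IsWeight P X fun q => A q * (matCoord i (adInv (u q) Y) : ℂ) where
  measurable := hA.measurable.mul (Complex.measurable_ofReal.comp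
    (((matCoord i).continuous.comp (continuous_adInv_apply Y)).measurable.comp hu.measurable))
  integrable N := by
    obtain ⟨C, hC, hb⟩ := hu.bound
    refine Integrable.mono' ((hA.integrable (N + 1)).mul_const (‖matCoord (E := E) i‖ * C * ‖Y‖)) ?_
      (Filter.Eventually.of_forall fun q => ?_)
    · refine Measurable.aestronglyMeasurable ((Measurable.norm ?_).mul
        (hu.measurable_bound.pow_const N))
      exact hA.measurable.mul (Complex.measurable_ofReal.comp
        (((matCoord i).continuous.comp (continuous_adInv_apply Y)).measurable.comp hu.measurable))
    · have hX : 0 ≤ X q := zero_le_one.trans (hu.one_le q)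
      rw [Real.norm_of_nonneg (by positivity), norm_mul, Complex.norm_real]
      have h1 : ‖matCoord i (adInv (u q) Y)‖ ≤ ‖matCoord (E := E) i‖ * (C * X q * ‖Y‖) :=
        ((matCoord i).le_opNorm _).trans (mul_le_mul_of_nonneg_left (hb q Y) (norm_nonneg _))
      calc _ ≤ ‖A q‖ * (‖matCoord (E := E) i‖ * (C * X q * ‖Y‖)) * X q ^ N := by gcongr
        _ = _ := by ring

/-- Differentiation under the integral sign. The dominating function is a multiple of the first
moment of the weight: `dD f` is bounded, the adjoint action of `u` is at most `C X`, and matrix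
inverses near the identity are bounded by `c`. -/
theorem hasD_average (hu : IsControlled u X) (hA : IsWeight P X A) (hf : IsTest f) :
    HasD (average P u A f) (fun g => ∫ q, A q • (dD f (g * u q)).comp (adInv (u q)) ∂P) := by
  intro g
  obtain ⟨B, hB0, hB⟩ := hf.exists_bound_dD
  obtain ⟨C, hC0, hC⟩ := hu.bound
  have hadj : ∀ q, ‖adInv (u q)‖ ≤ C * X q := fun q =>
    ContinuousLinearMap.opNorm_le_bound _
      (mul_nonneg hC0 (zero_le_one.trans (hu.one_le q))) (hC q)
  have hcont : ContinuousAt (fun M : MatInf E => vecM (Matrix.of M)⁻¹) (vec 1) :=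
    (contDiffAt_matrix_inv 1).continuousAt
  obtain ⟨c, hc⟩ : ∃ c : ℝ, ‖vecM (Matrix.of (vec (E := E) 1))⁻¹‖ < c := exists_gt _
  have hs : {M : MatInf E | IsUnit (Matrix.of M).det ∧ ‖vecM (Matrix.of M)⁻¹‖ < c} ∈
      nhds (vec 1) :=
    (eventually_isUnit_det 1).and (hcont.norm.eventually_lt_const hc)
  let F' : MatInf E → Ω → MatInf E →L[ℝ] ℂ := fun M q =>
    A q • (dD f (g * rho M * u q)).comp ((adInv (u q)).comp (mulLR (Matrix.of M)⁻¹ 1))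
  have hF' : ∀ q, F' (vec 1) q = A q • (dD f (g * u q)).comp (adInv (u q)) := by
    intro q
    have h1 : mulLR (Matrix.of (vec (E := E) 1))⁻¹ 1 = ContinuousLinearMap.id ℝ _ := by
      refine ContinuousLinearMap.ext fun V => ?_
      rw [mulLR_apply, ← coe_inv_eq_of_vec, inv_one, Units.val_one, one_mul, mul_one]
      rfl
    simp only [F', h1, ContinuousLinearMap.comp_id, rho_vec, ofMix_one, mul_one]
  have := hasFDerivAt_integral_of_dominated_of_fderiv_le (μ := P) (𝕜 := ℝ)
    (F := fun (M : MatInf E) q => A q * f (g * rho M * u q)) (F' := F') (x₀ := vec 1)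
    (bound := fun q => ‖A q‖ * X q ^ 1 * (B * (C * (4 * c * ‖vecM (E := E) 1‖)))) hs ?_ ?_ ?_ ?_ ?_ ?_
  · simp only [hF'] at this
    exact this
  · refine Filter.Eventually.of_forall fun M => ?_
    exact (hA.measurable.mul ((hf.continuous.comp (continuous_const.mul continuous_id)).measurable.comp
      hu.measurable)).aestronglyMeasurable
  · exact integrable_average hu hA hf _
  · refine (stronglyMeasurable_of_apply fun Y => ?_).aestronglyMeasurable
    have : ∀ q, F' (vec 1) q Y = A q * ∑ i, (matCoord i (adInv (u q) Y) : ℂ) *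
        dD f (g * u q) (matBasis E i) := fun q => by
      rw [hF', ← apply_eq_sum_matCoord]; rfl
    simp only [this]
    refine hA.measurable.mul (Finset.measurable_fun_sum _ fun i _ => Measurable.mul ?_ ?_)
    · exact Complex.measurable_ofReal.comp
        (((matCoord i).continuous.comp (continuous_adInv_apply Y)).measurable.comp hu.measurable)
    · exact ((hf.dD_apply (matBasis E i)).continuous.comp
        (continuous_const.mul continuous_id)).measurable.comp hu.measurable
  · refine Filter.Eventually.of_forall fun q M hM => ?_
    have hX : 0 ≤ X q := zero_le_one.trans (hu.one_le q)
    have h1 : ‖mulLR (Matrix.of M)⁻¹ 1‖ ≤ 4 * c * ‖vecM (E := E) 1‖ := by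
      refine (norm_mulLR_le _ _).trans ?_
      have := hM.2.le
      gcongr
    have hc0 : 0 ≤ c := (norm_nonneg _).trans hc.le
    rw [_root_.norm_smul]
    calc _ ≤ ‖A q‖ * (B * (C * X q * (4 * c * ‖vecM (E := E) 1‖))) := by
          refine mul_le_mul_of_nonneg_left ?_ (norm_nonneg _)
          refine (ContinuousLinearMap.opNorm_comp_le _ _).trans
            (mul_le_mul (hB _) ?_ (norm_nonneg _) hB0)
          exact (ContinuousLinearMap.opNorm_comp_le _ _).trans
            (mul_le_mul (hadj q) h1 (norm_nonneg _) (by positivity))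
      _ = _ := by ring
  · exact (hA.integrable 1).mul_const _
  · refine Filter.Eventually.of_forall fun q M hM => ?_
    obtain ⟨U, rfl⟩ := exists_vec_eq hM.1
    have h1 := (hf.smooth.hasD.hasFDerivAt g (u q) U).const_mul (A q)
    refine h1.congr_fderiv ?_
    simp only [F', rho_vec]
    congr 2
    refine ContinuousLinearMap.ext fun V => ?_
    rw [ContinuousLinearMap.comp_apply, adInv, mulLR_apply, mulLR_apply, mulLR_apply, mul_one,
      ← coe_inv_eq_of_vec, Units.val_mul]
    congr 1
    change _ = _ * (_ * Matrix.of V) * _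
    simp only [mul_assoc]

theorem integrable_smul_dD (hu : IsControlled u X) (hA : IsWeight P X A) (hf : IsTest f)
    (g : GA E) : Integrable (fun q => A q • (dD f (g * u q)).comp (adInv (u q))) P := by
  obtain ⟨B, hB0, hB⟩ := hf.exists_bound_dD
  obtain ⟨C, hC0, hC⟩ := hu.bound
  have hadj : ∀ q, ‖adInv (u q)‖ ≤ C * X q := fun q =>
    ContinuousLinearMap.opNorm_le_bound _
      (mul_nonneg hC0 (zero_le_one.trans (hu.one_le q))) (hC q)
  refine Integrable.mono' ((hA.integrable 1).mul_const (B * C)) ?_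
    (Filter.Eventually.of_forall fun q => ?_)
  · refine (stronglyMeasurable_of_apply fun Y => ?_).aestronglyMeasurable
    have : ∀ q, (A q • (dD f (g * u q)).comp (adInv (u q))) Y =
        A q * ∑ i, (matCoord i (adInv (u q) Y) : ℂ) *
        dD f (g * u q) (matBasis E i) := fun q => by
      rw [← apply_eq_sum_matCoord]; rfl
    simp only [this]
    refine hA.measurable.mul (Finset.measurable_fun_sum _ fun i _ => Measurable.mul ?_ ?_)
    · exact Complex.measurable_ofReal.comp
        (((matCoord i).continuous.comp (continuous_adInv_apply Y)).measurable.comp hu.measurable)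
    · exact ((hf.dD_apply (matBasis E i)).continuous.comp
        (continuous_const.mul continuous_id)).measurable.comp hu.measurable
  · rw [_root_.norm_smul]
    have hX : 0 ≤ X q := zero_le_one.trans (hu.one_le q)
    calc _ ≤ ‖A q‖ * (B * (C * X q)) := by
          refine mul_le_mul_of_nonneg_left ?_ (norm_nonneg _)
          exact (ContinuousLinearMap.opNorm_comp_le _ _).trans
            (mul_le_mul (hB _) (hadj q) (norm_nonneg _) hB0)
      _ = _ := by ring

theorem integral_smul_dD_apply (hu : IsControlled u X) (hA : IsWeight P X A) (hf : IsTest f)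
    (g : GA E) (Y : MatInf E) :
    (∫ q, A q • (dD f (g * u q)).comp (adInv (u q)) ∂P) Y
      = ∫ q, A q * dD f (g * u q) (adInv (u q) Y) ∂P := by
  rw [ContinuousLinearMap.integral_apply (integrable_smul_dD hu hA hf g)]
  rfl

variable (P u X) in
/-- The span of the weighted averages of test functions. -/
def averages : Submodule ℂ (GA E → ℂ) :=
  Submodule.span ℂ {F | ∃ A f, IsWeight P X A ∧ IsTest f ∧ F = average P u A f}

theorem average_mem (hA : IsWeight P X A) (hf : IsTest f) : average P u A f ∈ averages P u X :=
  Submodule.subset_span ⟨A, f, hA, hf, rfl⟩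

theorem HasD.add {f₁ f₂ : GA E → ℂ} {D₁ D₂ : GA E → MatInf E →L[ℝ] ℂ} (h₁ : HasD f₁ D₁)
    (h₂ : HasD f₂ D₂) : HasD (f₁ + f₂) (D₁ + D₂) := fun g => (h₁ g).add (h₂ g)

theorem HasD.const_smul {f : GA E → ℂ} {D : GA E → MatInf E →L[ℝ] ℂ} (h : HasD f D) (c : ℂ) :
    HasD (c • f) (c • D) := fun g => (h g).const_smul c

theorem HasD.zero : HasD (0 : GA E → ℂ) 0 := fun _ => hasFDerivAt_const _ _

/-- Evaluating `D g` at `Y` gives right derivatives and evaluating it at `adInv g Y` gives left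
ones, up to sign. For an average, the first expands in a basis into averages whose weights are
multiplied by coordinates of `adInv (u q) Y`; the second is the average of a left derivative with
the same weight, since left derivatives commute with right translation. -/
theorem exists_hasD_of_mem_averages (hu : IsControlled u X) {F : GA E → ℂ}
    (hF : F ∈ averages P u X) : ∃ D, HasD F D ∧ (∀ Y, (fun g => D g Y) ∈ averages P u X) ∧
      ∀ Y, (fun g => D g (adInv g Y)) ∈ averages P u X := by
  induction hF using Submodule.span_induction with
  | mem F h =>
    obtain ⟨A, f, hA, hf, rfl⟩ := h
    refine ⟨_, hasD_average hu hA hf, fun Y => ?_, fun Y => ?_⟩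
    · have : (fun g => (∫ q, A q • (dD f (g * u q)).comp (adInv (u q)) ∂P) Y) = ∑ i,
          average P u (fun q => A q * (matCoord i (adInv (u q) Y) : ℂ))
            fun g => dD f g (matBasis E i) := by
        funext g
        rw [integral_smul_dD_apply hu hA hf, Finset.sum_apply]
        unfold average
        rw [← integral_finsetSum]
        · refine integral_congr_ae (Filter.Eventually.of_forall fun q => ?_)
          simp only
          rw [apply_eq_sum_matCoord, Finset.mul_sum]
          simp only [mul_assoc]
        · exact fun i _ => integrable_average hu (hA.mul_matCoord hu i Y) (hf.dD_apply _) g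
      rw [this]
      exact Submodule.sum_mem _ fun i _ => average_mem (hA.mul_matCoord hu i Y) (hf.dD_apply _)
    · have : (fun g => (∫ q, A q • (dD f (g * u q)).comp (adInv (u q)) ∂P) (adInv g Y)) =
          average P u A fun g => -leftDeriv (Matrix.of Y) f g := by
        funext g
        rw [integral_smul_dD_apply hu hA hf]
        unfold average
        refine integral_congr_ae (Filter.Eventually.of_forall fun q => ?_)
        simp only
        rw [hf.smooth.hasD.leftDeriv_eq, neg_neg, adInv_mul]
        rfl
      rw [this]
      exact average_mem hA (hf.leftDeriv _).neg
  | zero => exact ⟨0, HasD.zero, fun _ => Submodule.zero_mem _, fun _ => Submodule.zero_mem _⟩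
  | add F₁ F₂ _ _ h₁ h₂ =>
    obtain ⟨D₁, h₁, h₁', h₁''⟩ := h₁
    obtain ⟨D₂, h₂, h₂', h₂''⟩ := h₂
    exact ⟨_, h₁.add h₂, fun Y => Submodule.add_mem _ (h₁' Y) (h₂' Y),
      fun Y => Submodule.add_mem _ (h₁'' Y) (h₂'' Y)⟩
  | smul c F _ h =>
    obtain ⟨D, h, h', h''⟩ := h
    exact ⟨_, h.const_smul c, fun Y => Submodule.smul_mem _ c (h' Y),
      fun Y => Submodule.smul_mem _ c (h'' Y)⟩

theorem smoothAtInf_of_mem_averages (hu : IsControlled u X) {F : GA E → ℂ}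
    (hF : F ∈ averages P u X) : SmoothAtInf F :=
  smoothAtInf_of_forall_hasD (averages P u X)
    (fun _ hF => (exists_hasD_of_mem_averages hu hF).imp fun _ h => ⟨h.1, h.2.1⟩) F hF

theorem rightDeriv_mem_averages (hu : IsControlled u X) {F : GA E → ℂ}
    (hF : F ∈ averages P u X) (Y : LieInf E) : rightDeriv Y F ∈ averages P u X := by
  obtain ⟨D, hD, h, -⟩ := exists_hasD_of_mem_averages hu hF
  have : rightDeriv Y F = -fun g => D g (vecM Y) := funext fun g => hD.rightDeriv_eq Y g
  rw [this]
  exact Submodule.neg_mem _ (h _)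

theorem leftDeriv_mem_averages (hu : IsControlled u X) {F : GA E → ℂ}
    (hF : F ∈ averages P u X) (Y : LieInf E) : leftDeriv Y F ∈ averages P u X := by
  obtain ⟨D, hD, -, h⟩ := exists_hasD_of_mem_averages hu hF
  have : leftDeriv Y F = -fun g => D g (adInv g (vecM Y)) := funext fun g => hD.leftDeriv_eq Y g
  rw [this]
  exact Submodule.neg_mem _ (h _)

theorem envConv_mem_averages (hu : IsControlled u X) {F : GA E → ℂ}
    (hF : F ∈ averages P u X) (U V : EnvelopingWords E) : envConv U F V ∈ averages P u X := by
  have hr : ∀ l : List (LieInf E), l.foldr rightDeriv F ∈ averages P u X := fun l => by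
    induction l with
    | nil => exact hF
    | cons Y l ih => exact rightDeriv_mem_averages hu ih Y
  have hl : ∀ (l : List (LieInf E)) (F : GA E → ℂ), F ∈ averages P u X →
      l.foldr leftDeriv F ∈ averages P u X := fun l F hF => by
    induction l with
    | nil => exact hF
    | cons Y l ih => exact leftDeriv_mem_averages hu ih Y
  have : envConv U F V = ∑ l ∈ U.support, ∑ l' ∈ V.support,
      (U l * V l') • l.foldr leftDeriv (l'.reverse.foldr rightDeriv F) := by
    funext g
    simp only [envConv, Finsupp.sum, Finset.sum_apply, Pi.smul_apply, smul_eq_mul]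
  rw [this]
  exact Submodule.sum_mem _ fun l _ => Submodule.sum_mem _ fun l' _ =>
    Submodule.smul_mem _ _ (hl _ _ (hr _))

theorem scalar_of_mem_averages {F : GA E → ℂ} (hF : F ∈ averages P u X) : IsScalarInvariant F := by
  intro t ht g
  induction hF using Submodule.span_induction with
  | mem F h =>
    obtain ⟨A, f, hA, hf, rfl⟩ := h
    simp only [average, mul_assoc, hf.scalar t ht]
  | zero => rfl
  | add F₁ F₂ _ _ h₁ h₂ => rw [Pi.add_apply, Pi.add_apply, h₁, h₂]
  | smul c F _ h => rw [Pi.smul_apply, Pi.smul_apply, h]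

/-- Scalar invariance lets `u q` be replaced by its projection to `G(𝔸_F)^1`. By right invariance of
`μ` the `L¹` norm of each translate is that of `f`, so the double integral is finite by Fubini. -/
theorem integrable_of_mem_averages [SFinite P] (hu : IsControlled u X) (μ : Measure (GAOne E))
    [μ.IsHaarMeasure] {F : GA E → ℂ} (hF : F ∈ averages P u X) :
    Integrable (fun g : GAOne E => F g) μ := by
  induction hF using Submodule.span_induction with
  | mem F h =>
    obtain ⟨A, f, hA, hf, rfl⟩ := h
    have hsc : SecondCountableTopology (GAOne E) :=
      TopologicalSpace.Subtype.secondCountableTopology _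
    have hsig : SigmaCompactSpace (GAOne E) := inferInstance
    have hsf : SigmaFinite μ := inferInstance
    have hri := isMulRightInvariant_GAOne μ
    have key : ∀ q (g : GAOne E), f (g * u q) = f ((g * projOne (u q) : GAOne E) : GA E) := by
      intro q g
      rw [← apply_projOne hf.scalar, projOne_mul, projOne_coe]
    have hm : Measurable fun p : GAOne E × Ω => A p.2 * f (p.1 * u p.2) := by
      refine (hA.measurable.comp measurable_snd).mul (hf.continuous.measurable.comp ?_)
      exact (measurable_subtype_coe.comp measurable_fst).mul (hu.measurable.comp measurable_snd)
    have hint : Integrable (fun p : GAOne E × Ω => A p.2 * f (p.1 * u p.2)) (μ.prod P) := by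
      rw [integrable_prod_iff' hm.aestronglyMeasurable]
      refine ⟨Filter.Eventually.of_forall fun q => ?_, ?_⟩
      · simp only [key]
        exact ((hf.integrable μ).comp_mul_right (projOne (u q))).const_mul _
      · simp only [key, norm_mul, integral_const_mul]
        have : ∀ q, ∫ g : GAOne E, ‖f ((g * projOne (u q) : GAOne E) : GA E)‖ ∂μ
            = ∫ g : GAOne E, ‖f g‖ ∂μ := fun q =>
          integral_mul_right_eq_self (fun g : GAOne E => ‖f g‖) _
        simp only [this]
        exact hA.integrable_norm.mul_const _
    exact hint.integral_prod_left
  | zero => exact integrable_zero _ _ _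
  | add F₁ F₂ _ _ h₁ h₂ => exact h₁.add h₂
  | smul c F _ h => exact h.smul c

theorem memC_of_mem_averages [SFinite P] (hu : IsControlled u X) (μ : Measure (GAOne E))
    [μ.IsHaarMeasure] {F : GA E → ℂ} (hF : F ∈ averages P u X)
    (hK : ∀ k : GA E, toInf k = 1 → toFin k ∈ KFin E → ∀ g : GA E, F (g * k) = F g) :
    MemC μ F where
  scalar := scalar_of_mem_averages hF
  smooth := smoothAtInf_of_mem_averages hu hF
  right_inv := hK
  integrable U V := integrable_of_mem_averages hu μ (envConv_mem_averages hu hF U V)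

end Averages

/-! ### The additive character -/

theorem valued_algebraMap (v : HeightOneSpectrum (𝓞 E)) (e : E) :
    Valued.v (algebraMap E (FiniteAdeleRing (𝓞 E) E) e v) = v.valuation E e :=
  HeightOneSpectrum.valuedAdicCompletion_eq_valuation' v e

theorem valued_mul (v : HeightOneSpectrum (𝓞 E)) (a b : FiniteAdeleRing (𝓞 E) E) :
    Valued.v ((a * b) v) = Valued.v (a v) * Valued.v (b v) :=
  map_mul (Valued.v : Valuation (v.adicCompletion E) _) (a v) (b v)

/-- The local conditions say that `x` lies in the inverse different, which is the dual of `𝓞 E` for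
the trace form; it is paired with `1`. -/
theorem exists_int_eq_trace {x : E} (h : ∀ v : HeightOneSpectrum (𝓞 E), v.valuation E x ≤
      WithZero.exp (multiplicity v.asIdeal (differentIdeal ℤ (𝓞 E)) : ℤ)) :
    ∃ n : ℤ, Algebra.trace ℚ E x = n := by
  have hdual : x ∈ FractionalIdeal.dual ℤ ℚ (1 : FractionalIdeal (nonZeroDivisors (𝓞 E)) E) := by
    have h0 : differentIdeal ℤ (𝓞 E) ≠ ⊥ := differentIdeal_ne_bot
    have h0' : ((differentIdeal ℤ (𝓞 E) : Ideal (𝓞 E)) :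
        FractionalIdeal (nonZeroDivisors (𝓞 E)) E) ≠ 0 :=
      FractionalIdeal.coeIdeal_ne_zero.2 h0
    have h1 := coeIdeal_differentIdeal ℤ ℚ E (𝓞 E)
    rw [← inv_inv (FractionalIdeal.dual ℤ ℚ _), ← h1, FractionalIdeal.mem_inv_iff h0']
    intro y hy
    obtain ⟨r, hr, rfl⟩ := (FractionalIdeal.mem_coeIdeal _).1 hy
    rw [FractionalIdeal.mem_one_iff]
    refine HeightOneSpectrum.mem_integers_of_valuation_le_one E _ fun v => ?_
    rw [map_mul]
    have h2 : v.valuation E (algebraMap (𝓞 E) E r) ≤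
        WithZero.exp (-(multiplicity v.asIdeal (differentIdeal ℤ (𝓞 E)) : ℤ)) := by
      rw [HeightOneSpectrum.valuation_of_algebraMap, HeightOneSpectrum.intValuation_le_pow_iff_mem]
      exact Ideal.le_of_dvd (pow_multiplicity_dvd _ _) hr
    calc _ ≤ _ := mul_le_mul' (h v) h2
      _ = 1 := by rw [← WithZero.exp_add, add_neg_cancel, WithZero.exp_zero]
  rw [FractionalIdeal.mem_dual
    (one_ne_zero : (1 : FractionalIdeal (nonZeroDivisors (𝓞 E)) E) ≠ 0)] at hdual
  obtain ⟨n, hn⟩ := hdual 1 (FractionalIdeal.mem_one_iff _ |>.2 ⟨1, map_one _⟩)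
  refine ⟨n, ?_⟩
  rw [Algebra.traceForm_apply, mul_one] at hn
  exact hn.symm

/-- The principal parts of `a` and `a'` differ by an element of the inverse different, so their
traces differ by an integer. In particular the value does not depend on the chosen principal part.
-/
theorem psiFin_eq_of_sub_mem {δ : (AdeleRing (𝓞 E) E)ˣ} (hδ : IsDifferentIdele δ)
    {a a' : FiniteAdeleRing (𝓞 E) E} (h : (a - a') * (δ : AdeleRing (𝓞 E) E).2 ∈ intFin E) :
    psiFin a = psiFin a' := by
  unfold psiFin
  rw [dif_pos (exists_principal_part a), dif_pos (exists_principal_part a')]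
  have h1 := (exists_principal_part a).choose_spec
  have h2 := (exists_principal_part a').choose_spec
  generalize (exists_principal_part a).choose = e at h1 ⊢
  generalize (exists_principal_part a').choose = e' at h2 ⊢
  have hint : (δ : AdeleRing (𝓞 E) E).2 ∈ intFin E := fun v => by
    rw [hδ.2 v, ← WithZero.exp_zero, WithZero.exp_le_exp]; simp
  have h3 : algebraMap E (FiniteAdeleRing (𝓞 E) E) (e - e') * (δ : AdeleRing (𝓞 E) E).2 ∈
      intFin E := by
    have : algebraMap E (FiniteAdeleRing (𝓞 E) E) (e - e') * (δ : AdeleRing (𝓞 E) E).2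
        = (a - a') * (δ : AdeleRing (𝓞 E) E).2 +
          ((a' - algebraMap E (FiniteAdeleRing (𝓞 E) E) e') -
            (a - algebraMap E (FiniteAdeleRing (𝓞 E) E) e)) * (δ : AdeleRing (𝓞 E) E).2 := by
      rw [map_sub]; ring
    rw [this]
    exact mem_intFin_add h (mem_intFin_mul (mem_intFin_sub h2 h1) hint)
  obtain ⟨n, hn⟩ := exists_int_eq_trace (x := e - e') fun v => by
    have := h3 v
    rw [valued_mul, hδ.2 v, valued_algebraMap, WithZero.exp_neg] at this
    rwa [mul_inv_le_iff₀ (by simp), one_mul] at this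
  rw [map_sub, sub_eq_iff_eq_add] at hn
  rw [hn, Complex.exp_eq_exp_iff_exists_int]
  exact ⟨n, by push_cast; ring⟩

theorem norm_psiFin (a : FiniteAdeleRing (𝓞 E) E) : ‖psiFin a‖ = 1 := by
  unfold psiFin
  split_ifs
  · rw [show ∀ q : ℚ, 2 * (Real.pi : ℂ) * Complex.I * (q : ℂ)
      = ((2 * Real.pi * q : ℝ) : ℂ) * Complex.I from fun q => by push_cast; ring]
    exact Complex.norm_exp_ofReal_mul_I _
  · exact norm_one

/-! ### Matrices integral at the finite places -/

theorem valued_eq_one_of_units {u : (FiniteAdeleRing (𝓞 E) E)ˣ}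
    (h : (u : FiniteAdeleRing (𝓞 E) E) ∈ intFin E)
    (h' : ((u⁻¹ : (FiniteAdeleRing (𝓞 E) E)ˣ) : FiniteAdeleRing (𝓞 E) E) ∈ intFin E)
    (v : HeightOneSpectrum (𝓞 E)) : Valued.v ((u : FiniteAdeleRing (𝓞 E) E) v) = 1 := by
  have h1 := valued_mul v (u : FiniteAdeleRing (𝓞 E) E)
    ((u⁻¹ : (FiniteAdeleRing (𝓞 E) E)ˣ) : FiniteAdeleRing (𝓞 E) E)
  rw [Units.mul_inv] at h1
  have h2 : Valued.v ((1 : FiniteAdeleRing (𝓞 E) E) v) = 1 :=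
    map_one (Valued.v : Valuation (v.adicCompletion E) _)
  rw [h2] at h1
  refine le_antisymm (h v) ?_
  rw [h1]
  exact mul_le_of_le_one_right' (h' v)

theorem det_mem_intFin {k : Matrix (Fin 2) (Fin 2) (FiniteAdeleRing (𝓞 E) E)}
    (hk : ∀ i j, k i j ∈ intFin E) : k.det ∈ intFin E := by
  rw [Matrix.det_fin_two]
  exact mem_intFin_sub (mem_intFin_mul (hk _ _) (hk _ _)) (mem_intFin_mul (hk _ _) (hk _ _))

theorem valued_det_of_mem_KFin {k : GL (Fin 2) (FiniteAdeleRing (𝓞 E) E)} (hk : k ∈ KFin E)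
    (v : HeightOneSpectrum (𝓞 E)) :
    Valued.v (((Matrix.GeneralLinearGroup.det k : (FiniteAdeleRing (𝓞 E) E)ˣ) :
      FiniteAdeleRing (𝓞 E) E) v) = 1 := by
  refine valued_eq_one_of_units ?_ ?_ v
  · exact det_mem_intFin fun i j => (mem_KFin_iff.1 hk i j).1
  · rw [← map_inv]
    exact det_mem_intFin fun i j => (mem_KFin_iff.1 hk i j).2

theorem valued_diag_of_mem_KFin {k : GL (Fin 2) (FiniteAdeleRing (𝓞 E) E)} (hk : k ∈ KFin E)
    (h : k 1 0 = 0) (v : HeightOneSpectrum (𝓞 E)) :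
    Valued.v (k 0 0 v) = 1 ∧ Valued.v (k 1 1 v) = 1 := by
  have h1 := valued_det_of_mem_KFin hk v
  rw [Matrix.GeneralLinearGroup.val_det_apply, Matrix.det_fin_two, h, mul_zero, sub_zero,
    valued_mul] at h1
  have h2 := (mem_KFin_iff.1 hk 0 0).1 v
  have h3 := (mem_KFin_iff.1 hk 1 1).1 v
  constructor
  · exact le_antisymm h2 (h1 ▸ mul_le_of_le_one_right' h3)
  · exact le_antisymm h3 (h1 ▸ mul_le_of_le_one_left' h2)

theorem heckeIndicator_mul_right (m : FiniteAdeleRing (𝓞 E) E)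
    (x : GL (Fin 2) (FiniteAdeleRing (𝓞 E) E)) {k : GL (Fin 2) (FiniteAdeleRing (𝓞 E) E)}
    (hk : k ∈ KFin E) : heckeIndicator m (x * k) = heckeIndicator m x := by
  have hint : ∀ (x k : GL (Fin 2) (FiniteAdeleRing (𝓞 E) E)), k ∈ KFin E →
      (∀ (v : HeightOneSpectrum (𝓞 E)) (i j : Fin 2), Valued.v (x i j v) ≤ 1) →
      ∀ (v : HeightOneSpectrum (𝓞 E)) (i j : Fin 2), Valued.v ((x * k) i j v) ≤ 1 := by
    intro x k hk hx v i j
    have h : (x * k) i j ∈ intFin E := by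
      rw [Units.val_mul, Matrix.mul_apply, Fin.sum_univ_two]
      exact mem_intFin_add (mem_intFin_mul (fun v => hx v i 0) (mem_KFin_iff.1 hk _ _).1)
        (mem_intFin_mul (fun v => hx v i 1) (mem_KFin_iff.1 hk _ _).1)
    exact h v
  have hdet : ∀ v : HeightOneSpectrum (𝓞 E),
      Valued.v (((Matrix.GeneralLinearGroup.det (x * k) : (FiniteAdeleRing (𝓞 E) E)ˣ) :
          FiniteAdeleRing (𝓞 E) E) v) =
      Valued.v (((Matrix.GeneralLinearGroup.det x : (FiniteAdeleRing (𝓞 E) E)ˣ) :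
          FiniteAdeleRing (𝓞 E) E) v) := fun v => by
    rw [map_mul, Units.val_mul, valued_mul, valued_det_of_mem_KFin hk, mul_one]
  classical
  unfold heckeIndicator
  refine if_congr (and_congr ⟨fun h => ?_, hint x k hk⟩ (forall_congr' fun v => by rw [hdet])) rfl rfl
  have := hint _ _ (inv_mem_KFin hk) h
  rwa [mul_inv_cancel_right] at this

theorem heckeIndicator_congr {m m' : FiniteAdeleRing (𝓞 E) E}
    (h : ∀ v : HeightOneSpectrum (𝓞 E), Valued.v (m v) = Valued.v (m' v))
    (x : GL (Fin 2) (FiniteAdeleRing (𝓞 E) E)) : heckeIndicator m x = heckeIndicator m' x := by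
  classical
  unfold heckeIndicator
  exact if_congr (and_congr Iff.rfl (forall_congr' fun v => by rw [h])) rfl rfl

/-- A function on `GL₂(𝔸_E)` that only depends on the finite part modulo `K^∞` is continuous. -/
theorem continuous_of_forall_mul_KFin {X Y : Type*} [TopologicalSpace X] [TopologicalSpace Y]
    {f : X → Y} {p : X → GL (Fin 2) (FiniteAdeleRing (𝓞 E) E)} (hp : Continuous p)
    (h : ∀ x y, (p x)⁻¹ * p y ∈ KFin E → f y = f x) : Continuous f := by
  refine continuous_iff_continuousAt.2 fun x => ?_
  have h4 : ∀ᶠ y in nhds x, (p x)⁻¹ * p y ∈ KFin E := by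
    have h3 : Continuous fun y => (p x)⁻¹ * p y := continuous_const.mul hp
    refine h3.continuousAt.eventually (isOpen_KFin.mem_nhds ?_)
    simpa using one_mem_KFin
  refine continuousAt_const.congr (f := fun _ => f x) ?_
  filter_upwards [h4] with y hy using (h x y hy).symm

/-- A representative of the class of a matrix modulo `K^∞`. -/
def repFin (g : GL (Fin 2) (FiniteAdeleRing (𝓞 E) E)) : GL (Fin 2) (FiniteAdeleRing (𝓞 E) E) :=
  Classical.epsilon fun x => g⁻¹ * x ∈ KFin E

theorem inv_mul_repFin_mem (g : GL (Fin 2) (FiniteAdeleRing (𝓞 E) E)) :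
    g⁻¹ * repFin g ∈ KFin E :=
  Classical.epsilon_spec (p := fun x => g⁻¹ * x ∈ KFin E)
    ⟨g, by rw [inv_mul_cancel]; exact one_mem_KFin⟩

theorem repFin_eq {g g' : GL (Fin 2) (FiniteAdeleRing (𝓞 E) E)} (h : g⁻¹ * g' ∈ KFin E) :
    repFin g' = repFin g := by
  unfold repFin
  congr 1
  funext x
  refine propext ⟨fun hx => ?_, fun hx => ?_⟩
  · have := mul_mem_KFin h hx
    rwa [mul_assoc, mul_inv_cancel_left] at this
  · have := mul_mem_KFin (inv_mem_KFin h) hx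
    rwa [mul_inv_rev, inv_inv, mul_assoc, mul_inv_cancel_left] at this

/-! ### Uniqueness of Iwasawa coordinates -/

/-- The finite part of an adele. -/
def sndHom : AdeleRing (𝓞 E) E →+* FiniteAdeleRing (𝓞 E) E :=
  RingHom.snd (InfiniteAdeleRing E) (FiniteAdeleRing (𝓞 E) E)

/-- The finite part of an idele. -/
def sndUnit : (AdeleRing (𝓞 E) E)ˣ →* (FiniteAdeleRing (𝓞 E) E)ˣ :=
  Units.map (sndHom (E := E)).toMonoidHom

theorem coe_sndUnit (x : (AdeleRing (𝓞 E) E)ˣ) :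
    (sndUnit x : FiniteAdeleRing (𝓞 E) E) = (x : AdeleRing (𝓞 E) E).2 := rfl

theorem toFin_unipGL (t : AdeleRing (𝓞 E) E) : toFin (unipGL t) = unipGL t.2 := by
  refine Units.ext ?_
  ext1 i j
  fin_cases i <;> fin_cases j <;> rfl

theorem toFin_diagGL (a b : (AdeleRing (𝓞 E) E)ˣ) :
    toFin (diagGL a b) = diagGL (sndUnit a) (sndUnit b) := by
  refine Units.ext ?_
  ext1 i j
  fin_cases i <;> fin_cases j <;> rfl

theorem upper_triangular_quotient {R : Type*} [CommRing R] {t t' : R} {a a' z z' : Rˣ}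
    {κ : GL (Fin 2) R} (h : unipGL t' * diagGL a' z' = unipGL t * diagGL a z * κ) :
    κ 1 0 = 0 ∧ (z' : R) = z * κ 1 1 ∧ (a' : R) = a * κ 0 0 ∧ (t' - t) * z' = a * κ 0 1 := by
  have e : (unipGL t' * diagGL a' z' : Matrix (Fin 2) (Fin 2) R)
      = unipGL t * diagGL a z * (κ : Matrix (Fin 2) (Fin 2) R) :=
    congrArg (fun g : GL (Fin 2) R => (g : Matrix (Fin 2) (Fin 2) R)) h
  rw [coe_unipGL, coe_unipGL, coe_diagGL, coe_diagGL,
    Matrix.eta_fin_two (κ : Matrix (Fin 2) (Fin 2) R)] at e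
  simp only [Matrix.mul_fin_two, one_mul, mul_zero, add_zero, zero_mul, zero_add] at e
  have e00 := congrFun (congrFun e 0) 0
  have e01 := congrFun (congrFun e 0) 1
  have e10 := congrFun (congrFun e 1) 0
  have e11 := congrFun (congrFun e 1) 1
  simp only [Matrix.of_apply, Matrix.cons_val', Matrix.cons_val_zero, Matrix.cons_val_one,
    Matrix.cons_val_fin_one] at e00 e01 e10 e11
  have h10 : κ 1 0 = 0 := z.isUnit.mul_right_eq_zero.1 e10.symm
  refine ⟨h10, e11, ?_, ?_⟩
  · rw [e00, h10, mul_zero, add_zero]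
  · rw [sub_mul, e01, e11]; ring

/-- The two triangular factors differ by an element `κ` of `K^∞`. It is upper triangular, so its
diagonal entries are local units, which fixes `z` and `m` up to units, and its upper right entry is
integral, which fixes `t` up to `m / δ` times an integral adele. -/
theorem IwasawaCoord.IsFor.finite_part {δ : (AdeleRing (𝓞 E) E)ˣ} {h h' : GA E}
    {c c' : IwasawaCoord E} (hc : c.IsFor δ h) (hc' : c'.IsFor δ h')
    (hh : (toFin h)⁻¹ * toFin h' ∈ KFin E) (v : HeightOneSpectrum (𝓞 E)) :
    Valued.v ((c'.m : AdeleRing (𝓞 E) E).2 v) = Valued.v ((c.m : AdeleRing (𝓞 E) E).2 v) ∧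
    Valued.v ((c'.z : AdeleRing (𝓞 E) E).2 v) = Valued.v ((c.z : AdeleRing (𝓞 E) E).2 v) ∧
    Valued.v (((c'.t.2 - c.t.2) * (δ : AdeleRing (𝓞 E) E).2) v)
      ≤ Valued.v ((c.m : AdeleRing (𝓞 E) E).2 v) := by
  obtain ⟨k, hk, rfl⟩ := hc
  obtain ⟨k', hk', rfl⟩ := hc'
  rw [map_mul, map_mul, map_mul, map_mul, toFin_unipGL, toFin_unipGL, toFin_diagGL,
    toFin_diagGL] at hh
  have hκ := mul_mem_KFin (mul_mem_KFin hk.2 hh) (inv_mem_KFin hk'.2)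
  obtain ⟨κ, hκe⟩ : ∃ κ, κ = toFin k * ((unipGL c.t.2 * diagGL (sndUnit (c.z * c.m * δ⁻¹))
    (sndUnit c.z) * toFin k)⁻¹ * (unipGL c'.t.2 * diagGL (sndUnit (c'.z * c'.m * δ⁻¹))
    (sndUnit c'.z) * toFin k')) * (toFin k')⁻¹ := ⟨_, rfl⟩
  rw [← hκe] at hκ
  have e : unipGL c'.t.2 * diagGL (sndUnit (c'.z * c'.m * δ⁻¹)) (sndUnit c'.z)
      = unipGL c.t.2 * diagGL (sndUnit (c.z * c.m * δ⁻¹)) (sndUnit c.z) * κ := by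
    rw [hκe]; group
  obtain ⟨h10, hz, ha, ht⟩ := upper_triangular_quotient e
  obtain ⟨h00, h11⟩ := valued_diag_of_mem_KFin hκ h10 v
  have hnz : ∀ x : (AdeleRing (𝓞 E) E)ˣ, Valued.v ((x : AdeleRing (𝓞 E) E).2 v) ≠ 0 := by
    intro x hx
    have := valued_mul v (sndUnit x) ((sndUnit x)⁻¹ : (FiniteAdeleRing (𝓞 E) E)ˣ)
    rw [Units.mul_inv, coe_sndUnit, hx, zero_mul] at this
    exact one_ne_zero ((map_one (Valued.v : Valuation (v.adicCompletion E) _)).symm.trans this)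
  have hzv : Valued.v ((c'.z : AdeleRing (𝓞 E) E).2 v) = Valued.v ((c.z : AdeleRing (𝓞 E) E).2 v) := by
    have := congrArg (fun a : FiniteAdeleRing (𝓞 E) E => Valued.v (a v)) hz
    simpa only [valued_mul, h11, mul_one, coe_sndUnit] using this
  have hmul : ∀ c : IwasawaCoord E, Valued.v ((sndUnit (c.z * c.m * δ⁻¹) :
      FiniteAdeleRing (𝓞 E) E) v) = Valued.v ((c.z : AdeleRing (𝓞 E) E).2 v) *
        Valued.v ((c.m : AdeleRing (𝓞 E) E).2 v) *
        Valued.v (((δ⁻¹ : (AdeleRing (𝓞 E) E)ˣ) : AdeleRing (𝓞 E) E).2 v) := fun c => by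
    rw [map_mul, map_mul, Units.val_mul, Units.val_mul, valued_mul, valued_mul]; rfl
  refine ⟨?_, hzv, ?_⟩
  · have := congrArg (fun a : FiniteAdeleRing (𝓞 E) E => Valued.v (a v)) ha
    simp only [valued_mul, h00, mul_one, hmul, hzv] at this
    exact mul_left_cancel₀ (hnz c.z) (mul_right_cancel₀ (hnz δ⁻¹) this)
  · have h1 : (c'.t.2 - c.t.2) * (δ : AdeleRing (𝓞 E) E).2 * sndUnit c'.z
        = sndUnit c.z * sndUnit c.m * κ 0 1 := by
      have h2 : (sndUnit (c.z * c.m * δ⁻¹) : FiniteAdeleRing (𝓞 E) E) * (δ : AdeleRing (𝓞 E) E).2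
          = sndUnit c.z * sndUnit c.m := by
        rw [← coe_sndUnit, ← Units.val_mul, ← map_mul, inv_mul_cancel_right, map_mul, Units.val_mul]
      rw [← h2, mul_right_comm, ht]; ring
    have := congrArg (fun a : FiniteAdeleRing (𝓞 E) E => Valued.v (a v)) h1
    simp only [valued_mul, coe_sndUnit, hzv] at this
    rw [mul_comm, mul_assoc] at this
    rw [valued_mul, mul_left_cancel₀ (hnz c.z) this]
    exact mul_le_of_le_one_right' ((mem_KFin_iff.1 hκ 0 1).1 v)

/-! ### Explicit Iwasawa coordinates -/

/-- The infinite part of an adele. -/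
def fstHom : AdeleRing (𝓞 E) E →+* InfiniteAdeleRing E :=
  RingHom.fst (InfiniteAdeleRing E) (FiniteAdeleRing (𝓞 E) E)

/-- The infinite part of an idele. -/
def fstUnit : (AdeleRing (𝓞 E) E)ˣ →* (InfiniteAdeleRing E)ˣ :=
  Units.map (fstHom (E := E)).toMonoidHom

/-- The component of an infinite adele at an infinite place, as a complex number. -/
def atPlace (w : InfinitePlace E) : InfiniteAdeleRing E →+* ℂ :=
  (InfinitePlace.Completion.extensionEmbedding w).comp
    (Pi.evalRingHom (fun w : InfinitePlace E => w.Completion) w)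

theorem norm_atPlace (w : InfinitePlace E) (x : InfiniteAdeleRing E) : ‖atPlace w x‖ = ‖x w‖ :=
  (InfinitePlace.Completion.isometry_extensionEmbedding w).norm_map_of_map_zero (map_zero _) _

theorem toInf_unipGL (t : AdeleRing (𝓞 E) E) : toInf (unipGL t) = unipGL t.1 := by
  refine Units.ext ?_
  ext1 i j
  fin_cases i <;> fin_cases j <;> rfl

theorem toInf_diagGL (a b : (AdeleRing (𝓞 E) E)ˣ) :
    toInf (diagGL a b) = diagGL (fstUnit a) (fstUnit b) := by
  refine Units.ext ?_
  ext1 i j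
  fin_cases i <;> fin_cases j <;> rfl

/-- The matrix of `h` at an infinite place. -/
def matAt (h : GA E) (w : InfinitePlace E) : Matrix (Fin 2) (Fin 2) ℂ := infPlace w (toInf h)

theorem continuous_matAt (w : InfinitePlace E) : Continuous fun h : GA E => matAt h w :=
  Units.continuous_val.comp ((continuous_infPlace w).comp continuous_toInf)

theorem matAt_mul (g h : GA E) (w : InfinitePlace E) : matAt (g * h) w = matAt g w * matAt h w := by
  rw [matAt, map_mul, map_mul]; rfl

theorem det_matAt_ne_zero (h : GA E) (w : InfinitePlace E) : (matAt h w).det ≠ 0 :=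
  ((Matrix.isUnit_iff_isUnit_det _).1 (Units.isUnit (infPlace w (toInf h)))).ne_zero

/-- The absolute value of the Iwasawa coordinate `z`. -/
def zAbs (h : GA E) (w : InfinitePlace E) : ℝ :=
  Real.sqrt (‖matAt h w 1 0‖ ^ 2 + ‖matAt h w 1 1‖ ^ 2)

/-- The absolute value of the Iwasawa coordinate `m`. -/
def mAbs (h : GA E) (w : InfinitePlace E) : ℝ := ‖(matAt h w).det‖ / zAbs h w ^ 2

/-- The real part of the Iwasawa coordinate `t`. -/
def tRe (h : GA E) (w : InfinitePlace E) : ℝ :=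
  (matAt h w 0 0 * star (matAt h w 1 0) + matAt h w 0 1 * star (matAt h w 1 1)).re / zAbs h w ^ 2

theorem zAbs_pos (h : GA E) (w : InfinitePlace E) : 0 < zAbs h w := by
  refine Real.sqrt_pos.2 (lt_of_le_of_ne (by positivity) fun h0 => ?_)
  have h1 : ‖matAt h w 1 0‖ = 0 := by nlinarith [norm_nonneg (matAt h w 1 0), sq_nonneg ‖matAt h w 1 1‖]
  have h2 : ‖matAt h w 1 1‖ = 0 := by nlinarith [norm_nonneg (matAt h w 1 1), sq_nonneg ‖matAt h w 1 0‖]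
  refine det_matAt_ne_zero h w ?_
  rw [Matrix.det_fin_two, norm_eq_zero.1 h1, norm_eq_zero.1 h2]
  ring

theorem mAbs_pos (h : GA E) (w : InfinitePlace E) : 0 < mAbs h w :=
  div_pos (norm_pos_iff.2 (det_matAt_ne_zero h w)) (pow_pos (zAbs_pos h w) 2)

theorem continuous_matAt_apply (w : InfinitePlace E) (i j : Fin 2) :
    Continuous fun h : GA E => matAt h w i j := (continuous_matAt w).matrix_elem i j

theorem continuous_zAbs (w : InfinitePlace E) : Continuous fun h : GA E => zAbs h w :=
  Real.continuous_sqrt.comp (((continuous_matAt_apply w 1 0).norm.pow 2).add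
    ((continuous_matAt_apply w 1 1).norm.pow 2))

theorem continuous_mAbs (w : InfinitePlace E) : Continuous fun h : GA E => mAbs h w :=
  (continuous_matAt w).matrix_det.norm.div ((continuous_zAbs w).pow 2)
    fun h => (pow_pos (zAbs_pos h w) 2).ne'

theorem continuous_tRe (w : InfinitePlace E) : Continuous fun h : GA E => tRe h w := by
  refine Continuous.div ?_ ((continuous_zAbs w).pow 2) fun h => (pow_pos (zAbs_pos h w) 2).ne'
  exact Complex.continuous_re.comp
    (((continuous_matAt_apply w 0 0).mul (continuous_matAt_apply w 1 0).star).add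
      ((continuous_matAt_apply w 0 1).mul (continuous_matAt_apply w 1 1).star))

/-- The rows of a unitary `κ` are orthonormal. So the bottom row of `H` has length `‖Z‖`, and in its
Hermitian product with the top row the term with `M` drops out and only `T ‖Z‖ ^ 2` survives. -/
theorem iwasawa_formulas {T M Z : ℂ} {κ : Matrix (Fin 2) (Fin 2) ℂ}
    (hκ : κ ∈ Matrix.unitaryGroup (Fin 2) ℂ) {H : Matrix (Fin 2) (Fin 2) ℂ}
    (hH : H = !![Z * M, T * Z; 0, Z] * κ) :
    ‖H 1 0‖ ^ 2 + ‖H 1 1‖ ^ 2 = ‖Z‖ ^ 2 ∧ ‖H.det‖ = ‖M‖ * ‖Z‖ ^ 2 ∧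
      (H 0 0 * star (H 1 0) + H 0 1 * star (H 1 1)).re = T.re * ‖Z‖ ^ 2 := by
  have h1 := (Matrix.mem_unitaryGroup_iff).1 hκ
  have e11 := congrFun (congrFun h1 1) 1
  have e01 := congrFun (congrFun h1 0) 1
  simp only [Matrix.mul_apply, Fin.sum_univ_two, Matrix.star_apply, Matrix.one_apply_eq,
    Matrix.one_apply_ne (zero_ne_one (α := Fin 2))] at e11 e01
  have hdet : ‖κ.det‖ = 1 := CStarRing.norm_of_mem_unitary (Matrix.det_of_mem_unitary hκ)
  have e11' : ‖κ 1 0‖ ^ 2 + ‖κ 1 1‖ ^ 2 = 1 := by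
    have hn : ∀ z : ℂ, z * star z = ((‖z‖ ^ 2 : ℝ) : ℂ) := fun z => by
      rw [← starRingEnd_apply, Complex.mul_conj, Complex.normSq_eq_norm_sq]
    rw [hn, hn] at e11
    exact_mod_cast e11
  have H00 : H 0 0 = Z * M * κ 0 0 + T * Z * κ 1 0 := by
    rw [hH, Matrix.mul_apply, Fin.sum_univ_two]; rfl
  have H01 : H 0 1 = Z * M * κ 0 1 + T * Z * κ 1 1 := by
    rw [hH, Matrix.mul_apply, Fin.sum_univ_two]; rfl
  have H10 : H 1 0 = Z * κ 1 0 := by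
    rw [hH, Matrix.mul_apply, Fin.sum_univ_two]
    exact (congrArg (· + Z * κ 1 0) (zero_mul _)).trans (zero_add _)
  have H11 : H 1 1 = Z * κ 1 1 := by
    rw [hH, Matrix.mul_apply, Fin.sum_univ_two]
    exact (congrArg (· + Z * κ 1 1) (zero_mul _)).trans (zero_add _)
  refine ⟨?_, ?_, ?_⟩
  · rw [H10, H11, norm_mul, norm_mul, mul_pow, mul_pow, ← mul_add, e11', mul_one]
  · rw [hH, Matrix.det_mul, Matrix.det_fin_two_of, norm_mul, hdet, mul_zero, sub_zero, norm_mul,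
      norm_mul]
    ring
  · have hZ : Z * star Z = ((‖Z‖ ^ 2 : ℝ) : ℂ) := by
      rw [← starRingEnd_apply, Complex.mul_conj, Complex.normSq_eq_norm_sq]
    have : H 0 0 * star (H 1 0) + H 0 1 * star (H 1 1) = ((‖Z‖ ^ 2 : ℝ) : ℂ) * T := by
      rw [← hZ, H00, H01, H10, H11, star_mul', star_mul']
      linear_combination (Z * star Z * M) * e01 + (T * Z * star Z) * e11
    rw [this, Complex.re_ofReal_mul]
    ring

theorem IwasawaCoord.IsFor.inf_part {δ : (AdeleRing (𝓞 E) E)ˣ} (hδ : (δ : AdeleRing (𝓞 E) E).1 = 1)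
    {h : GA E} {c : IwasawaCoord E} (hc : c.IsFor δ h) (w : InfinitePlace E) :
    ‖(c.z : AdeleRing (𝓞 E) E).1 w‖ = zAbs h w ∧ ‖(c.m : AdeleRing (𝓞 E) E).1 w‖ = mAbs h w ∧
      (atPlace w c.t.1).re = tRe h w := by
  obtain ⟨k, hk, rfl⟩ := hc
  have hδ' : fstUnit δ⁻¹ = 1 := by
    rw [map_inv, inv_eq_one]
    exact Units.ext hδ
  have hH : matAt (unipGL c.t * diagGL (c.z * c.m * δ⁻¹) c.z * k) w
      = !![atPlace w (c.z : AdeleRing (𝓞 E) E).1 * atPlace w (c.m : AdeleRing (𝓞 E) E).1,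
        atPlace w c.t.1 * atPlace w (c.z : AdeleRing (𝓞 E) E).1; 0,
        atPlace w (c.z : AdeleRing (𝓞 E) E).1] * matAt k w := by
    rw [matAt_mul]
    congr 1
    rw [matAt, map_mul, toInf_unipGL, toInf_diagGL, map_mul fstUnit, hδ', mul_one]
    have : (unipGL c.t.1 * diagGL (fstUnit (c.z * c.m)) (fstUnit c.z) :
        Matrix (Fin 2) (Fin 2) (InfiniteAdeleRing E))
        = !![(c.z : AdeleRing (𝓞 E) E).1 * (c.m : AdeleRing (𝓞 E) E).1,
          c.t.1 * (c.z : AdeleRing (𝓞 E) E).1; 0, (c.z : AdeleRing (𝓞 E) E).1] := by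
      rw [coe_unipGL, coe_diagGL, Matrix.mul_fin_two]
      simp only [one_mul, mul_zero, add_zero, zero_mul, zero_add]
      rfl
    ext1 i j
    refine (congrArg (fun A : Matrix (Fin 2) (Fin 2) (InfiniteAdeleRing E) => atPlace w (A i j))
      this).trans ?_
    fin_cases i <;> fin_cases j
    · exact map_mul (atPlace w) _ _
    · exact map_mul (atPlace w) _ _
    · exact map_zero (atPlace w)
    · rfl
  obtain ⟨h1, h2, h3⟩ := iwasawa_formulas (hk.1 w) hH
  have hz : ‖(c.z : AdeleRing (𝓞 E) E).1 w‖
      = zAbs (unipGL c.t * diagGL (c.z * c.m * δ⁻¹) c.z * k) w := by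
    rw [zAbs, h1, Real.sqrt_sq (norm_nonneg _), norm_atPlace]
  have hp := zAbs_pos (unipGL c.t * diagGL (c.z * c.m * δ⁻¹) c.z * k) w
  refine ⟨hz, ?_, ?_⟩
  · rw [mAbs, h2, norm_atPlace, norm_atPlace, hz, mul_div_assoc, div_self (pow_pos hp 2).ne', mul_one]
  · rw [tRe, h3, norm_atPlace, hz, mul_div_assoc, div_self (pow_pos hp 2).ne', mul_one]

/-- A finite idele, extended by `1` to the infinite places. -/
def finUnit (u : (FiniteAdeleRing (𝓞 E) E)ˣ) : (AdeleRing (𝓞 E) E)ˣ where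
  val := (1, u)
  inv := (1, (u⁻¹ : (FiniteAdeleRing (𝓞 E) E)ˣ))
  val_inv := Prod.ext (mul_one (1 : InfiniteAdeleRing E)) (Units.mul_inv u)
  inv_val := Prod.ext (mul_one (1 : InfiniteAdeleRing E)) (Units.inv_mul u)

theorem sndUnit_finUnit (u : (FiniteAdeleRing (𝓞 E) E)ˣ) : sndUnit (finUnit u) = u := Units.ext rfl

theorem fstUnit_finUnit (u : (FiniteAdeleRing (𝓞 E) E)ˣ) : fstUnit (finUnit u) = 1 := Units.ext rfl

/-- A finite adele, extended by `0` to the infinite places. -/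
def finAdele (a : FiniteAdeleRing (𝓞 E) E) : AdeleRing (𝓞 E) E := ((0 : InfiniteAdeleRing E), a)

theorem toFin_unipGL_finAdele (a : FiniteAdeleRing (𝓞 E) E) :
    toFin (unipGL (finAdele a)) = unipGL a := toFin_unipGL _

theorem toInf_unipGL_finAdele (a : FiniteAdeleRing (𝓞 E) E) : toInf (unipGL (finAdele a)) = 1 := by
  rw [toInf_unipGL]
  refine Units.ext ?_
  rw [coe_unipGL, Units.val_one, Matrix.one_fin_two]
  rfl

/-- Iwasawa coordinates of a representative of the finite part of `h`. -/
def finCoord (δ : (AdeleRing (𝓞 E) E)ˣ) (h : GA E) : IwasawaCoord E :=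
  iwasawaCoord δ (ofFin (repFin (toFin h)))

theorem finCoord_eq (δ : (AdeleRing (𝓞 E) E)ˣ) {h h' : GA E}
    (hh : (toFin h)⁻¹ * toFin h' ∈ KFin E) : finCoord δ h' = finCoord δ h := by
  rw [finCoord, finCoord, repFin_eq hh]

/-- Erasing the infinite components of coordinates of `h` gives coordinates of the chosen
representative, so the choice made in `finCoord` is among genuine coordinates. -/
theorem IwasawaCoord.IsFor.finCoord {δ : (AdeleRing (𝓞 E) E)ˣ}
    (hδ : (δ : AdeleRing (𝓞 E) E).1 = 1) {h : GA E} {c : IwasawaCoord E} (hc : c.IsFor δ h) :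
    (finCoord δ h).IsFor δ (ofFin (repFin (toFin h))) := by
  refine Classical.epsilon_spec (p := IwasawaCoord.IsFor δ (ofFin (repFin (toFin h))))
    ⟨⟨finAdele c.t.2, finUnit (sndUnit c.m), finUnit (sndUnit c.z)⟩, ?_⟩
  obtain ⟨k, hk, e⟩ := hc
  have hδ' : fstUnit δ⁻¹ = 1 := by
    rw [map_inv, inv_eq_one]
    exact Units.ext hδ
  refine ⟨ofFin (toFin k * ((toFin h)⁻¹ * repFin (toFin h))),
    ofFin_mem_KA (mul_mem_KFin hk.2 (inv_mul_repFin_mem _)), GA_ext ?_ ?_⟩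
  · simp only [map_mul, toInf_ofFin, toInf_unipGL_finAdele, toInf_diagGL, fstUnit_finUnit, hδ',
      mul_one, diagGL_one]
  · have e' := congrArg toFin e
    simp only [map_mul, toFin_ofFin, toFin_unipGL, toFin_diagGL] at e'
    simp only [map_mul, toFin_ofFin, toFin_unipGL_finAdele, toFin_diagGL, sndUnit_finUnit]
    rw [← mul_assoc _ (toFin k), ← e', mul_inv_cancel_left]

/-- The scalar matrix with Iwasawa coordinate `z`. -/
def zScalar (δ : (AdeleRing (𝓞 E) E)ˣ) (h : GA E) : GA E :=
  scalarInf (zAbs h) * ofFin (diagGL (sndUnit (finCoord δ h).z) (sndUnit (finCoord δ h).z))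

/-- The scalar matrix with components `|m|_w^{1/2}` at infinity. -/
def mRadius (h : GA E) : GA E := scalarInf fun w => Real.sqrt (mAbs h w)

theorem sqrt_mAbs_pos (h : GA E) (w : InfinitePlace E) : 0 < Real.sqrt (mAbs h w) :=
  Real.sqrt_pos.2 (mAbs_pos h w)

open scoped Classical in
/-- The coefficient of the distribution `𝕎_h`, in explicit form. -/
def wCoeff (δ : (AdeleRing (𝓞 E) E)ˣ) (h : GA E) : ℂ :=
  Complex.exp (-2 * Real.pi * Complex.I *
    ((∑ w : InfinitePlace E, (w.mult : ℝ) * tRe h w : ℝ) : ℂ)) * psiFin (finCoord δ h).t.2 *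
    ((∏ w : InfinitePlace E, (mAbs h w ^ w.mult) ^ (1 / 2 : ℝ) / 2 : ℝ) : ℂ) *
    ((if ∀ v : HeightOneSpectrum (𝓞 E), Valued.v (((finCoord δ h).m : AdeleRing (𝓞 E) E).2 v) ≤ 1
      then finAbs ((finCoord δ h).m : AdeleRing (𝓞 E) E).2 else 0 : ℝ) : ℂ)

/-- The density of the distribution `𝕎_h`. -/
def wWeight (δ : (AdeleRing (𝓞 E) E)ˣ) (h x : GA E) : ℂ :=
  wCoeff δ h * ((gaussian (toInf (mRadius h * x)) : ℂ) *
    (heckeIndicator ((finCoord δ h).m : AdeleRing (𝓞 E) E).2 (toFin x) : ℂ))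

/-- The inverse of the argument of the test function in the definition of `𝕎_h`. -/
def wPoint (δ : (AdeleRing (𝓞 E) E)ˣ) (h x : GA E) : GA E := (zScalar δ h * mRadius h * x)⁻¹

/-- For integral `m` the two values of `t` at the finite places differ by an adele whose product
with `δ` is integral, and `ψ` does not see it. For non-integral `m` both coefficients vanish. -/
theorem wCoeff_eq {δ : (AdeleRing (𝓞 E) E)ˣ} (hδ : IsDifferentIdele δ)
    {h : GA E} {c : IwasawaCoord E} (hc : c.IsFor δ h) : c.coeff = wCoeff δ h := by
  have hf := hc.finite_part (hc.finCoord hδ.1)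
    (by rw [toFin_ofFin]; exact inv_mul_repFin_mem _)
  have hi := hc.inf_part hδ.1
  unfold IwasawaCoord.coeff wCoeff
  simp only [fun v => (hf v).1, fun w => (hi w).2.1,
    finAbs_eq_of_valued_eq (fun v => (hf v).1)]
  by_cases hm : ∀ v : HeightOneSpectrum (𝓞 E), Valued.v ((c.m : AdeleRing (𝓞 E) E).2 v) ≤ 1
  · rw [if_pos hm, psi, psiFin_eq_of_sub_mem hδ (a := (finCoord δ h).t.2) (a' := c.t.2)
      fun v => (hf v).2.2.trans (hm v), psiInf]
    have : ∀ w : InfinitePlace E,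
        (InfinitePlace.Completion.extensionEmbedding w (c.t.1 w)).re = tRe h w :=
      fun w => (hi w).2.2
    simp only [this]
    rw [if_pos fun v => (hf v).1.trans_le (hm v)]
  · rw [if_neg hm, if_neg fun h => hm fun v => (hf v).1.symm.trans_le (h v)]
    simp only [Complex.ofReal_zero, mul_zero]

theorem diagGL_mem_KInf {u : (InfiniteAdeleRing E)ˣ}
    (hu : ∀ w : InfinitePlace E, ‖(u : InfiniteAdeleRing E) w‖ = 1) : diagGL u u ∈ KInf E := by
  intro w
  rw [Matrix.mem_unitaryGroup_iff]
  have h : atPlace w u * star (atPlace w u) = 1 := by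
    rw [← starRingEnd_apply, Complex.mul_conj, Complex.normSq_eq_norm_sq, norm_atPlace, hu]
    norm_num
  have h0 : atPlace w 0 = 0 := map_zero _
  have e : (Matrix.of fun i j => InfinitePlace.Completion.extensionEmbedding w (diagGL u u i j w))
      = !![atPlace w u, 0; 0, atPlace w u] := by
    ext1 i j
    fin_cases i <;> fin_cases j
    exacts [rfl, h0, h0, rfl]
  rw [e, Matrix.star_eq_conjTranspose]
  ext1 i j
  fin_cases i <;> fin_cases j <;>
    simp only [Matrix.mul_apply, Fin.sum_univ_two, Matrix.conjTranspose_apply] <;> simp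
  all_goals exact h

theorem diagGL_mem_KFin {u : (FiniteAdeleRing (𝓞 E) E)ˣ}
    (hu : ∀ v : HeightOneSpectrum (𝓞 E), Valued.v ((u : FiniteAdeleRing (𝓞 E) E) v) = 1) :
    diagGL u u ∈ KFin E := by
  have hu' : ((u⁻¹ : (FiniteAdeleRing (𝓞 E) E)ˣ) : FiniteAdeleRing (𝓞 E) E) ∈ intFin E := by
    intro v
    have h1 := valued_mul v (u : FiniteAdeleRing (𝓞 E) E)
      ((u⁻¹ : (FiniteAdeleRing (𝓞 E) E)ˣ) : FiniteAdeleRing (𝓞 E) E)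
    rw [Units.mul_inv, hu, one_mul] at h1
    exact (h1.symm.trans (map_one (Valued.v : Valuation (v.adicCompletion E) _))).le
  rw [mem_KFin_iff, diagGL_inv]
  intro i j
  fin_cases i <;> fin_cases j
  exacts [⟨fun v => (hu v).le, hu'⟩, ⟨zero_mem_intFin, zero_mem_intFin⟩,
    ⟨zero_mem_intFin, zero_mem_intFin⟩, ⟨fun v => (hu v).le, hu'⟩]

/-- The idele with positive real components at infinity and component `1` at the finite places. -/
def realIdele (r : InfinitePlace E → ℝ) (hr : ∀ w, 0 < r w) : (InfiniteAdeleRing E)ˣ :=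
  Units.map ((InfiniteAdeleRing.ringEquiv_mixedSpace E).symm : mixedSpace E →* InfiniteAdeleRing E)
    (realUnit r hr)

theorem toInf_scalarInf {r : InfinitePlace E → ℝ} (hr : ∀ w, 0 < r w) :
    toInf (scalarInf r) = diagGL (realIdele r hr) (realIdele r hr) := by
  refine Units.ext ?_
  ext1 i j
  refine (toInf_scalarInf_apply hr i j).trans ?_
  fin_cases i <;> fin_cases j <;> rfl

theorem norm_realIdele {r : InfinitePlace E → ℝ} (hr : ∀ w, 0 < r w) (w : InfinitePlace E) :
    ‖(realIdele r hr : InfiniteAdeleRing E) w‖ = r w :=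
  (norm_symm_realVec r w).trans (abs_of_pos (hr w))

/-- `zScalar` has the right absolute value at every place, so the quotient is a scalar matrix with
entries of absolute value one. -/
theorem diagGL_mul_zScalar_inv_mem {δ : (AdeleRing (𝓞 E) E)ˣ} (hδ : IsDifferentIdele δ)
    {h : GA E} {c : IwasawaCoord E} (hc : c.IsFor δ h) :
    diagGL c.z c.z * (zScalar δ h)⁻¹ ∈ KA E := by
  have hf := hc.finite_part (hc.finCoord hδ.1)
    (by rw [toFin_ofFin]; exact inv_mul_repFin_mem _)
  have hi := hc.inf_part hδ.1
  have hz := zAbs_pos h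
  rw [← inv_inv (_ * _), mul_inv_rev, inv_inv]
  refine inv_mem_KA ⟨?_, ?_⟩
  · rw [map_mul, map_inv, zScalar, map_mul, toInf_ofFin, mul_one, toInf_scalarInf hz, toInf_diagGL,
      diagGL_inv, diagGL_mul]
    refine diagGL_mem_KInf fun w => ?_
    rw [← norm_atPlace, Units.val_mul, map_mul, norm_mul]
    have h1 : atPlace w ((fstUnit c.z)⁻¹ : (InfiniteAdeleRing E)ˣ)
        = (atPlace w (c.z : AdeleRing (𝓞 E) E).1)⁻¹ := by
      refine eq_inv_of_mul_eq_one_left ?_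
      have := congrArg (atPlace w) (Units.inv_mul (fstUnit c.z))
      rwa [map_mul, map_one] at this
    rw [h1, norm_inv, norm_atPlace, norm_atPlace, norm_realIdele, (hi w).1,
      mul_inv_cancel₀ (hz w).ne']
  · rw [map_mul, map_inv, zScalar, map_mul, toFin_ofFin, toFin_scalarInf hz, one_mul, toFin_diagGL,
      diagGL_inv, diagGL_mul]
    refine diagGL_mem_KFin fun v => ?_
    rw [Units.val_mul, valued_mul, coe_sndUnit, (hf v).2.1, ← coe_sndUnit, ← valued_mul,
      Units.mul_inv]
    exact map_one (Valued.v : Valuation (v.adicCompletion E) _)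

/-- The explicit point `wPoint` differs from the one given by the chosen coordinates by a right
factor in `K`, under which `Ψ` is invariant; the Gaussian and the Hecke indicator depend only on
absolute values of `m`. -/
theorem coeff_mul_integrand {δ : (AdeleRing (𝓞 E) E)ˣ} (hδ : IsDifferentIdele δ)
    {h : GA E} {c : IwasawaCoord E} (hc : c.IsFor δ h) {Ψ : GA E → ℂ}
    (hΨ : ∀ k ∈ KA E, ∀ g, Ψ (g * k) = Ψ g) (g x : GA E) :
    c.integrand (fun x => Ψ (g * x⁻¹)) x
      = (gaussian (toInf (mRadius h * x)) : ℂ) *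
        (heckeIndicator ((finCoord δ h).m : AdeleRing (𝓞 E) E).2 (toFin x) : ℂ) *
        Ψ (g * wPoint δ h x) := by
  have hf := hc.finite_part (hc.finCoord hδ.1)
    (by rw [toFin_ofFin]; exact inv_mul_repFin_mem _)
  have hi := hc.inf_part hδ.1
  have hr : c.radius = mRadius h := by
    unfold IwasawaCoord.radius mRadius
    congr 1
    funext w
    rw [(hi w).2.1]
  unfold IwasawaCoord.integrand
  rw [hr, heckeIndicator_congr fun v => (hf v).1]
  have e : g * wPoint δ h x = g * (diagGL c.z c.z * mRadius h * x)⁻¹ *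
      (diagGL c.z c.z * (zScalar δ h)⁻¹) := by
    unfold wPoint
    group
  rw [e, hΨ _ (diagGL_mul_zScalar_inv_mem hδ hc)]

/-! ### Sizes of matrices at infinity -/

/-- The sum of the squares of the entries at an infinite place. -/
def sizeAt (x : GA E) (w : InfinitePlace E) : ℝ := ∑ i, ∑ j, ‖matAt x w i j‖ ^ 2

/-- The product over the infinite places of the sums of the squares of the entries. -/
def size (x : GA E) : ℝ := ∏ w : InfinitePlace E, sizeAt x w

theorem continuous_sizeAt (w : InfinitePlace E) : Continuous fun x : GA E => sizeAt x w :=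
  continuous_finsetSum _ fun i _ => continuous_finsetSum _ fun j _ =>
    (continuous_matAt_apply w i j).norm.pow 2

theorem continuous_size : Continuous (size (E := E)) :=
  continuous_finsetProd _ fun w _ => continuous_sizeAt w

theorem det_matAt (x : GA E) (w : InfinitePlace E) : (matAt x w).det
    = atPlace w ((Matrix.GeneralLinearGroup.det x : (AdeleRing (𝓞 E) E)ˣ) : AdeleRing (𝓞 E) E).1 := by
  rw [fst_det, Matrix.GeneralLinearGroup.val_det_apply, RingHom.map_det]
  rfl

theorem norm_det_matAt (x : GAArchOne E) (w : InfinitePlace E) : ‖(matAt (x : GA E) w).det‖ = 1 := by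
  rw [det_matAt, norm_atPlace]; exact x.2 w

/-- From `|ad - bc| = 1` and the inequality of arithmetic and geometric means. The value `2` is what
`pow_mul_exp_le` needs in order to split the Gaussian. -/
theorem two_le_sizeAt (x : GAArchOne E) (w : InfinitePlace E) : 2 ≤ sizeAt (x : GA E) w := by
  have h := norm_det_matAt x w
  rw [Matrix.det_fin_two] at h
  have h1 := norm_sub_le (matAt (x : GA E) w 0 0 * matAt (x : GA E) w 1 1)
    (matAt (x : GA E) w 0 1 * matAt (x : GA E) w 1 0)
  rw [h, norm_mul, norm_mul] at h1
  simp only [sizeAt, Fin.sum_univ_two]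
  nlinarith [sq_nonneg (‖matAt (x : GA E) w 0 0‖ - ‖matAt (x : GA E) w 1 1‖),
    sq_nonneg (‖matAt (x : GA E) w 0 1‖ - ‖matAt (x : GA E) w 1 0‖)]

theorem one_le_size (x : GAArchOne E) : 1 ≤ size (x : GA E) :=
  Finset.one_le_prod fun w _ => one_le_two.trans (two_le_sizeAt x w)

theorem sizeAt_le_size (x : GAArchOne E) (w : InfinitePlace E) :
    sizeAt (x : GA E) w ≤ size (x : GA E) := by
  classical
  rw [size, ← Finset.mul_prod_erase _ _ (Finset.mem_univ w)]
  have h0 : 0 ≤ sizeAt (x : GA E) w := zero_le_two.trans (two_le_sizeAt x w)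
  refine le_mul_of_one_le_right h0 ?_
  exact Finset.prod_induction _ (fun t : ℝ => 1 ≤ t) (fun a b => one_le_mul_of_one_le_of_one_le)
    le_rfl fun w _ => one_le_two.trans (two_le_sizeAt x w)

theorem sq_norm_matAt_le (x : GA E) (w : InfinitePlace E) (i j : Fin 2) :
    ‖matAt x w i j‖ ^ 2 ≤ sizeAt x w :=
  (Finset.single_le_sum (f := fun j => ‖matAt x w i j‖ ^ 2) (fun _ _ => by positivity)
    (Finset.mem_univ j)).trans
    (Finset.single_le_sum (f := fun i => ∑ j, ‖matAt x w i j‖ ^ 2)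
      (fun _ _ => Finset.sum_nonneg fun _ _ => by positivity) (Finset.mem_univ i))

/-- With determinant of absolute value one, the inverse has the same entries as the adjugate up to a
unimodular factor. -/
theorem exists_norm_matAt_inv (x : GAArchOne E) (w : InfinitePlace E) (i j : Fin 2) :
    ∃ i' j', ‖matAt ((x : GA E)⁻¹) w i j‖ = ‖matAt (x : GA E) w i' j'‖ := by
  have h : matAt ((x : GA E)⁻¹) w = Ring.inverse (matAt (x : GA E) w).det •
      (matAt (x : GA E) w).adjugate := by
    rw [matAt, map_inv, map_inv, Matrix.coe_units_inv, Matrix.inv_def]; rfl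
  rw [h, Matrix.smul_apply, smul_eq_mul, norm_mul, Ring.inverse_eq_inv', norm_inv, norm_det_matAt,
    inv_one, one_mul, Matrix.adjugate_fin_two]
  fin_cases i <;> fin_cases j
  exacts [⟨1, 1, rfl⟩, ⟨0, 1, norm_neg _⟩, ⟨1, 0, norm_neg _⟩, ⟨0, 0, rfl⟩]

open scoped Classical in
theorem norm_vecM_toMix_le {x : GA E} {c : ℝ} (hc : 0 ≤ c)
    (h : ∀ w i j, ‖matAt x w i j‖ ≤ c) : ‖vecM (toMix x : Matrix (Fin 2) (Fin 2) (mixedSpace E))‖ ≤ c := by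
  refine (pi_norm_le_iff_of_nonneg hc).2 fun i => (pi_norm_le_iff_of_nonneg hc).2 fun j => ?_
  refine norm_prod_le_iff.2 ⟨(pi_norm_le_iff_of_nonneg hc).2 fun w => ?_,
    (pi_norm_le_iff_of_nonneg hc).2 fun w => ?_⟩
  · refine le_of_eq_of_le ?_ (h w.1 i j)
    rw [matAt, norm_apply_eq]
    exact (InfinitePlace.Completion.isometry_extensionEmbeddingOfIsReal
      w.2).norm_map_of_map_zero (map_zero _) _
  · exact h w.1 i j

-- All entries of `x` and of `x⁻¹` are at most the square root of `size x`, so conjugation costs at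
-- most `4 · size x`.
open scoped Classical in
theorem norm_adInv_inv_le (x : GAArchOne E) (V : MatInf E) :
    ‖adInv ((x : GA E)⁻¹) V‖ ≤ 4 * size (x : GA E) * ‖V‖ := by
  have h0 : 0 ≤ size (x : GA E) := zero_le_one.trans (one_le_size x)
  have h1 : ∀ w i j, ‖matAt (x : GA E) w i j‖ ≤ Real.sqrt (size (x : GA E)) := fun w i j =>
    Real.le_sqrt_of_sq_le ((sq_norm_matAt_le _ w i j).trans (sizeAt_le_size x w))
  have h2 : ∀ w i j, ‖matAt ((x : GA E)⁻¹) w i j‖ ≤ Real.sqrt (size (x : GA E)) := fun w i j => by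
    obtain ⟨i', j', h⟩ := exists_norm_matAt_inv x w i j
    rw [h]; exact h1 w i' j'
  have h3 := norm_vecM_toMix_le (Real.sqrt_nonneg _) h1
  have h4 := norm_vecM_toMix_le (Real.sqrt_nonneg _) h2
  rw [adInv, map_inv, inv_inv]
  rw [map_inv] at h4
  refine (norm_mulLR_apply_le _ _ _).trans ?_
  refine mul_le_mul_of_nonneg_right ?_ (norm_nonneg _)
  calc _ ≤ 4 * Real.sqrt (size (x : GA E)) * Real.sqrt (size (x : GA E)) := by gcongr
    _ = 4 * size (x : GA E) := by rw [mul_assoc, Real.mul_self_sqrt h0]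

-- The scalar factors and the finite factor of `wPoint` act trivially on the Lie algebra. Only `x`
-- contributes, so the bound is uniform in `h`.
open scoped Classical in
theorem norm_adInv_wPoint_le (δ : (AdeleRing (𝓞 E) E)ˣ) (h : GA E) (x : GAArchOne E)
    (V : MatInf E) : ‖adInv (wPoint δ h x) V‖ ≤ 4 * size (x : GA E) * ‖V‖ := by
  have e : wPoint δ h x = (x : GA E)⁻¹ * (scalarInf (fun w => Real.sqrt (mAbs h w)))⁻¹ *
      ((scalarInf (zAbs h))⁻¹ * ofFin (diagGL (sndUnit (finCoord δ h).z)
        (sndUnit (finCoord δ h).z))⁻¹) := by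
    have : ofFin (diagGL (sndUnit (finCoord δ h).z) (sndUnit (finCoord δ h).z))⁻¹
        = (ofFin (diagGL (sndUnit (finCoord δ h).z) (sndUnit (finCoord δ h).z)))⁻¹ :=
      eq_inv_of_mul_eq_one_left (by rw [← ofFin_mul, inv_mul_cancel, ofFin_one])
    rw [wPoint, zScalar, mRadius, this, scalarInf_comm (zAbs_pos h)]
    group
  have hf : ∀ (k : GL (Fin 2) (FiniteAdeleRing (𝓞 E) E)) (V : MatInf E), adInv (ofFin k) V = V := by
    intro k V
    rw [adInv, toMix_ofFin, mulLR_apply, inv_one, Units.val_one, one_mul, mul_one]; rfl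
  rw [e, adInv_mul, adInv_mul, adInv_mul, hf, scalarInf_inv (zAbs_pos h),
    scalarInf_inv fun w => sqrt_mAbs_pos h w, adInv_scalarInf fun w => inv_pos.2 (zAbs_pos h w),
    adInv_scalarInf fun w => inv_pos.2 (sqrt_mAbs_pos h w)]
  exact norm_adInv_inv_le x V

/-! ### Continuity of the density -/

theorem continuous_of_finCoord (δ : (AdeleRing (𝓞 E) E)ˣ) {Y : Type*} [TopologicalSpace Y]
    (f : IwasawaCoord E → Y) : Continuous fun h : GA E => f (finCoord δ h) :=
  continuous_of_forall_mul_KFin continuous_toFin fun _ _ hxy => by rw [finCoord_eq δ hxy]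

theorem continuous_zScalar (δ : (AdeleRing (𝓞 E) E)ˣ) : Continuous (zScalar δ) :=
  (continuous_scalarInf (fun h w => zAbs_pos h w) (continuous_pi continuous_zAbs)).mul
    (continuous_of_finCoord δ fun c => ofFin (diagGL (sndUnit c.z) (sndUnit c.z)))

theorem continuous_mRadius : Continuous (mRadius (E := E)) :=
  continuous_scalarInf (fun h w => sqrt_mAbs_pos h w)
    (continuous_pi fun w => Real.continuous_sqrt.comp (continuous_mAbs w))

theorem continuous_wPoint (δ : (AdeleRing (𝓞 E) E)ˣ) :
    Continuous fun p : GA E × GA E => wPoint δ p.1 p.2 :=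
  ((((continuous_zScalar δ).comp continuous_fst).mul
    (continuous_mRadius.comp continuous_fst)).mul continuous_snd).inv

theorem continuous_wCoeff (δ : (AdeleRing (𝓞 E) E)ˣ) : Continuous (wCoeff δ) := by
  classical
  refine ((Continuous.mul ?_ (continuous_of_finCoord δ fun c => psiFin c.t.2)).mul ?_).mul ?_
  · exact Complex.continuous_exp.comp (continuous_const.mul (Complex.continuous_ofReal.comp
      (continuous_finsetSum _ fun w _ => continuous_const.mul (continuous_tRe w))))
  · refine Complex.continuous_ofReal.comp (continuous_finsetProd _ fun w _ => Continuous.div_const ?_ _)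
    exact ((continuous_mAbs w).pow _).rpow_const fun h => Or.inr (by norm_num)
  · exact Complex.continuous_ofReal.comp (continuous_of_finCoord δ fun c =>
      if ∀ v : HeightOneSpectrum (𝓞 E), Valued.v ((c.m : AdeleRing (𝓞 E) E).2 v) ≤ 1
      then finAbs (c.m : AdeleRing (𝓞 E) E).2 else 0)

theorem gaussian_toInf (x : GA E) : gaussian (toInf x) = ∏ w : InfinitePlace E,
    Real.exp (-(w.mult : ℝ) * sizeAt x w) * (‖(matAt x w).det‖ ^ w.mult) ^ (1 / 2 : ℝ) := by
  unfold gaussian sizeAt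
  refine Finset.prod_congr rfl fun w _ => ?_
  rw [det_matAt, norm_atPlace, fst_det]
  simp only [matAt, norm_apply_eq]

theorem continuous_gaussian : Continuous fun x : GA E => gaussian (toInf x) := by
  simp only [gaussian_toInf]
  refine continuous_finsetProd _ fun w _ => Continuous.mul ?_ ?_
  · exact Real.continuous_exp.comp (continuous_const.mul (continuous_sizeAt w))
  · exact ((continuous_matAt w).matrix_det.norm.pow _).rpow_const fun h => Or.inr (by norm_num)

/-- The value depends only on the cosets modulo `K^∞` of the finite parts of both variables, hence
is locally constant. -/
theorem continuous_heckeIndicator (δ : (AdeleRing (𝓞 E) E)ˣ) :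
    Continuous fun p : GA E × GA E =>
      heckeIndicator ((finCoord δ p.1).m : AdeleRing (𝓞 E) E).2 (toFin p.2) := by
  refine continuous_iff_continuousAt.2 fun p => ?_
  have h2 : ContinuousAt (fun q : GA E × GA E =>
      heckeIndicator ((finCoord δ p.1).m : AdeleRing (𝓞 E) E).2 (toFin q.2)) p := by
    refine Continuous.continuousAt ?_
    refine continuous_of_forall_mul_KFin (continuous_toFin.comp continuous_snd) fun x y hxy => ?_
    have := heckeIndicator_mul_right ((finCoord δ p.1).m : AdeleRing (𝓞 E) E).2 (toFin x.2) hxy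
    rwa [Function.comp_apply, Function.comp_apply, mul_inv_cancel_left] at this
  refine h2.congr ?_
  have h4 : ∀ᶠ q : GA E × GA E in nhds p, (toFin p.1)⁻¹ * toFin q.1 ∈ KFin E := by
    have h3 : Continuous fun q : GA E × GA E => (toFin p.1)⁻¹ * toFin q.1 :=
      continuous_const.mul (continuous_toFin.comp continuous_fst)
    refine h3.continuousAt.eventually (isOpen_KFin.mem_nhds ?_)
    simpa using one_mem_KFin
  filter_upwards [h4] with q hq
  rw [finCoord_eq δ hq]

theorem continuous_wWeight (δ : (AdeleRing (𝓞 E) E)ˣ) :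
    Continuous fun p : GA E × GA E => wWeight δ p.1 p.2 := by
  refine ((continuous_wCoeff δ).comp continuous_fst).mul (Continuous.mul ?_ ?_)
  · exact Complex.continuous_ofReal.comp (continuous_gaussian.comp
      ((continuous_mRadius.comp continuous_fst).mul continuous_snd))
  · exact Complex.continuous_ofReal.comp (continuous_heckeIndicator δ)

/-! ### The absolute value of the density -/

theorem matAt_scalarInf_mul {r : InfinitePlace E → ℝ} (hr : ∀ w, 0 < r w) (x : GA E)
    (w : InfinitePlace E) : matAt (scalarInf r * x) w = (r w : ℂ) • matAt x w := by
  have h : matAt (scalarInf r) w = (r w : ℂ) • 1 := by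
    ext1 i j
    refine (congrArg (atPlace w) (toInf_scalarInf_apply hr i j)).trans ?_
    rw [Matrix.smul_apply, Matrix.one_apply]
    split_ifs
    · exact (extensionEmbedding_symm_realVec r w).trans (by simp)
    · simp
  rw [matAt_mul, h, Matrix.smul_mul, one_mul]

theorem gaussian_mRadius_mul (h : GA E) (x : GAArchOne E) :
    gaussian (toInf (mRadius h * (x : GA E))) = ∏ w : InfinitePlace E,
      Real.exp (-(w.mult : ℝ) * (mAbs h w * sizeAt (x : GA E) w)) * (mAbs h w ^ w.mult) ^ (1 / 2 : ℝ) := by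
  rw [gaussian_toInf]
  refine Finset.prod_congr rfl fun w _ => ?_
  have h1 : sizeAt (mRadius h * (x : GA E)) w = mAbs h w * sizeAt (x : GA E) w := by
    unfold sizeAt mRadius
    rw [matAt_scalarInf_mul (sqrt_mAbs_pos h)]
    simp only [Matrix.smul_apply, smul_eq_mul, norm_mul, Complex.norm_real, mul_pow,
      Real.norm_of_nonneg (Real.sqrt_nonneg _), Real.sq_sqrt (mAbs_pos h w).le, Finset.mul_sum]
  have h2 : ‖(matAt (mRadius h * (x : GA E)) w).det‖ = mAbs h w := by
    unfold mRadius
    rw [matAt_scalarInf_mul (sqrt_mAbs_pos h), Matrix.det_smul, norm_mul, norm_det_matAt,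
      Fintype.card_fin, norm_pow, Complex.norm_real, Real.norm_of_nonneg (Real.sqrt_nonneg _),
      Real.sq_sqrt (mAbs_pos h w).le, mul_one]
  rw [h1, h2]

theorem finAbs_nonneg (x : FiniteAdeleRing (𝓞 E) E) : 0 ≤ finAbs x :=
  finprod_nonneg fun v => norm_nonneg _

theorem finAbs_le_one {x : FiniteAdeleRing (𝓞 E) E} (h : x ∈ intFin E) : finAbs x ≤ 1 := by
  refine (finprod_induction (fun t : ℝ => 0 ≤ t ∧ t ≤ 1) ⟨zero_le_one, le_rfl⟩
    (fun a b ha hb => ⟨mul_nonneg ha.1 hb.1, mul_le_one₀ ha.2 hb.1 hb.2⟩)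
    fun v => ⟨norm_nonneg _, ?_⟩).2
  rw [FinitePlace.norm_def]
  exact_mod_cast (WithZeroMulInt.toNNReal_le_one_iff (HeightOneSpectrum.one_lt_absNorm_nnreal v)).2 (h v)

theorem heckeIndicator_nonneg (m : FiniteAdeleRing (𝓞 E) E)
    (x : GL (Fin 2) (FiniteAdeleRing (𝓞 E) E)) : 0 ≤ heckeIndicator m x := by
  unfold heckeIndicator; split_ifs <;> norm_num

/-- The characters have modulus one, the finite absolute value of an integral `m` is at most one and
the factors `1/2` are discarded. The square root of `|m|_w` in the coefficient and the one from the
determinant in the Gaussian combine to `|m|_w`. -/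
theorem norm_wWeight_le (δ : (AdeleRing (𝓞 E) E)ˣ) (h : GA E) (x : GAArchOne E) :
    ‖wWeight δ h x‖ ≤ (∏ w : InfinitePlace E, mAbs h w ^ w.mult *
      Real.exp (-(w.mult : ℝ) * (mAbs h w * sizeAt (x : GA E) w))) *
      heckeIndicator ((finCoord δ h).m : AdeleRing (𝓞 E) E).2 (toFin x) := by
  classical
  have h1 : ‖wCoeff δ h‖ ≤ ∏ w : InfinitePlace E, (mAbs h w ^ w.mult) ^ (1 / 2 : ℝ) := by
    unfold wCoeff
    rw [norm_mul, norm_mul, norm_mul, norm_psiFin, mul_one, Complex.norm_real, Complex.norm_real]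
    have e1 : ‖Complex.exp (-2 * Real.pi * Complex.I *
        ((∑ w : InfinitePlace E, (w.mult : ℝ) * tRe h w : ℝ) : ℂ))‖ = 1 := by
      rw [show ∀ q : ℝ, -2 * (Real.pi : ℂ) * Complex.I * (q : ℂ)
        = ((-2 * Real.pi * q : ℝ) : ℂ) * Complex.I from fun q => by push_cast; ring]
      exact Complex.norm_exp_ofReal_mul_I _
    rw [e1, one_mul]
    have e2 : ‖(if ∀ v : HeightOneSpectrum (𝓞 E),
        Valued.v (((finCoord δ h).m : AdeleRing (𝓞 E) E).2 v) ≤ 1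
        then finAbs ((finCoord δ h).m : AdeleRing (𝓞 E) E).2 else 0)‖ ≤ 1 := by
      split_ifs with hm
      · rw [Real.norm_of_nonneg (finAbs_nonneg _)]; exact finAbs_le_one hm
      · simp
    have hp : ∀ w : InfinitePlace E, 0 ≤ (mAbs h w ^ w.mult) ^ (1 / 2 : ℝ) := fun w =>
      Real.rpow_nonneg (pow_nonneg (mAbs_pos h w).le _) _
    refine (mul_le_of_le_one_right (norm_nonneg _) e2).trans ?_
    rw [Real.norm_of_nonneg (Finset.prod_nonneg fun w _ => div_nonneg (hp w) zero_le_two)]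
    exact Finset.prod_le_prod (fun w _ => div_nonneg (hp w) zero_le_two)
      fun w _ => half_le_self (hp w)
  unfold wWeight
  rw [norm_mul, norm_mul, Complex.norm_real, Complex.norm_real,
    Real.norm_of_nonneg (heckeIndicator_nonneg _ _), gaussian_mRadius_mul, ← mul_assoc]
  refine mul_le_mul_of_nonneg_right ?_ (heckeIndicator_nonneg _ _)
  have hp : ∀ w : InfinitePlace E, 0 ≤ (mAbs h w ^ w.mult) ^ (1 / 2 : ℝ) := fun w =>
    Real.rpow_nonneg (pow_nonneg (mAbs_pos h w).le _) _
  rw [Real.norm_of_nonneg (Finset.prod_nonneg fun w _ => mul_nonneg (Real.exp_nonneg _) (hp w))]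
  refine (mul_le_mul_of_nonneg_right h1
    (Finset.prod_nonneg fun w _ => mul_nonneg (Real.exp_nonneg _) (hp w))).trans_eq ?_
  rw [← Finset.prod_mul_distrib]
  refine Finset.prod_congr rfl fun w _ => ?_
  have : (mAbs h w ^ w.mult) ^ (1 / 2 : ℝ) * (mAbs h w ^ w.mult) ^ (1 / 2 : ℝ) = mAbs h w ^ w.mult := by
    rw [← Real.rpow_add (pow_pos (mAbs_pos h w) _)]
    norm_num
  rw [mul_left_comm, this, mul_comm]

/-! ### Counting integral matrices of bounded size -/

/-- With `e` a principal part of `a / n`, the element `n e` differs from `a` by `n` times an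
integral adele. It is then integral everywhere, hence in `𝓞 E`. -/
theorem exists_int_sub_eq_natCast_mul {n : ℕ} (hn : n ≠ 0) {a : FiniteAdeleRing (𝓞 E) E}
    (ha : a ∈ intFin E) : ∃ r : 𝓞 E, ∃ b ∈ intFin E,
      a - algebraMap E (FiniteAdeleRing (𝓞 E) E) (r : E) = (n : FiniteAdeleRing (𝓞 E) E) * b := by
  have hnE : (n : E) ≠ 0 := Nat.cast_ne_zero.2 hn
  obtain ⟨e, he⟩ := exists_principal_part
    (a * algebraMap E (FiniteAdeleRing (𝓞 E) E) (n : E)⁻¹)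
  set b := a * algebraMap E (FiniteAdeleRing (𝓞 E) E) (n : E)⁻¹ - algebraMap E _ e with hb
  have h1 : a - algebraMap E (FiniteAdeleRing (𝓞 E) E) ((n : E) * e) = (n : FiniteAdeleRing (𝓞 E) E) * b := by
    have : (n : FiniteAdeleRing (𝓞 E) E) * algebraMap E (FiniteAdeleRing (𝓞 E) E) (n : E)⁻¹ = 1 := by
      rw [← map_natCast (algebraMap E (FiniteAdeleRing (𝓞 E) E)), ← map_mul, mul_inv_cancel₀ hnE,
        map_one]
    rw [hb, mul_sub, mul_left_comm, this, mul_one, map_mul, map_natCast]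
  have hn' : (n : FiniteAdeleRing (𝓞 E) E) ∈ intFin E := by
    have := mem_intFin_algebraMap (E := E) (n : 𝓞 E)
    rwa [show (((n : 𝓞 E) : 𝓞 E) : E) = (n : E) from map_natCast _ n, map_natCast] at this
  have h2 : algebraMap E (FiniteAdeleRing (𝓞 E) E) ((n : E) * e) ∈ intFin E := by
    rw [← sub_sub_cancel a (algebraMap E _ _), h1]
    exact mem_intFin_sub ha (mem_intFin_mul hn' he)
  obtain ⟨r, hr⟩ := HeightOneSpectrum.mem_integers_of_valuation_le_one E ((n : E) * e)
    fun v => (valued_algebraMap v _).symm.trans_le (h2 v)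
  exact ⟨r, b, he, by rw [← h1, ← hr]⟩

/-- One has `x⁻¹ x' = 1 + (n / det x) · adj(x) · B`, and `n` is divisible by `det x` at every place.
-/
theorem inv_mul_mem_intFin {x x' : GL (Fin 2) (FiniteAdeleRing (𝓞 E) E)} {n : FiniteAdeleRing (𝓞 E) E}
    (hx : ∀ i j, x i j ∈ intFin E)
    (hdet : ∀ v : HeightOneSpectrum (𝓞 E), Valued.v (n v) ≤
      Valued.v (((Matrix.GeneralLinearGroup.det x : (FiniteAdeleRing (𝓞 E) E)ˣ) :
        FiniteAdeleRing (𝓞 E) E) v))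
    {B : Matrix (Fin 2) (Fin 2) (FiniteAdeleRing (𝓞 E) E)} (hB : ∀ i j, B i j ∈ intFin E)
    (h : (x' : Matrix (Fin 2) (Fin 2) (FiniteAdeleRing (𝓞 E) E)) = x + n • B) (i j : Fin 2) :
    (x⁻¹ * x') i j ∈ intFin E := by
  have hd : n * (((Matrix.GeneralLinearGroup.det x)⁻¹ : (FiniteAdeleRing (𝓞 E) E)ˣ) :
      FiniteAdeleRing (𝓞 E) E) ∈ intFin E := by
    intro v
    have h1 := mul_le_mul_left (hdet v) (Valued.v ((((Matrix.GeneralLinearGroup.det x)⁻¹ :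
      (FiniteAdeleRing (𝓞 E) E)ˣ) : FiniteAdeleRing (𝓞 E) E) v))
    rw [← valued_mul, ← valued_mul, Units.mul_inv] at h1
    exact h1.trans (one_mem_intFin v)
  have hinv : ((x⁻¹ : GL (Fin 2) (FiniteAdeleRing (𝓞 E) E)) : Matrix _ _ _)
      = (((Matrix.GeneralLinearGroup.det x)⁻¹ : (FiniteAdeleRing (𝓞 E) E)ˣ) :
      FiniteAdeleRing (𝓞 E) E) • (x : Matrix (Fin 2) (Fin 2) (FiniteAdeleRing (𝓞 E) E)).adjugate := by
    rw [Matrix.coe_units_inv, Matrix.inv_def, ← Ring.inverse_unit (Matrix.GeneralLinearGroup.det x)]; rfl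
  have e : ((x⁻¹ * x' : GL (Fin 2) (FiniteAdeleRing (𝓞 E) E)) : Matrix (Fin 2) (Fin 2) _)
      = 1 + (n * (((Matrix.GeneralLinearGroup.det x)⁻¹ : (FiniteAdeleRing (𝓞 E) E)ˣ) :
      FiniteAdeleRing (𝓞 E) E)) • ((x : Matrix (Fin 2) (Fin 2) (FiniteAdeleRing (𝓞 E) E)).adjugate * B) := by
    rw [Units.val_mul, h, Matrix.mul_add, ← Units.val_mul, inv_mul_cancel, Units.val_one, hinv,
      Matrix.mul_smul, Matrix.smul_mul, smul_smul]
  have hadj : ∀ i j, (x : Matrix (Fin 2) (Fin 2) (FiniteAdeleRing (𝓞 E) E)).adjugate i j ∈ intFin E := by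
    intro i j
    rw [Matrix.adjugate_fin_two]
    fin_cases i <;> fin_cases j
    exacts [hx 1 1, mem_intFin_neg (hx 0 1), mem_intFin_neg (hx 1 0), hx 0 0]
  rw [e, Matrix.add_apply, Matrix.smul_apply, smul_eq_mul, Matrix.mul_apply, Fin.sum_univ_two]
  refine mem_intFin_add ?_ (mem_intFin_mul hd (mem_intFin_add (mem_intFin_mul (hadj _ _) (hB _ _))
    (mem_intFin_mul (hadj _ _) (hB _ _))))
  rw [Matrix.one_apply]
  split_ifs
  exacts [one_mem_intFin, zero_mem_intFin]

variable (E) in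
/-- Elements with bounded components at infinity and finite part in `K^∞`. -/
def archBox (R : ℝ) : Set (GAArchOne E) :=
  {g | toFin (g : GA E) ∈ KFin E ∧ ∀ w i j, ‖matAt (g : GA E) w i j‖ ≤ R}

theorem isCompact_archBox (R : ℝ) : IsCompact (archBox E R) := by
  have h3 : IsClosed {g : GA E | ∀ w i j, ‖matAt g w i j‖ ≤ R} := by
    simp only [Set.ofPred_forall]
    exact isClosed_iInter fun w => isClosed_iInter fun i => isClosed_iInter fun j =>
      isClosed_le (continuous_matAt_apply w i j).norm continuous_const
  have h1 : IsCompact {g : GA E | g ∈ GAArchOne E ∧ toFin g ∈ KFin E ∧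
      ∀ w i j, ‖matAt g w i j‖ ≤ R} := by
    refine isCompact_of_matrix_mem (isClosed_GAArchOne.inter
      ((isClosed_KFin.preimage continuous_toFin).inter h3))
      (isCompact_matBall R) (isCompact_matBall R) ?_
    rintro g ⟨hg, hf, hi⟩
    refine ⟨fun i j => ⟨fun w => (norm_apply_eq w (toInf g) i j).symm.trans_le (hi w i j),
      fun v => (hf v i j).1⟩, fun i j => ⟨fun w => ?_, fun v => (hf v i j).2⟩⟩
    obtain ⟨i', j', h⟩ := exists_norm_matAt_inv ⟨g, hg⟩ w i j
    exact (norm_apply_eq w (toInf g⁻¹) i j).symm.trans_le (h.trans_le (hi w i' j'))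
  refine ((isClosed_GAArchOne.isClosedEmbedding_subtypeVal).isCompact_preimage h1).of_isClosed_subset
    ?_ fun g hg => ⟨g.2, hg⟩
  exact ((isClosed_KFin.preimage continuous_toFin).inter h3).preimage continuous_subtype_val

/-- Each nonempty fibre of `idx` in `S` lies in a left translate of `C` by one of its points, and
translates of `C` have the same measure. -/
theorem measure_le_card_mul {G : Type*} [Group G] [MeasurableSpace G] [MeasurableMul G] (ν : Measure G)
    [ν.IsMulLeftInvariant] {I : Type*} (idx : G → I) (t : Finset I) {S C : Set G}
    (ht : ∀ x ∈ S, idx x ∈ t) (h : ∀ x ∈ S, ∀ x' ∈ S, idx x = idx x' → x⁻¹ * x' ∈ C) :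
    ν S ≤ t.card * ν C := by
  calc ν S ≤ ν (⋃ i ∈ t, S ∩ idx ⁻¹' {i}) := measure_mono fun x hx =>
        Set.mem_iUnion₂.2 ⟨idx x, ht x hx, hx, rfl⟩
    _ ≤ ∑ i ∈ t, ν (S ∩ idx ⁻¹' {i}) := measure_biUnion_finset_le _ _
    _ ≤ ∑ i ∈ t, ν C := Finset.sum_le_sum fun i _ => ?_
    _ = t.card * ν C := by rw [Finset.sum_const, nsmul_eq_mul]
  rcases (S ∩ idx ⁻¹' {i}).eq_empty_or_nonempty with h0 | ⟨x, hx, hxi⟩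
  · rw [h0, measure_empty]; exact zero_le
  · rw [← measure_preimage_mul ν x⁻¹ C]
    exact measure_mono fun y hy => h x hx y hy.1 (hxi.trans hy.2.symm)

theorem of_heckeIndicator_ne_zero {m : FiniteAdeleRing (𝓞 E) E}
    {x : GL (Fin 2) (FiniteAdeleRing (𝓞 E) E)} (h : heckeIndicator m x ≠ 0) :
    (∀ i j, x i j ∈ intFin E) ∧ ∀ v : HeightOneSpectrum (𝓞 E),
      Valued.v (((Matrix.GeneralLinearGroup.det x : (FiniteAdeleRing (𝓞 E) E)ˣ) :
        FiniteAdeleRing (𝓞 E) E) v) = Valued.v (m v) := by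
  classical
  unfold heckeIndicator at h
  have := (ite_ne_right_iff.1 h).1
  exact ⟨fun i j v => this.1 v i j, this.2⟩

open scoped Classical in
/-- A representative in `𝓞 E` of an integral finite adele modulo `n`. -/
def residue (n : ℕ) (a : FiniteAdeleRing (𝓞 E) E) : 𝓞 E ⧸ Ideal.span {(n : 𝓞 E)} :=
  if h : ∃ r : 𝓞 E, ∃ b ∈ intFin E,
      a - algebraMap E (FiniteAdeleRing (𝓞 E) E) (r : E) = (n : FiniteAdeleRing (𝓞 E) E) * b
  then Ideal.Quotient.mk _ h.choose else 0

theorem exists_sub_eq_of_residue_eq {n : ℕ} (hn : n ≠ 0) {a a' : FiniteAdeleRing (𝓞 E) E}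
    (ha : a ∈ intFin E) (ha' : a' ∈ intFin E) (h : residue n a = residue n a') :
    ∃ b ∈ intFin E, a' = a + (n : FiniteAdeleRing (𝓞 E) E) * b := by
  have h1 := exists_int_sub_eq_natCast_mul hn ha
  have h2 := exists_int_sub_eq_natCast_mul hn ha'
  rw [residue, residue, dif_pos h1, dif_pos h2, Ideal.Quotient.eq, Ideal.mem_span_singleton] at h
  obtain ⟨s, hs⟩ := h
  obtain ⟨b, hb, e⟩ := h1.choose_spec
  obtain ⟨b', hb', e'⟩ := h2.choose_spec
  refine ⟨b' - b - algebraMap E _ (s : E), mem_intFin_sub (mem_intFin_sub hb' hb)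
    (mem_intFin_algebraMap s), ?_⟩
  have hs' := congrArg (fun q : 𝓞 E => algebraMap E (FiniteAdeleRing (𝓞 E) E) (q : E)) hs
  simp only [map_sub, map_mul, map_natCast] at hs'
  linear_combination e' - e - hs'

theorem natCard_quotient_span (n : ℕ) :
    Nat.card (𝓞 E ⧸ Ideal.span {(n : 𝓞 E)}) = n ^ Module.finrank ℤ (𝓞 E) := by
  rw [← Ideal.absNorm_span_natCast, Ideal.absNorm_apply, Submodule.cardQuot_apply]

/-- At the finite places congruence modulo `n`, a multiple of both determinants, makes `x⁻¹ x'` and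
its inverse integral. At infinity `x⁻¹ x' = 1 + x⁻¹ (x' - x)`, with entries of `x⁻¹` at most `R` and
differences at most `2 / R`, so the entries are at most `1 + 2 + 2 = 5`. -/
theorem inv_mul_mem_archBox {n R : ℕ} (hn : n ≠ 0) (hR : 1 ≤ R) {m : FiniteAdeleRing (𝓞 E) E}
    (hm : ∀ v : HeightOneSpectrum (𝓞 E), Valued.v ((n : FiniteAdeleRing (𝓞 E) E) v) ≤ Valued.v (m v))
    {x x' : GAArchOne E} (hx : heckeIndicator m (toFin (x : GA E)) ≠ 0)
    (hx' : heckeIndicator m (toFin (x' : GA E)) ≠ 0)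
    (hres : ∀ i j, residue n (toFin (x : GA E) i j) = residue n (toFin (x' : GA E) i j))
    (hxR : ∀ w i j, ‖matAt (x : GA E) w i j‖ ≤ R)
    (hd : ∀ w i j, ‖matAt (x' : GA E) w i j - matAt (x : GA E) w i j‖ ≤ 2 / R) :
    x⁻¹ * x' ∈ archBox E 5 := by
  have hR0 : (0 : ℝ) < R := by exact_mod_cast hR
  obtain ⟨h1, h2⟩ := of_heckeIndicator_ne_zero hx
  obtain ⟨h1', h2'⟩ := of_heckeIndicator_ne_zero hx'
  refine ⟨?_, fun w i j => ?_⟩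
  · choose B hB hB' using fun i j => exists_sub_eq_of_residue_eq hn (h1 i j) (h1' i j) (hres i j)
    choose B' hB2 hB2' using fun i j =>
      exists_sub_eq_of_residue_eq hn (h1' i j) (h1 i j) (hres i j).symm
    have e : toFin ((x⁻¹ * x' : GAArchOne E) : GA E) = (toFin (x : GA E))⁻¹ * toFin (x' : GA E) := by
      rw [Subgroup.coe_mul, map_mul, Subgroup.coe_inv, map_inv]
    rw [e, mem_KFin_iff, mul_inv_rev, inv_inv]
    refine fun i j => ⟨inv_mul_mem_intFin (n := (n : FiniteAdeleRing (𝓞 E) E)) h1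
      (fun v => (hm v).trans_eq (h2 v).symm) (B := Matrix.of B) hB ?_ i j,
      inv_mul_mem_intFin (n := (n : FiniteAdeleRing (𝓞 E) E)) h1'
      (fun v => (hm v).trans_eq (h2' v).symm) (B := Matrix.of B') hB2 ?_ i j⟩
    · ext1 i j; exact hB' i j
    · ext1 i j; exact hB2' i j
  · have e : matAt ((x⁻¹ * x' : GAArchOne E) : GA E) w
        = 1 + matAt ((x : GA E)⁻¹) w * (matAt (x' : GA E) w - matAt (x : GA E) w) := by
      have h0 : matAt ((x : GA E)⁻¹) w * matAt (x : GA E) w = 1 := by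
        rw [← matAt_mul, inv_mul_cancel, matAt, map_one, map_one]; rfl
      rw [Matrix.mul_sub, h0, add_sub_cancel, Subgroup.coe_mul, matAt_mul, Subgroup.coe_inv]
    have hinv : ∀ i j, ‖matAt ((x : GA E)⁻¹) w i j‖ ≤ R := fun i j => by
      obtain ⟨i', j', h⟩ := exists_norm_matAt_inv x w i j
      exact h.trans_le (hxR w i' j')
    have hprod : ∀ k, ‖matAt ((x : GA E)⁻¹) w i k *
        (matAt (x' : GA E) w k j - matAt (x : GA E) w k j)‖ ≤ 2 := fun k => by
      rw [norm_mul]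
      calc _ ≤ (R : ℝ) * (2 / R) := mul_le_mul (hinv i k) (hd w k j) (norm_nonneg _) hR0.le
        _ = 2 := by field_simp
    have hone : ‖(1 : Matrix (Fin 2) (Fin 2) ℂ) i j‖ ≤ 1 := by
      rw [Matrix.one_apply]; split_ifs <;> simp
    rw [e, Matrix.add_apply, Matrix.mul_apply, Fin.sum_univ_two]
    refine (norm_add_le _ _).trans ?_
    have := norm_add_le (matAt ((x : GA E)⁻¹) w i 0 *
        (matAt (x' : GA E) w - matAt (x : GA E) w) 0 j) (matAt ((x : GA E)⁻¹) w i 1 *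
        (matAt (x' : GA E) w - matAt (x : GA E) w) 1 j)
    linarith [hprod 0, hprod 1, Matrix.sub_apply (matAt (x' : GA E) w) (matAt (x : GA E) w) 0 j,
      show ‖matAt ((x : GA E)⁻¹) w i 0 * (matAt (x' : GA E) w - matAt (x : GA E) w) 0 j‖ ≤ 2 from hprod 0,
      show ‖matAt ((x : GA E)⁻¹) w i 1 * (matAt (x' : GA E) w - matAt (x : GA E) w) 1 j‖ ≤ 2 from hprod 1]

theorem abs_sub_le_of_floor_eq {a b R : ℝ} (hR : 0 < R) (h : ⌊a * R⌋ = ⌊b * R⌋) :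
    |b - a| ≤ 1 / R := by
  have := (Int.abs_sub_lt_one_of_floor_eq_floor h).le
  rw [← sub_mul, abs_mul, abs_of_pos hR] at this
  rw [abs_sub_comm, le_div_iff₀ hR]
  exact this

theorem floor_mem_Icc {a : ℝ} {R : ℕ} (h : |a| ≤ R) :
    ⌊a * R⌋ ∈ Finset.Icc (-(R : ℤ) ^ 2) ((R : ℤ) ^ 2) := by
  obtain ⟨h1, h2⟩ := abs_le.1 h
  have hR : (0 : ℝ) ≤ R := Nat.cast_nonneg R
  rw [Finset.mem_Icc]
  constructor
  · rw [Int.le_floor]; push_cast; nlinarith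
  · have : (⌊a * R⌋ : ℝ) ≤ (R : ℝ) ^ 2 := (Int.floor_le _).trans (by nlinarith)
    exact_mod_cast this

/-- Integral matrices with given determinant at the finite places and bounded entries at infinity
occupy a bounded number of cells. -/
theorem measure_hecke_le (ν : Measure (GAArchOne E)) [ν.IsHaarMeasure] {n R : ℕ} (hn : n ≠ 0)
    (hR : 1 ≤ R) {m : FiniteAdeleRing (𝓞 E) E}
    (hm : ∀ v : HeightOneSpectrum (𝓞 E), Valued.v ((n : FiniteAdeleRing (𝓞 E) E) v) ≤ Valued.v (m v)) :
    ν {x : GAArchOne E | heckeIndicator m (toFin (x : GA E)) ≠ 0 ∧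
      ∀ w i j, ‖matAt (x : GA E) w i j‖ ≤ R} ≤
      (n ^ (4 * Module.finrank ℤ (𝓞 E)) * (2 * R ^ 2 + 1) ^ (8 * Fintype.card (InfinitePlace E)) : ℕ) *
        ν (archBox E 5) := by
  classical
  have hR0 : (0 : ℝ) < R := by exact_mod_cast hR
  have hfin : Finite (𝓞 E ⧸ Ideal.span {(n : 𝓞 E)}) := by
    refine Nat.finite_of_card_ne_zero ?_
    rw [natCard_quotient_span]
    exact pow_ne_zero _ hn
  have := Fintype.ofFinite (𝓞 E ⧸ Ideal.span {(n : 𝓞 E)})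
  -- A cell records the four finite entries modulo `n` and, at each infinite place, the eight real
  -- and imaginary parts rounded to a grid of mesh `1 / R`. Each rounded value lies among `2 R ^ 2 +
  -- 1` integers.
  let idx : GAArchOne E → (Fin 2 × Fin 2 → 𝓞 E ⧸ Ideal.span {(n : 𝓞 E)}) ×
      ((InfinitePlace E × Fin 2 × Fin 2) × Bool → ℤ) := fun x =>
    (fun p => residue n (toFin (x : GA E) p.1 p.2),
      fun p => ⌊(if p.2 then (matAt (x : GA E) p.1.1 p.1.2.1 p.1.2.2).re
        else (matAt (x : GA E) p.1.1 p.1.2.1 p.1.2.2).im) * (R : ℝ)⌋)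
  let t : Finset ((Fin 2 × Fin 2 → 𝓞 E ⧸ Ideal.span {(n : 𝓞 E)}) ×
      ((InfinitePlace E × Fin 2 × Fin 2) × Bool → ℤ)) :=
    Finset.univ ×ˢ Fintype.piFinset fun _ => Finset.Icc (-(R : ℤ) ^ 2) ((R : ℤ) ^ 2)
  have ht : t.card = n ^ (4 * Module.finrank ℤ (𝓞 E)) *
      (2 * R ^ 2 + 1) ^ (8 * Fintype.card (InfinitePlace E)) := by
    rw [Finset.card_product, Finset.card_univ, Fintype.card_fun, ← Nat.card_eq_fintype_card,
      natCard_quotient_span, Fintype.card_piFinset, Finset.prod_const, Finset.card_univ, Int.card_Icc, ← pow_mul]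
    simp only [Fintype.card_prod, Fintype.card_fin, Fintype.card_bool]
    congr 2
    · ring
    · have : ((R : ℤ) ^ 2 + 1 - -(R : ℤ) ^ 2) = ((2 * R ^ 2 + 1 : ℕ) : ℤ) := by push_cast; ring
      rw [this, Int.toNat_natCast]
    · ring
  rw [← ht]
  refine measure_le_card_mul ν idx t (fun x hx => ?_) fun x hx x' hx' h => ?_
  · refine Finset.mem_product.2 ⟨Finset.mem_univ _, Fintype.mem_piFinset.2 fun p => floor_mem_Icc ?_⟩
    split_ifs
    · exact (Complex.abs_re_le_norm _).trans (hx.2 _ _ _)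
    · exact (Complex.abs_im_le_norm _).trans (hx.2 _ _ _)
  · have hA := congrArg Prod.fst h
    have hB := congrArg Prod.snd h
    refine inv_mul_mem_archBox hn hR hm hx.1 hx'.1 (fun i j => congrFun hA (i, j)) hx.2 fun w i j => ?_
    have hre : ⌊(matAt (x : GA E) w i j).re * (R : ℝ)⌋ = ⌊(matAt (x' : GA E) w i j).re * (R : ℝ)⌋ :=
      congrFun hB ((w, i, j), true)
    have him : ⌊(matAt (x : GA E) w i j).im * (R : ℝ)⌋ = ⌊(matAt (x' : GA E) w i j).im * (R : ℝ)⌋ :=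
      congrFun hB ((w, i, j), false)
    refine (Complex.norm_le_abs_re_add_abs_im _).trans ?_
    rw [Complex.sub_re, Complex.sub_im]
    have := abs_sub_le_of_floor_eq hR0 hre
    have := abs_sub_le_of_floor_eq hR0 him
    rw [show (2 : ℝ) / R = 1 / R + 1 / R by ring]
    linarith

theorem continuous_heckeIndicator_toFin (m : FiniteAdeleRing (𝓞 E) E) :
    Continuous fun x : GA E => heckeIndicator m (toFin x) :=
  continuous_of_forall_mul_KFin continuous_toFin fun x y hxy => by
    have := heckeIndicator_mul_right m (toFin x) hxy
    rwa [mul_inv_cancel_left] at this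

theorem heckeIndicator_le_one (m : FiniteAdeleRing (𝓞 E) E)
    (x : GL (Fin 2) (FiniteAdeleRing (𝓞 E) E)) : heckeIndicator m x ≤ 1 := by
  unfold heckeIndicator; split_ifs <;> norm_num

/-- Cut into layers where `size x` lies in `[k + 1, k + 2)`. By `measure_hecke_le` with `R = k + 2`,
and `2 (k + 2) ^ 2 + 1 ≤ 9 (k + 1) ^ 2`, the volume of a layer grows at most like `n ^ (4 d) (k + 1)
^ (16 r)`. The exponent `16 r + 2` leaves the convergent series of `(k + 1) ^ (-2)`, uniformly in
`m`. -/
theorem exists_lintegral_hecke_le (ν : Measure (GAArchOne E)) [ν.IsHaarMeasure] :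
    ∃ C : ENNReal, C ≠ ⊤ ∧ ∀ (n : ℕ) (_ : n ≠ 0) (m : FiniteAdeleRing (𝓞 E) E)
      (_ : ∀ v : HeightOneSpectrum (𝓞 E), Valued.v ((n : FiniteAdeleRing (𝓞 E) E) v) ≤ Valued.v (m v)),
      ∫⁻ x : GAArchOne E, ENNReal.ofReal (heckeIndicator m (toFin (x : GA E)) *
        ((size (x : GA E))⁻¹) ^ (16 * Fintype.card (InfinitePlace E) + 2)) ∂ν
      ≤ C * (n : ENNReal) ^ (4 * Module.finrank ℤ (𝓞 E)) := by
  set r := Fintype.card (InfinitePlace E)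
  set d := Module.finrank ℤ (𝓞 E)
  have hsum : Summable fun k : ℕ => (((k : ℝ) + 1) ^ 2)⁻¹ := by
    have := (summable_nat_add_iff 1).2 (Real.summable_nat_pow_inv (p := 2).2 one_lt_two)
    exact_mod_cast this
  refine ⟨ENNReal.ofReal (9 ^ (8 * r)) * ν (archBox E 5) *
    ∑' k : ℕ, ENNReal.ofReal (((k : ℝ) + 1) ^ 2)⁻¹, ?_, fun n hn m hm => ?_⟩
  · refine ENNReal.mul_ne_top (ENNReal.mul_ne_top ENNReal.ofReal_ne_top
      (isCompact_archBox 5).measure_lt_top.ne) hsum.tsum_ofReal_ne_top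
  let S : ℕ → Set (GAArchOne E) := fun k =>
    {x | heckeIndicator m (toFin (x : GA E)) ≠ 0 ∧ size (x : GA E) ≤ (k + 2 : ℕ)}
  have hSm : ∀ k, MeasurableSet (S k) := fun k =>
    (((continuous_heckeIndicator_toFin m).comp continuous_subtype_val).measurable
      (MeasurableSet.singleton (0 : ℝ)).compl).inter
    (measurableSet_le (continuous_size.comp continuous_subtype_val).measurable measurable_const)
  have hpt : ∀ x : GAArchOne E, ENNReal.ofReal (heckeIndicator m (toFin (x : GA E)) *
      ((size (x : GA E))⁻¹) ^ (16 * r + 2)) ≤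
      ∑' k : ℕ, (S k).indicator (fun _ => ENNReal.ofReal ((((k : ℝ) + 1)⁻¹) ^ (16 * r + 2))) x := by
    intro x
    by_cases hx : heckeIndicator m (toFin (x : GA E)) = 0
    · rw [hx, zero_mul, ENNReal.ofReal_zero]; exact zero_le
    have h1 := one_le_size x
    obtain ⟨k, hk⟩ : ∃ k : ℕ, ⌊size (x : GA E)⌋₊ = k + 1 :=
      Nat.exists_eq_succ_of_ne_zero (Nat.floor_pos.2 h1).ne'
    have h2 : ((k : ℝ) + 1) ≤ size (x : GA E) := by
      have := Nat.floor_le (zero_le_one.trans h1)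
      rw [hk] at this; exact_mod_cast this
    have h3 : size (x : GA E) ≤ (k + 2 : ℕ) := by
      have := (Nat.lt_floor_add_one (size (x : GA E))).le
      rw [hk] at this; push_cast at this ⊢; linarith
    refine le_trans ?_ (ENNReal.le_tsum k)
    rw [Set.indicator_of_mem (show x ∈ S k from ⟨hx, h3⟩)]
    refine ENNReal.ofReal_le_ofReal ?_
    have hk0 : (0 : ℝ) < (k : ℝ) + 1 := by positivity
    calc _ ≤ 1 * ((size (x : GA E))⁻¹) ^ (16 * r + 2) := by
          gcongr
          exact heckeIndicator_le_one _ _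
      _ ≤ _ := by rw [one_mul]; gcongr
  have hν : ∀ k, ν (S k) ≤ (n ^ (4 * d) * (2 * (k + 2) ^ 2 + 1) ^ (8 * r) : ℕ) * ν (archBox E 5) := by
    intro k
    refine (measure_mono ?_).trans (measure_hecke_le ν hn (R := k + 2) (by omega) hm)
    rintro x ⟨h1, h2⟩
    refine ⟨h1, fun w i j => ?_⟩
    have h3 := ((sq_norm_matAt_le (x : GA E) w i j).trans (sizeAt_le_size x w)).trans h2
    refine abs_le_of_sq_le_sq' ?_ (by positivity) |>.2
    refine h3.trans ?_
    have : (1 : ℝ) ≤ (k + 2 : ℕ) := by push_cast; linarith [(Nat.cast_nonneg k : (0 : ℝ) ≤ k)]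
    nlinarith
  calc _ ≤ ∫⁻ x : GAArchOne E, ∑' k : ℕ, (S k).indicator
          (fun _ => ENNReal.ofReal ((((k : ℝ) + 1)⁻¹) ^ (16 * r + 2))) x ∂ν := lintegral_mono hpt
    _ = ∑' k : ℕ, ENNReal.ofReal ((((k : ℝ) + 1)⁻¹) ^ (16 * r + 2)) * ν (S k) := by
        rw [lintegral_tsum fun k => (measurable_const.indicator (hSm k)).aemeasurable]
        exact tsum_congr fun k => lintegral_indicator_const (hSm k) _
    _ ≤ ∑' k : ℕ, (ENNReal.ofReal (9 ^ (8 * r)) * ν (archBox E 5) * (n : ENNReal) ^ (4 * d)) *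
          ENNReal.ofReal (((k : ℝ) + 1) ^ 2)⁻¹ := by
        refine ENNReal.tsum_le_tsum fun k => ?_
        refine (mul_le_mul_right (hν k) _).trans ?_
        have h1 : ENNReal.ofReal ((((k : ℝ) + 1)⁻¹) ^ (16 * r + 2)) *
            ((2 * (k + 2) ^ 2 + 1) ^ (8 * r) : ℕ) ≤
            ENNReal.ofReal (9 ^ (8 * r)) * ENNReal.ofReal (((k : ℝ) + 1) ^ 2)⁻¹ := by
          rw [← ENNReal.ofReal_natCast, ← ENNReal.ofReal_mul (by positivity),
            ← ENNReal.ofReal_mul (by positivity)]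
          refine ENNReal.ofReal_le_ofReal ?_
          have hk0 : (0 : ℝ) < (k : ℝ) + 1 := by positivity
          have hk : (0 : ℝ) ≤ k := Nat.cast_nonneg k
          push_cast
          calc _ ≤ (((k : ℝ) + 1)⁻¹) ^ (16 * r + 2) * (9 * ((k : ℝ) + 1) ^ 2) ^ (8 * r) := by
                gcongr
                nlinarith
            _ = _ := by
                rw [mul_pow, ← pow_mul, show 2 * (8 * r) = 16 * r by ring, pow_add, inv_pow, inv_pow]
                field_simp
        rw [Nat.cast_mul, Nat.cast_pow]
        calc _ = (ENNReal.ofReal ((((k : ℝ) + 1)⁻¹) ^ (16 * r + 2)) *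
            ((2 * (k + 2) ^ 2 + 1) ^ (8 * r) : ℕ)) * ((n : ENNReal) ^ (4 * d) * ν (archBox E 5)) := by
              ring
          _ ≤ _ := mul_le_mul_left h1 _
          _ = _ := by ring
    _ = _ := by rw [ENNReal.tsum_mul_left]; ring

/-! ### Moments of the density -/

theorem exp_neg_le_factorial_div_pow {y : ℝ} (hy : 0 < y) (L : ℕ) :
    Real.exp (-y) ≤ (L.factorial : ℝ) / y ^ L := by
  have h := Real.pow_div_factorial_le_exp y hy.le L
  have hf : (0 : ℝ) < L.factorial := by exact_mod_cast L.factorial_pos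
  rw [Real.exp_neg, le_div_iff₀ (pow_pos hy L), ← div_eq_inv_mul, div_le_iff₀ (Real.exp_pos y)]
  rwa [div_le_iff₀ hf, mul_comm] at h

/-- Since `X ≥ 2`, one has `m X ≥ m + m X / 2`: the first term keeps `exp(-m)` and the second is
converted into inverse powers of `m X`. The exponent `c` is the local degree, and a surplus power of
`exp(-m)` or `X⁻¹` may be dropped as both are at most one. -/
theorem pow_mul_exp_le {m X : ℝ} (hm : 0 < m) (hX : 2 ≤ X) {c : ℕ} (hc : 1 ≤ c) (hc2 : c ≤ 2) (L : ℕ) :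
    m ^ c * Real.exp (-(c : ℝ) * (m * X)) ≤
      ((L.factorial : ℝ) * 2 ^ L) ^ 2 * (m ^ c * ((m ^ c)⁻¹) ^ L * Real.exp (-m) * (X⁻¹) ^ L) := by
  have hX0 : 0 < X := by linarith
  have hK : (1 : ℝ) ≤ (L.factorial : ℝ) * 2 ^ L :=
    one_le_mul_of_one_le_of_one_le (by exact_mod_cast L.factorial_pos) (one_le_pow₀ one_le_two)
  have h1 : Real.exp (-(m * X)) ≤ ((L.factorial : ℝ) * 2 ^ L) * (Real.exp (-m) * ((m⁻¹) ^ L * (X⁻¹) ^ L)) := by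
    calc Real.exp (-(m * X)) ≤ Real.exp (-m) * Real.exp (-(m * X / 2)) := by
          rw [← Real.exp_add, Real.exp_le_exp]; nlinarith
      _ ≤ Real.exp (-m) * ((L.factorial : ℝ) / (m * X / 2) ^ L) := by
          gcongr; exact exp_neg_le_factorial_div_pow (by positivity) L
      _ = _ := by rw [div_pow, mul_pow, inv_pow, inv_pow]; field_simp
  have h2 : Real.exp (-(c : ℝ) * (m * X)) = Real.exp (-(m * X)) ^ c := by
    rw [← Real.exp_nat_mul]; ring_nf
  calc m ^ c * Real.exp (-(c : ℝ) * (m * X))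
      ≤ m ^ c * (((L.factorial : ℝ) * 2 ^ L) * (Real.exp (-m) * ((m⁻¹) ^ L * (X⁻¹) ^ L))) ^ c := by
        rw [h2]; gcongr
    _ = ((L.factorial : ℝ) * 2 ^ L) ^ c * (m ^ c * ((m ^ c)⁻¹) ^ L * Real.exp (-m) ^ c * ((X⁻¹) ^ L) ^ c) := by
        rw [mul_pow, mul_pow, mul_pow, ← inv_pow, ← pow_mul, ← pow_mul m⁻¹ c L, mul_comm L c]; ring
    _ ≤ _ := by
        have ha : Real.exp (-m) ^ c ≤ Real.exp (-m) :=
          pow_le_of_le_one (Real.exp_pos _).le (Real.exp_le_one_iff.2 (by linarith)) (by omega)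
        have hb : ((X⁻¹) ^ L) ^ c ≤ (X⁻¹) ^ L :=
          pow_le_of_le_one (by positivity) (pow_le_one₀ (by positivity)
            (inv_le_one_of_one_le₀ (by linarith))) (by omega)
        gcongr

/-- The product of the normalized absolute values of the Iwasawa coordinate `m` at infinity. -/
def mProd (h : GA E) : ℝ := ∏ w : InfinitePlace E, mAbs h w ^ w.mult

theorem mProd_pos (h : GA E) : 0 < mProd h := Finset.prod_pos fun w _ => pow_pos (mAbs_pos h w) _

theorem mult_le_two (w : InfinitePlace E) : w.mult ≤ 2 := by
  unfold InfinitePlace.mult; split_ifs <;> norm_num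

theorem norm_wWeight_le_size (δ : (AdeleRing (𝓞 E) E)ˣ) (L : ℕ) (h : GA E) (x : GAArchOne E) :
    ‖wWeight δ h x‖ ≤ (((L.factorial : ℝ) * 2 ^ L) ^ 2) ^ Fintype.card (InfinitePlace E) *
      (mProd h * ((mProd h)⁻¹) ^ L * Real.exp (-∑ w : InfinitePlace E, mAbs h w)) *
      (heckeIndicator ((finCoord δ h).m : AdeleRing (𝓞 E) E).2 (toFin x) * ((size (x : GA E))⁻¹) ^ L) := by
  refine (norm_wWeight_le δ h x).trans ?_
  have h1 : ∏ w : InfinitePlace E, mAbs h w ^ w.mult *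
      Real.exp (-(w.mult : ℝ) * (mAbs h w * sizeAt (x : GA E) w)) ≤
      ∏ w : InfinitePlace E, ((L.factorial : ℝ) * 2 ^ L) ^ 2 * (mAbs h w ^ w.mult *
        ((mAbs h w ^ w.mult)⁻¹) ^ L * Real.exp (-mAbs h w) * ((sizeAt (x : GA E) w)⁻¹) ^ L) :=
    Finset.prod_le_prod (fun w _ => mul_nonneg (pow_nonneg (mAbs_pos h w).le _) (Real.exp_pos _).le)
      fun w _ => pow_mul_exp_le (mAbs_pos h w) (two_le_sizeAt x w) w.mult_pos (mult_le_two w) L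
  refine (mul_le_mul_of_nonneg_right h1 (heckeIndicator_nonneg _ _)).trans_eq ?_
  simp only [Finset.prod_mul_distrib, Finset.prod_const, Finset.card_univ, Finset.prod_pow,
    Finset.prod_inv_distrib, ← Real.exp_sum, Finset.sum_neg_distrib, mProd, size]
  ring

theorem wWeight_eq_zero {δ : (AdeleRing (𝓞 E) E)ˣ} {h : GA E}
    (hm : ((finCoord δ h).m : AdeleRing (𝓞 E) E).2 ∉ intFin E) (x : GA E) : wWeight δ h x = 0 := by
  classical
  unfold wWeight wCoeff
  rw [if_neg (show ¬∀ v : HeightOneSpectrum (𝓞 E), Valued.v (((finCoord δ h).m : AdeleRing (𝓞 E) E).2 v) ≤ 1 from hm),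
    Complex.ofReal_zero, mul_zero, zero_mul]

/-- The Gaussian decay is used to the order `N + 16 r + 2`: `N` pays for the moment and the rest is
what `exists_lintegral_hecke_le` requires. The price is a negative power of `mProd h`, harmless
where `mProd h` is bounded below. -/
theorem exists_lintegral_wWeight_le (δ : (AdeleRing (𝓞 E) E)ˣ) (ν : Measure (GAArchOne E))
    [ν.IsHaarMeasure] (N : ℕ) : ∃ L : ℕ, ∃ C : ENNReal, C ≠ ⊤ ∧ ∀ (h : GA E) (n : ℕ) (_ : n ≠ 0)
      (_ : ∀ v : HeightOneSpectrum (𝓞 E), Valued.v ((n : FiniteAdeleRing (𝓞 E) E) v) ≤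
        Valued.v (((finCoord δ h).m : AdeleRing (𝓞 E) E).2 v)),
      ∫⁻ x : GAArchOne E, ‖wWeight δ h x‖ₑ * ENNReal.ofReal (size (x : GA E) ^ N) ∂ν
      ≤ C * ENNReal.ofReal (mProd h * ((mProd h)⁻¹) ^ (L + 1) *
        Real.exp (-∑ w : InfinitePlace E, mAbs h w)) * (n : ENNReal) ^ (4 * Module.finrank ℤ (𝓞 E)) := by
  obtain ⟨C, hC, H⟩ := exists_lintegral_hecke_le ν
  set r := Fintype.card (InfinitePlace E)
  set L := N + (16 * r + 1) with hL
  set K : ℝ := ((((L + 1).factorial : ℝ) * 2 ^ (L + 1)) ^ 2) ^ r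
  refine ⟨L, ENNReal.ofReal K * C, ENNReal.mul_ne_top ENNReal.ofReal_ne_top hC, fun h n hn hm => ?_⟩
  set W := mProd h * ((mProd h)⁻¹) ^ (L + 1) * Real.exp (-∑ w : InfinitePlace E, mAbs h w)
  have hW : 0 ≤ W := mul_nonneg (mul_nonneg (mProd_pos h).le
    (pow_nonneg (inv_nonneg.2 (mProd_pos h).le) _)) (Real.exp_pos _).le
  have hK : 0 ≤ K := by positivity
  calc _ ≤ ∫⁻ x : GAArchOne E, ENNReal.ofReal (K * W) * ENNReal.ofReal
        (heckeIndicator ((finCoord δ h).m : AdeleRing (𝓞 E) E).2 (toFin (x : GA E)) *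
          ((size (x : GA E))⁻¹) ^ (16 * r + 2)) ∂ν := by
        refine lintegral_mono fun x => ?_
        have hs : 0 < size (x : GA E) := zero_lt_one.trans_le (one_le_size x)
        rw [← ofReal_norm, ← ENNReal.ofReal_mul (norm_nonneg _),
          ← ENNReal.ofReal_mul (mul_nonneg hK hW)]
        refine ENNReal.ofReal_le_ofReal ?_
        refine (mul_le_mul_of_nonneg_right (norm_wWeight_le_size δ (L + 1) h x) (by positivity)).trans_eq ?_
        rw [show L + 1 = N + (16 * r + 2) by omega, pow_add (size (x : GA E))⁻¹ N]
        have : ((size (x : GA E))⁻¹) ^ N * size (x : GA E) ^ N = 1 := by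
          rw [← mul_pow, inv_mul_cancel₀ hs.ne', one_pow]
        simp only [K, W]
        linear_combination (((((L + 1).factorial : ℝ) * 2 ^ (L + 1)) ^ 2) ^ r *
          (mProd h * ((mProd h)⁻¹) ^ (L + 1) * Real.exp (-∑ w : InfinitePlace E, mAbs h w)) *
          (heckeIndicator ((finCoord δ h).m : AdeleRing (𝓞 E) E).2 (toFin (x : GA E)) *
            ((size (x : GA E))⁻¹) ^ (16 * r + 2))) * this
    _ = ENNReal.ofReal (K * W) * ∫⁻ x : GAArchOne E, ENNReal.ofReal
        (heckeIndicator ((finCoord δ h).m : AdeleRing (𝓞 E) E).2 (toFin (x : GA E)) *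
          ((size (x : GA E))⁻¹) ^ (16 * r + 2)) ∂ν := lintegral_const_mul' _ _ ENNReal.ofReal_ne_top
    _ ≤ ENNReal.ofReal (K * W) * (C * (n : ENNReal) ^ (4 * Module.finrank ℤ (𝓞 E))) := by
        gcongr; exact H n hn _ hm
    _ = _ := by rw [ENNReal.ofReal_mul hK]; ring

/-! ### Iwasawa coordinates on a Siegel set -/

/-- An infinite idele, extended by `1` to the finite places. -/
def infUnit (u : (InfiniteAdeleRing E)ˣ) : (AdeleRing (𝓞 E) E)ˣ where
  val := (u, 1)
  inv := ((u⁻¹ : (InfiniteAdeleRing E)ˣ), 1)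
  val_inv := Prod.ext (Units.mul_inv u) (mul_one (1 : FiniteAdeleRing (𝓞 E) E))
  inv_val := Prod.ext (Units.inv_mul u) (mul_one (1 : FiniteAdeleRing (𝓞 E) E))

theorem fstUnit_infUnit (u : (InfiniteAdeleRing E)ˣ) : fstUnit (infUnit u) = u := Units.ext rfl

theorem sndUnit_infUnit (u : (InfiniteAdeleRing E)ˣ) : sndUnit (infUnit u) = 1 := Units.ext rfl

/-- The idele with component `t` at every infinite place. -/
def tIdele (t : ℝ) (ht : 0 < t) : (AdeleRing (𝓞 E) E)ˣ := infUnit (realIdele (fun _ => t) fun _ => ht)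

theorem torusInf_eq_diagGL {t : ℝ} (ht : 0 < t) :
    torusInf (E := E) t = diagGL (tIdele t ht) (tIdele t ht)⁻¹ := by
  refine GA_ext ?_ ?_
  · rw [toInf_diagGL, map_inv, tIdele, fstUnit_infUnit, torusInf_eq ht, ofMix, toInf_ofInf]
    refine Units.ext ?_
    ext1 i j
    change (InfiniteAdeleRing.ringEquiv_mixedSpace E).symm (diagGL _ _ i j) = _
    fin_cases i <;> fin_cases j
    exacts [rfl, map_zero _, map_zero _, rfl]
  · rw [toFin_diagGL, map_inv, tIdele, sndUnit_infUnit, inv_one, diagGL_one, torusInf_eq ht,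
      toFin_ofMix]

theorem exists_upper_triangular {R : Type*} [CommRing R] (b : GL (Fin 2) R) (hb : b 1 0 = 0) :
    ∃ (p q : Rˣ), (p : R) = b 0 0 ∧ (q : R) = b 1 1 ∧
      b = unipGL (b 0 1 * ((q⁻¹ : Rˣ) : R)) * diagGL p q := by
  have hd : IsUnit (b 0 0 * b 1 1) := by
    have h := (Matrix.isUnit_iff_isUnit_det _).1 (Units.isUnit b)
    rwa [Matrix.det_fin_two, hb, mul_zero, sub_zero] at h
  obtain ⟨p, hp⟩ := isUnit_of_mul_isUnit_left hd
  obtain ⟨q, hq⟩ := isUnit_of_mul_isUnit_right hd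
  refine ⟨p, q, hp, hq, Units.ext ?_⟩
  rw [Units.val_mul, coe_unipGL, coe_diagGL, Matrix.mul_fin_two]
  simp only [one_mul, mul_zero, add_zero, zero_mul, zero_add, mul_assoc, Units.inv_mul, mul_one]
  rw [hp, hq, ← hb]
  ext1 i j
  fin_cases i <;> fin_cases j <;> rfl

theorem exists_isFor_of_upper {δ : (AdeleRing (𝓞 E) E)ˣ} (b : GA E) (hb : b 1 0 = 0) :
    ∃ c : IwasawaCoord E, b = unipGL c.t * diagGL (c.z * c.m * δ⁻¹) c.z := by
  obtain ⟨p, q, -, -, h⟩ := exists_upper_triangular b hb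
  refine ⟨⟨b 0 1 * ((q⁻¹ : (AdeleRing (𝓞 E) E)ˣ) : AdeleRing (𝓞 E) E), p * q⁻¹ * δ, q⟩, h.trans ?_⟩
  simp only [mul_assoc, mul_inv_cancel, mul_one, mul_inv_cancel_comm_assoc]

/-- The principal idele of `y`. -/
def ratIdele (y : Eˣ) : (AdeleRing (𝓞 E) E)ˣ := Units.map (algebraMap E (AdeleRing (𝓞 E) E)).toMonoidHom y

theorem ofRat_diagGL (y : Eˣ) : ofRat (diagGL y 1) = diagGL (ratIdele y) 1 := by
  refine Units.ext ?_
  ext1 i j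
  change algebraMap E (AdeleRing (𝓞 E) E) (diagGL y 1 i j) = _
  fin_cases i <;> fin_cases j
  exacts [rfl, map_zero _, map_zero _, map_one _]

/-- Moving `diag(y, 1)` past the unipotent factor scales `t` by `y`. On the diagonal, `diag(y, 1)`
and the torus element multiply the ratio of the entries by `y` and by the square of the torus
parameter, and the lower entry by its inverse. -/
theorem isFor_siegel {δ : (AdeleRing (𝓞 E) E)ˣ} {b : GA E} {c : IwasawaCoord E}
    (hb : b = unipGL c.t * diagGL (c.z * c.m * δ⁻¹) c.z) {t : ℝ} (ht : 0 < t) {k : GA E}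
    (hk : k ∈ KA E) (y : Eˣ) :
    (⟨ratIdele y * c.t, ratIdele y * c.m * tIdele t ht ^ 2, (tIdele t ht)⁻¹ * c.z⟩ :
      IwasawaCoord E).IsFor δ (ofRat (diagGL y 1) * (b * torusInf t * k)) := by
  refine ⟨k, hk, ?_⟩
  simp only
  rw [ofRat_diagGL, torusInf_eq_diagGL ht, hb]
  have h1 : ∀ a : AdeleRing (𝓞 E) E, diagGL (ratIdele y) 1 * unipGL a
      = unipGL (ratIdele y * a) * diagGL (ratIdele y) 1 := fun a => by
    rw [diagGL_mul_unipGL, inv_one, Units.val_one, mul_one]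
  rw [← mul_assoc, ← mul_assoc, ← mul_assoc, h1, mul_assoc _ (diagGL (ratIdele y) 1), diagGL_mul,
    mul_assoc _ (diagGL _ _) (diagGL _ _), diagGL_mul]
  congr 3
  · rw [show (tIdele t ht)⁻¹ * c.z * (ratIdele y * c.m * tIdele t ht ^ 2) * δ⁻¹
      = ((tIdele t ht)⁻¹ * tIdele t ht) * (ratIdele y * (c.z * c.m * δ⁻¹ * tIdele t ht)) by
        rw [pow_two]; simp only [mul_comm, mul_left_comm, mul_assoc], inv_mul_cancel, one_mul,
      mul_assoc (ratIdele y)]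
  · rw [one_mul, mul_comm]

theorem norm_ratIdele (y : Eˣ) (w : InfinitePlace E) :
    ‖(ratIdele y : AdeleRing (𝓞 E) E).1 w‖ = w (y : E) :=
  InfinitePlace.Completion.norm_coe w (WithAbs.toAbs w.1 (y : E))

theorem norm_tIdele {t : ℝ} (ht : 0 < t) (w : InfinitePlace E) :
    ‖((tIdele t ht : (AdeleRing (𝓞 E) E)ˣ) : AdeleRing (𝓞 E) E).1 w‖ = t :=
  norm_realIdele (fun _ => ht) w

theorem norm_fst_mul (a b : AdeleRing (𝓞 E) E) (w : InfinitePlace E) :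
    ‖(a * b).1 w‖ = ‖a.1 w‖ * ‖b.1 w‖ := norm_mul (α := w.Completion) _ _

theorem valued_snd_mul (a b : AdeleRing (𝓞 E) E) (v : HeightOneSpectrum (𝓞 E)) :
    Valued.v ((a * b).2 v) = Valued.v (a.2 v) * Valued.v (b.2 v) := valued_mul v _ _

theorem valued_one (v : HeightOneSpectrum (𝓞 E)) :
    Valued.v ((1 : FiniteAdeleRing (𝓞 E) E) v) = 1 :=
  map_one (Valued.v : Valuation (v.adicCompletion E) _)

theorem snd_tIdele {t : ℝ} (ht : 0 < t) :
    ((tIdele t ht : (AdeleRing (𝓞 E) E)ˣ) : AdeleRing (𝓞 E) E).2 = 1 := rfl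

theorem valued_ratIdele (y : Eˣ) (v : HeightOneSpectrum (𝓞 E)) :
    Valued.v ((ratIdele y : AdeleRing (𝓞 E) E).2 v) = v.valuation E (y : E) :=
  valued_algebraMap v (y : E)

theorem exists_isFor_siegel (δ : (AdeleRing (𝓞 E) E)ˣ) {b : GA E} (hb : b 1 0 = 0) {t : ℝ}
    (ht : 0 < t) {k : GA E} (hk : k ∈ KA E) (y : Eˣ) :
    ∃ c : IwasawaCoord E, c.IsFor δ (ofRat (diagGL y 1) * (b * torusInf t * k)) := by
  obtain ⟨c, hc⟩ := exists_isFor_of_upper (δ := δ) b hb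
  exact ⟨_, isFor_siegel hc ht hk y⟩

theorem mAbs_siegel {δ : (AdeleRing (𝓞 E) E)ˣ} (hδ : (δ : AdeleRing (𝓞 E) E).1 = 1) {b : GA E}
    (hb : b 1 0 = 0) {t : ℝ} (ht : 0 < t) {k : GA E} (hk : k ∈ KA E) (y : Eˣ) (w : InfinitePlace E) :
    mAbs (ofRat (diagGL y 1) * (b * torusInf t * k)) w = w (y : E) * mAbs b w * t ^ 2 := by
  obtain ⟨c, hc⟩ := exists_isFor_of_upper (δ := δ) b hb
  have h0 : c.IsFor δ b := ⟨1, one_mem_KA, by rw [mul_one]; exact hc⟩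
  rw [← ((isFor_siegel hc ht hk y).inf_part hδ w).2.1, ← (h0.inf_part hδ w).2.1, Units.val_mul,
    Units.val_mul, pow_two, Units.val_mul, norm_fst_mul, norm_fst_mul, norm_fst_mul, norm_ratIdele,
    norm_tIdele, pow_two]

theorem valued_finCoord_siegel {δ : (AdeleRing (𝓞 E) E)ˣ} (hδ : (δ : AdeleRing (𝓞 E) E).1 = 1)
    {b : GA E} (hb : b 1 0 = 0) {t : ℝ} (ht : 0 < t) {k : GA E} (hk : k ∈ KA E) (y : Eˣ)
    (v : HeightOneSpectrum (𝓞 E)) :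
    Valued.v (((finCoord δ (ofRat (diagGL y 1) * (b * torusInf t * k))).m : AdeleRing (𝓞 E) E).2 v)
      = v.valuation E (y : E) * Valued.v (((finCoord δ b).m : AdeleRing (𝓞 E) E).2 v) := by
  obtain ⟨c, hc⟩ := exists_isFor_of_upper (δ := δ) b hb
  have h0 : c.IsFor δ b := ⟨1, one_mem_KA, by rw [mul_one]; exact hc⟩
  have h1 := isFor_siegel hc ht hk y
  rw [(h1.finite_part (h1.finCoord hδ) (by rw [toFin_ofFin]; exact inv_mul_repFin_mem _) v).1,
    (h0.finite_part (h0.finCoord hδ) (by rw [toFin_ofFin]; exact inv_mul_repFin_mem _) v).1]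
  rw [Units.val_mul, Units.val_mul, pow_two, Units.val_mul, valued_snd_mul, valued_snd_mul,
    valued_snd_mul, snd_tIdele, valued_one, mul_one, mul_one, valued_ratIdele]

/-! ### Bounds on compact sets -/

theorem exists_pos_le_mAbs {Ω : Set (GA E)} (hΩ : IsCompact Ω) :
    ∃ ρ : ℝ, 0 < ρ ∧ ρ ≤ 1 ∧ ∀ b ∈ Ω, ∀ w, ρ ≤ mAbs b w := by
  have h : ∀ w : InfinitePlace E, ∃ ρ : ℝ, 0 < ρ ∧ ρ ≤ 1 ∧ ∀ b ∈ Ω, ρ ≤ mAbs b w := by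
    intro w
    rcases Ω.eq_empty_or_nonempty with rfl | hne
    · exact ⟨1, one_pos, le_rfl, by simp⟩
    obtain ⟨b₀, -, hb₀⟩ := hΩ.exists_isMinOn hne (continuous_mAbs w).continuousOn
    exact ⟨min 1 (mAbs b₀ w), lt_min one_pos (mAbs_pos b₀ w), min_le_left _ _,
      fun b hb => (min_le_right _ _).trans (hb₀ hb)⟩
  choose ρ h0 h1 h2 using h
  -- Each local bound is at most one, so their product lies below all of them.
  refine ⟨∏ w, ρ w, Finset.prod_pos fun w _ => h0 w,
    Finset.prod_le_one (fun w _ => (h0 w).le) fun w _ => h1 w, fun b hb w => ?_⟩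
  classical
  rw [← Finset.mul_prod_erase _ _ (Finset.mem_univ w)]
  exact (mul_le_of_le_one_right (h0 w).le (Finset.prod_le_one (fun w _ => (h0 w).le)
    fun w _ => h1 w)).trans (h2 w b hb)

theorem valued_natCast_le_of_dvd {a b : ℕ} (h : a ∣ b) (v : HeightOneSpectrum (𝓞 E)) :
    Valued.v ((b : FiniteAdeleRing (𝓞 E) E) v) ≤ Valued.v ((a : FiniteAdeleRing (𝓞 E) E) v) := by
  obtain ⟨c, rfl⟩ := h
  rw [Nat.cast_mul, valued_mul]
  refine mul_le_of_le_one_right' ?_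
  have := mem_intFin_algebraMap (E := E) (c : 𝓞 E) v
  rwa [show (((c : 𝓞 E) : 𝓞 E) : E) = (c : E) from map_natCast _ c, map_natCast] at this

/-- The absolute value of the norm of an integer of `E`. -/
def normNat (a : 𝓞 E) : ℕ := Ideal.absNorm (Ideal.span {a})

theorem normNat_ne_zero {a : 𝓞 E} (ha : a ≠ 0) : normNat a ≠ 0 := by
  rw [normNat, Ne, Ideal.absNorm_eq_zero_iff, Ideal.span_singleton_eq_bot]
  exact ha

/-- An integer divides its norm in `𝓞 E`; so the norm can serve as the modulus `n` in the counting
of cells. -/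
theorem valued_normNat_le (a : 𝓞 E) (v : HeightOneSpectrum (𝓞 E)) :
    Valued.v ((normNat a : FiniteAdeleRing (𝓞 E) E) v) ≤ v.valuation E (a : E) := by
  have hd : a ∣ (normNat a : 𝓞 E) := Ideal.mem_span_singleton.1 (Ideal.absNorm_mem _)
  obtain ⟨c, hc⟩ := hd
  have h2 : (normNat a : FiniteAdeleRing (𝓞 E) E) = algebraMap E _ ((a : E) * (c : E)) := by
    rw [← map_natCast (algebraMap E (FiniteAdeleRing (𝓞 E) E)), ← map_mul, ← hc, map_natCast, map_natCast, map_natCast]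
  rw [h2, valued_algebraMap, map_mul]
  exact mul_le_of_le_one_right' (v.valuation_le_one c)

/-- Each idele `m` divides some nonzero natural number. As `finCoord` is locally constant, finitely
many such numbers serve for the compact set `Ω`, and the factorial of an upper bound is divisible by
all of them. -/
theorem exists_natCast_le_finCoord (δ : (AdeleRing (𝓞 E) E)ˣ) {Ω : Set (GA E)} (hΩ : IsCompact Ω) :
    ∃ D : ℕ, D ≠ 0 ∧ ∀ b ∈ Ω, ∀ v : HeightOneSpectrum (𝓞 E),
      Valued.v ((D : FiniteAdeleRing (𝓞 E) E) v)
        ≤ Valued.v (((finCoord δ b).m : AdeleRing (𝓞 E) E).2 v) := by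
  have hc : ∀ c : IwasawaCoord E, ∃ D : ℕ, D ≠ 0 ∧ ∀ v : HeightOneSpectrum (𝓞 E),
      Valued.v ((D : FiniteAdeleRing (𝓞 E) E) v) ≤ Valued.v ((c.m : AdeleRing (𝓞 E) E).2 v) := by
    intro c
    obtain ⟨d, hd, h⟩ := exists_int_mul_integral ((c.m⁻¹ : (AdeleRing (𝓞 E) E)ˣ) : AdeleRing (𝓞 E) E).2
    refine ⟨normNat d, normNat_ne_zero hd, fun v => ?_⟩
    refine (valued_normNat_le d v).trans ?_
    have h1 : v.valuation E (d : E) * Valued.v (((c.m⁻¹ : (AdeleRing (𝓞 E) E)ˣ) : AdeleRing (𝓞 E) E).2 v) ≤ 1 := by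
      rw [← valued_algebraMap v (d : E), ← map_mul]; exact h v
    have h2 := mul_le_mul_left h1 (Valued.v ((c.m : AdeleRing (𝓞 E) E).2 v))
    rwa [mul_assoc, ← valued_snd_mul, Units.inv_mul, one_mul, show Valued.v ((1 : AdeleRing (𝓞 E) E).2 v) = 1
      from map_one (Valued.v : Valuation (v.adicCompletion E) _), mul_one] at h2
  choose D hD h using hc
  have hf : (Set.image (fun b => D (finCoord δ b)) Ω).Finite :=
    (hΩ.image (continuous_of_finCoord δ D)).finite_of_discrete
  obtain ⟨B, hB⟩ := hf.bddAbove
  refine ⟨B.factorial, B.factorial_ne_zero, fun b hb v => ?_⟩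
  exact (valued_natCast_le_of_dvd (Nat.dvd_factorial (Nat.pos_of_ne_zero (hD _))
    (hB (Set.mem_image_of_mem _ hb))) v).trans (h (finCoord δ b) v)

/-! ### The sum over `Eˣ` -/

/-- The sum of the archimedean absolute values. -/
def absSum (y : E) : ℝ := ∑ w : InfinitePlace E, w y

theorem le_absSum (y : E) (w : InfinitePlace E) : w y ≤ absSum y :=
  Finset.single_le_sum (f := fun w : InfinitePlace E => w y) (fun w _ => apply_nonneg w y)
    (Finset.mem_univ w)

theorem absSum_pos {y : E} (hy : y ≠ 0) : 0 < absSum y :=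
  Finset.sum_pos (fun w _ => w.pos_iff.2 hy) Finset.univ_nonempty

theorem absSum_natCast_mul (D : ℕ) (y : E) : absSum ((D : E) * y) = D * absSum y := by
  simp only [absSum, map_mul, Finset.mul_sum, InfinitePlace.map_natCast]

open scoped Classical in
theorem norm_mixedEmbedding_le (y : E) : ‖mixedEmbedding E y‖ ≤ absSum y := by
  rw [norm_eq_sup'_normAtPlace]
  refine Finset.sup'_le _ _ fun w _ => ?_
  rw [normAtPlace_apply]
  exact le_absSum y w

/-- The integers form a lattice of rank `d` in the mixed space, where the sum of the inverse powers
of exponent `d + 1` of the norm converges; the norm is at most `absSum`. -/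
theorem summable_absSum_inv_pow :
    Summable fun a : {a : 𝓞 E // a ≠ 0} =>
      ((absSum (a.1 : E))⁻¹) ^ (Module.finrank ℤ (𝓞 E) + 1) := by
  classical
  have hr : Module.finrank ℤ (mixedEmbedding.integerLattice E) < Module.finrank ℤ (𝓞 E) + 1 := by
    rw [ZLattice.rank ℝ (mixedEmbedding.integerLattice E), mixedEmbedding.finrank,
      RingOfIntegers.rank]
    exact Nat.lt_succ_self _
  have h := ZLattice.summable_norm_pow_inv (mixedEmbedding.integerLattice E) _ hr
  let f : {a : 𝓞 E // a ≠ 0} → mixedEmbedding.integerLattice E :=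
    fun a => ⟨mixedEmbedding E (a.1 : E), a.1, rfl⟩
  have hf : Function.Injective f := fun a b hab => by
    have h1 : mixedEmbedding E (a.1 : E) = mixedEmbedding E (b.1 : E) := congrArg Subtype.val hab
    exact Subtype.ext (RingOfIntegers.coe_injective ((mixedEmbedding E).injective h1))
  refine Summable.of_nonneg_of_le (fun a => pow_nonneg (inv_nonneg.2 ?_) _) (fun a => ?_)
    (h.comp_injective hf)
  · exact Finset.sum_nonneg fun w _ => apply_nonneg w _
  · have ha : (a.1 : E) ≠ 0 := RingOfIntegers.coe_ne_zero_iff.2 a.2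
    have h1 : 0 < ‖mixedEmbedding E (a.1 : E)‖ :=
      norm_pos_iff.2 ((map_ne_zero (mixedEmbedding E)).2 ha)
    change _ ≤ ‖mixedEmbedding E (a.1 : E)‖⁻¹ ^ _
    have := absSum_pos ha
    gcongr
    exact norm_mixedEmbedding_le _

/-- Multiplication by `D` embeds the index set into the nonzero integers and scales `absSum` by `D`.
-/
theorem tsum_absSum_lt_top {D : ℕ} (hD : D ≠ 0) :
    ∑' y : {y : Eˣ // ∃ a : 𝓞 E, (a : E) = D * (y : E)},
      ENNReal.ofReal (((absSum (y.1 : E))⁻¹) ^ (Module.finrank ℤ (𝓞 E) + 1)) < ⊤ := by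
  have hDE : (D : E) ≠ 0 := Nat.cast_ne_zero.2 hD
  choose a ha using fun y : {y : Eˣ // ∃ a : 𝓞 E, (a : E) = D * (y : E)} => y.2
  have ha0 : ∀ y, a y ≠ 0 := fun y h0 => by
    have := ha y
    rw [h0, show ((0 : 𝓞 E) : E) = 0 from map_zero _] at this
    exact mul_ne_zero hDE y.1.ne_zero this.symm
  let f : {y : Eˣ // ∃ a : 𝓞 E, (a : E) = D * (y : E)} → {a : 𝓞 E // a ≠ 0} :=
    fun y => ⟨a y, ha0 y⟩
  have hf : Function.Injective f := fun y y' h => by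
    have h1 : a y = a y' := congrArg Subtype.val h
    have h2 : (D : E) * (y.1 : E) = D * (y'.1 : E) := by rw [← ha, ← ha, h1]
    exact Subtype.ext (Units.ext (mul_left_cancel₀ hDE h2))
  have hs := (summable_absSum_inv_pow (E := E)).comp_injective hf
  have hs2 := hs.mul_left ((D : ℝ) ^ (Module.finrank ℤ (𝓞 E) + 1))
  refine lt_of_eq_of_lt (tsum_congr fun y => congrArg ENNReal.ofReal ?_)
    (lt_top_iff_ne_top.2 hs2.tsum_ofReal_ne_top)
  change _ = _ * ((absSum (a y : E))⁻¹) ^ _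
  rw [ha y, absSum_natCast_mul, ← mul_pow, mul_inv, mul_inv_cancel_left₀ (Nat.cast_ne_zero.2 hD)]

theorem normNat_eq (a : 𝓞 E) : (normNat a : ℝ) = ∏ w : InfinitePlace E, w (a : E) ^ w.mult := by
  rw [InfinitePlace.prod_eq_abs_norm, normNat, Ideal.absNorm_span_singleton,
    ← Algebra.coe_norm_int, Nat.cast_natAbs]
  push_cast
  rfl

theorem normNat_le (a : 𝓞 E) : (normNat a : ℝ) ≤ absSum (a : E) ^ Module.finrank ℤ (𝓞 E) := by
  rw [normNat_eq, RingOfIntegers.rank, ← InfinitePlace.sum_mult_eq, ← Finset.prod_pow_eq_pow_sum]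
  exact Finset.prod_le_prod (fun w _ => pow_nonneg (apply_nonneg w _) _)
    fun w _ => pow_le_pow_left₀ (apply_nonneg w _) (le_absSum _ w) _

theorem one_le_normNat {a : 𝓞 E} (ha : a ≠ 0) : (1 : ℝ) ≤ normNat a := by
  exact_mod_cast Nat.one_le_iff_ne_zero.2 (normNat_ne_zero ha)

/-- The sum over `y` of the moments of the density, on a Siegel set. -/
theorem exists_tsum_lintegral_wWeight_le {δ : (AdeleRing (𝓞 E) E)ˣ} (hδ : (δ : AdeleRing (𝓞 E) E).1 = 1)
    (ν : Measure (GAArchOne E)) [ν.IsHaarMeasure] (N : ℕ) {Ω : Set (GA E)} (hΩ : IsCompact Ω)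
    (hΩ0 : ∀ b ∈ Ω, b 1 0 = 0) {T : ℝ} (hT : 0 < T) :
    ∃ B : ENNReal, B ≠ ⊤ ∧ ∃ Q : ℕ, Q ≠ 0 ∧ ∀ b ∈ Ω, ∀ t, T < t → ∀ k ∈ KA E,
      ∑' y : Eˣ, ∫⁻ x : GAArchOne E, ‖wWeight δ (ofRat (diagGL y 1) * (b * torusInf t * k)) x‖ₑ *
        ENNReal.ofReal (size (x : GA E) ^ N) ∂ν ≤ B * ENNReal.ofReal ((t ^ 2)⁻¹ ^ Q) := by
  obtain ⟨L, C, hC, H⟩ := exists_lintegral_wWeight_le δ ν N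
  obtain ⟨ρ, hρ0, hρ1, hρ⟩ := exists_pos_le_mAbs hΩ
  obtain ⟨D, hD, hDv⟩ := exists_natCast_le_finCoord δ hΩ
  set d := Module.finrank ℤ (𝓞 E) with hd
  have hDr : (0 : ℝ) < D := Nat.cast_pos.2 (Nat.pos_of_ne_zero hD)
  -- The part `4 d · d` cancels `|N(Dy)| ^ (4 d)`, which is at most a constant times `absSum y ^ (4
  -- d · d)`; the part `d + 1` makes the lattice sum converge.
  set Q := 4 * d * d + (d + 1) with hQ
  -- A lower bound for `mProd`: the norm of the nonzero integer `D y` is at least one, and each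
  -- `mAbs` is at least `w y · ρ t ^ 2` with `t > T`.
  set M₀ : ℝ := ((D : ℝ)⁻¹ * ρ * T ^ 2) ^ d with hM₀
  have hM₀p : 0 < M₀ := by positivity
  set K : ℝ := (M₀⁻¹) ^ L * ((Q.factorial : ℝ) * (ρ⁻¹) ^ Q) * (D ^ d : ℝ) ^ (4 * d)
  have hK : 0 ≤ K := by positivity
  refine ⟨C * ENNReal.ofReal K * ∑' y : {y : Eˣ // ∃ a : 𝓞 E, (a : E) = D * (y : E)},
      ENNReal.ofReal (((absSum (y.1 : E))⁻¹) ^ (d + 1)),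
    ENNReal.mul_ne_top (ENNReal.mul_ne_top hC ENNReal.ofReal_ne_top) (tsum_absSum_lt_top hD).ne,
    Q, by omega, fun b hb t ht k hk => ?_⟩
  have ht0 : 0 < t := hT.trans ht
  have hv : ∀ (y : Eˣ) (v : HeightOneSpectrum (𝓞 E)), v.valuation E ((D : E) * y) ≤
      Valued.v (((finCoord δ (ofRat (diagGL y 1) * (b * torusInf t * k))).m :
        AdeleRing (𝓞 E) E).2 v) := by
    intro y v
    rw [valued_finCoord_siegel hδ (hΩ0 b hb) ht0 hk, map_mul, mul_comm]
    refine mul_le_mul_right ?_ _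
    rw [← valued_algebraMap, map_natCast]
    exact hDv b hb v
  -- The weight vanishes unless `m` is integral. Since `D` is divisible by the coordinate of `b`,
  -- integrality of `m` forces `D y` into `𝓞 E`.
  have hsupp : Function.support (fun y : Eˣ => ∫⁻ x : GAArchOne E,
      ‖wWeight δ (ofRat (diagGL y 1) * (b * torusInf t * k)) x‖ₑ *
        ENNReal.ofReal (size (x : GA E) ^ N) ∂ν) ⊆ {y : Eˣ | ∃ a : 𝓞 E, (a : E) = D * (y : E)} := by
    intro y hy
    by_contra hcon
    refine hy ?_
    have hm : ((finCoord δ (ofRat (diagGL y 1) * (b * torusInf t * k))).m :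
        AdeleRing (𝓞 E) E).2 ∉ intFin E := fun hm => hcon
      (HeightOneSpectrum.mem_integers_of_valuation_le_one E _ fun v => (hv y v).trans (hm v))
    simp only [wWeight_eq_zero hm, enorm_zero, zero_mul, lintegral_zero]
  rw [← tsum_subtype_eq_of_support_subset hsupp, mul_right_comm, ← ENNReal.tsum_mul_left]
  refine ENNReal.tsum_le_tsum fun y => ?_
  obtain ⟨y, a, ha⟩ := y
  set h := ofRat (diagGL y 1) * (b * torusInf t * k) with hh
  have ha0 : a ≠ 0 := fun h0 => by
    rw [h0, show ((0 : 𝓞 E) : E) = 0 from map_zero _] at ha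
    exact mul_ne_zero (Nat.cast_ne_zero.2 hD) y.ne_zero ha.symm
  set s := absSum (y : E) with hs
  have hs0 : 0 < s := absSum_pos y.ne_zero
  have hn : (normNat a : ℝ) ≤ D ^ d * s ^ d := by
    refine (normNat_le a).trans_eq ?_
    rw [ha, absSum_natCast_mul, mul_pow]
  have hmAbs : ∀ w, w (y : E) * (ρ * t ^ 2) ≤ mAbs h w := fun w => by
    rw [hh, mAbs_siegel hδ (hΩ0 b hb) ht0 hk, mul_assoc]
    have := hρ b hb w
    have h0 : 0 ≤ w (y : E) := apply_nonneg w _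
    gcongr
  -- The exponential is spent on the `Q`-th inverse power of `absSum y · ρ t ^ 2`, which supplies at
  -- once the decay in `y` and the decay in `t`.
  have hexp : Real.exp (-∑ w : InfinitePlace E, mAbs h w) ≤
      ((Q.factorial : ℝ) * (ρ⁻¹) ^ Q) * ((t ^ 2)⁻¹ ^ Q * (s⁻¹) ^ Q) := by
    calc _ ≤ Real.exp (-(s * (ρ * t ^ 2))) := by
          rw [Real.exp_le_exp, neg_le_neg_iff, hs, absSum, Finset.sum_mul]
          exact Finset.sum_le_sum fun w _ => hmAbs w
      _ ≤ (Q.factorial : ℝ) / (s * (ρ * t ^ 2)) ^ Q := exp_neg_le_factorial_div_pow (by positivity) Q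
      _ = _ := by rw [mul_pow, mul_pow, inv_pow, inv_pow, inv_pow]; field_simp
  have hM : M₀ ≤ mProd h := by
    have h1 : (normNat a : ℝ) = D ^ d * ∏ w : InfinitePlace E, w (y : E) ^ w.mult := by
      rw [normNat_eq, ha]
      simp only [map_mul, mul_pow, Finset.prod_mul_distrib, InfinitePlace.map_natCast]
      rw [Finset.prod_pow_eq_pow_sum, InfinitePlace.sum_mult_eq, hd, RingOfIntegers.rank]
    have h2 : ((D : ℝ)⁻¹) ^ d ≤ ∏ w : InfinitePlace E, w (y : E) ^ w.mult := by
      rw [inv_pow, inv_le_iff_one_le_mul₀ (by positivity), mul_comm, ← h1]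
      exact one_le_normNat ha0
    calc M₀ = ((D : ℝ)⁻¹) ^ d * (ρ * t ^ 2) ^ d * ((T ^ 2) / t ^ 2) ^ d := by
          rw [hM₀, ← mul_pow, ← mul_pow]; congr 1; field_simp
      _ ≤ ((D : ℝ)⁻¹) ^ d * (ρ * t ^ 2) ^ d * 1 := by
          gcongr
          refine pow_le_one₀ (by positivity) ((div_le_one (by positivity)).2 ?_)
          gcongr
      _ ≤ (∏ w : InfinitePlace E, w (y : E) ^ w.mult) * (ρ * t ^ 2) ^ d := by
          rw [mul_one]; gcongr
      _ = ∏ w : InfinitePlace E, (w (y : E) * (ρ * t ^ 2)) ^ w.mult := by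
          have e : ∀ w : InfinitePlace E, (w (y : E) * (ρ * t ^ 2)) ^ w.mult
            = w (y : E) ^ w.mult * (ρ * t ^ 2) ^ w.mult := fun w => mul_pow _ _ _
          simp only [e]
          rw [Finset.prod_mul_distrib, Finset.prod_pow_eq_pow_sum, InfinitePlace.sum_mult_eq, hd, RingOfIntegers.rank]
      _ ≤ mProd h := Finset.prod_le_prod
          (fun w _ => pow_nonneg (mul_nonneg (apply_nonneg w _) (by positivity)) _)
          fun w _ => pow_le_pow_left₀ (mul_nonneg (apply_nonneg w _) (by positivity)) (hmAbs w) _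
  have hMP := mProd_pos h
  refine (H h (normNat a) (normNat_ne_zero ha0) fun v => (valued_normNat_le a v).trans
    (by rw [ha]; exact hv y v)).trans ?_
  have key : (mProd h * ((mProd h)⁻¹) ^ (L + 1) * Real.exp (-∑ w : InfinitePlace E, mAbs h w)) *
      (normNat a : ℝ) ^ (4 * d) ≤ K * (t ^ 2)⁻¹ ^ Q * (s⁻¹) ^ (d + 1) := by
    calc _ = ((mProd h)⁻¹) ^ L * Real.exp (-∑ w : InfinitePlace E, mAbs h w) *
          (normNat a : ℝ) ^ (4 * d) := by rw [pow_succ]; field_simp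
      _ ≤ (M₀⁻¹) ^ L * (((Q.factorial : ℝ) * (ρ⁻¹) ^ Q) * ((t ^ 2)⁻¹ ^ Q * (s⁻¹) ^ Q)) *
          (D ^ d * s ^ d) ^ (4 * d) := by gcongr
      _ = K * (t ^ 2)⁻¹ ^ Q * ((s⁻¹) ^ Q * (s ^ d) ^ (4 * d)) := by
          simp only [K]; rw [mul_pow (D ^ d : ℝ)]; ring
      _ = _ := by
          congr 1
          rw [hQ, pow_add, ← pow_mul, show d * (4 * d) = 4 * d * d by ring, mul_right_comm, ← mul_pow,
            inv_mul_cancel₀ hs0.ne', one_pow, one_mul]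
  calc _ = C * ENNReal.ofReal ((mProd h * ((mProd h)⁻¹) ^ (L + 1) *
        Real.exp (-∑ w : InfinitePlace E, mAbs h w)) * (normNat a : ℝ) ^ (4 * d)) := by
        rw [ENNReal.ofReal_mul (p := mProd h * ((mProd h)⁻¹) ^ (L + 1) * _) (by positivity),
          ENNReal.ofReal_pow (by positivity), ENNReal.ofReal_natCast, mul_assoc]
    _ ≤ C * ENNReal.ofReal (K * (t ^ 2)⁻¹ ^ Q * (s⁻¹) ^ (d + 1)) := by gcongr
    _ = _ := by
        rw [ENNReal.ofReal_mul (by positivity), ENNReal.ofReal_mul hK]; ring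

/-! ### Integration over a Siegel set -/

/-- The adele with component `t` at every infinite place and `1` at the finite places. -/
def tAdele (t : ℝ) : AdeleRing (𝓞 E) E :=
  ((InfiniteAdeleRing.ringEquiv_mixedSpace E).symm (realVec fun _ => t), (1 : FiniteAdeleRing (𝓞 E) E))

theorem continuous_tAdele : Continuous (tAdele (E := E)) :=
  (continuous_ringEquiv_mixedSpace_symm.comp (continuous_realVec.comp
    (continuous_pi fun _ => continuous_id))).prodMk continuous_const

theorem tAdele_mul (s t : ℝ) : tAdele (E := E) (s * t) = tAdele s * tAdele t := by
  refine Prod.ext ?_ (mul_one (1 : FiniteAdeleRing (𝓞 E) E)).symm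
  change (InfiniteAdeleRing.ringEquiv_mixedSpace E).symm (realVec fun _ => s * t) = _
  rw [realVec_mul, map_mul]
  rfl

theorem coe_tIdele_inv {t : ℝ} (ht : 0 < t) :
    (((tIdele t ht)⁻¹ : (AdeleRing (𝓞 E) E)ˣ) : AdeleRing (𝓞 E) E) = tAdele t⁻¹ := rfl

theorem tIdele_mul {s t : ℝ} (hs : 0 < s) (ht : 0 < t) :
    tIdele (E := E) (s * t) (mul_pos hs ht) = tIdele s hs * tIdele t ht :=
  Units.ext (tAdele_mul s t)

theorem torusInf_mul {s t : ℝ} (hs : 0 < s) (ht : 0 < t) :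
    torusInf (E := E) (s * t) = torusInf s * torusInf t := by
  rw [torusInf_eq_diagGL hs, torusInf_eq_diagGL ht, torusInf_eq_diagGL (mul_pos hs ht), diagGL_mul,
    tIdele_mul hs ht, mul_inv]

theorem continuous_unipGL : Continuous fun a : AdeleRing (𝓞 E) E => unipGL a := by
  refine Units.continuous_iff.2 ⟨continuous_matrix fun i j => ?_, continuous_matrix fun i j => ?_⟩
  · fin_cases i <;> fin_cases j
    exacts [continuous_const, continuous_id, continuous_const, continuous_const]
  · fin_cases i <;> fin_cases j
    exacts [continuous_const, continuous_neg, continuous_const, continuous_const]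

theorem continuousOn_torusInf : ContinuousOn (torusInf (E := E)) (Set.Ioi 0) := by
  rw [continuousOn_iff_continuous_domRestrict]
  have h : Set.domRestrict (Set.Ioi 0) (torusInf (E := E))
      = fun t : Set.Ioi (0 : ℝ) => diagGL (tIdele t.1 t.2) (tIdele t.1 t.2)⁻¹ :=
    funext fun t => torusInf_eq_diagGL t.2
  have h1 : Continuous fun t : Set.Ioi (0 : ℝ) => tAdele (E := E) t.1 :=
    continuous_tAdele.comp continuous_subtype_val
  have h2 : Continuous fun t : Set.Ioi (0 : ℝ) => tAdele (E := E) t.1⁻¹ :=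
    continuous_tAdele.comp (continuous_subtype_val.inv₀ fun t => (Set.mem_Ioi.1 t.2).ne')
  rw [h]
  refine Units.continuous_iff.2 ⟨continuous_matrix fun i j => ?_, continuous_matrix fun i j => ?_⟩
  · fin_cases i <;> fin_cases j
    exacts [h1, continuous_const, continuous_const, h2]
  · fin_cases i <;> fin_cases j
    exacts [h2, continuous_const, continuous_const, h1]

/-- For upper triangular `b`, the matrix whose upper right entry is that of `b` times `r` at the
infinite places. -/
def contract (b : GA E) (r : ℝ) : GA E :=
  unipGL (tAdele r * (b 0 1 * (b⁻¹ : GA E) 1 1) - b 0 1 * (b⁻¹ : GA E) 1 1) * b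

theorem continuous_contract : Continuous fun p : GA E × ℝ => contract p.1 p.2 := by
  have h : Continuous fun b : GA E => b 0 1 * (b⁻¹ : GA E) 1 1 :=
    ((Units.continuous_val (M := Matrix (Fin 2) (Fin 2) (AdeleRing (𝓞 E) E))).matrix_elem 0 1).mul
      ((Units.continuous_val.comp continuous_inv).matrix_elem 1 1)
  exact (continuous_unipGL.comp (((continuous_tAdele.comp continuous_snd).mul
    (h.comp continuous_fst)).sub (h.comp continuous_fst))).mul continuous_fst

/-- Conjugation by the torus only scales the unipotent coordinate at infinity, by `t ^ (-2)`. As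
`contract` is continuous up to `r = 0`, the conjugates of `Ω` with `t ≥ 1` stay in one compact set.
-/
theorem torusInf_inv_mul_mul {b : GA E} (hb : b 1 0 = 0) {t : ℝ} (ht : 0 < t) :
    (torusInf t)⁻¹ * b * torusInf t = contract b ((t ^ 2)⁻¹) := by
  obtain ⟨p, q, -, -, h⟩ := exists_upper_triangular b hb
  set s := b 0 1 * ((q⁻¹ : (AdeleRing (𝓞 E) E)ˣ) : AdeleRing (𝓞 E) E) with hs
  have hq : (b⁻¹ : GA E) 1 1 = ((q⁻¹ : (AdeleRing (𝓞 E) E)ˣ) : AdeleRing (𝓞 E) E) := by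
    rw [h, mul_inv_rev, diagGL_inv, unipGL_inv, Units.val_mul, coe_unipGL, coe_diagGL,
      Matrix.mul_fin_two]
    change 0 * -s + ((q⁻¹ : (AdeleRing (𝓞 E) E)ˣ) : AdeleRing (𝓞 E) E) * 1 = _
    rw [zero_mul, zero_add, mul_one]
  have h1 : contract b ((t ^ 2)⁻¹) = unipGL (tAdele ((t ^ 2)⁻¹) * s) * diagGL p q := by
    unfold contract
    rw [hq, ← hs]
    conv_lhs => rw [h]
    rw [← mul_assoc, ← unipGL_add, sub_add_cancel]
  rw [h1, torusInf_eq_diagGL ht, h, diagGL_inv, inv_inv, ← mul_assoc, diagGL_mul_unipGL, mul_assoc,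
    mul_assoc, diagGL_mul, diagGL_mul]
  congr 2
  · rw [coe_tIdele_inv, mul_right_comm, ← tAdele_mul, pow_two, mul_inv]
  · rw [mul_comm p, inv_mul_cancel_left]
  · rw [mul_comm q, mul_inv_cancel_left]

/-- The parameter `2` is an integer at every infinite place, hence fixed by any ring homomorphism; a
dyadic subdivision needs no other torus element in `H(𝔸_F)`. -/
theorem galAdele_tAdele_two (σ : E ≃+* E) : galAdele σ (tAdele 2) = tAdele 2 := by
  have h : (tAdele 2 : AdeleRing (𝓞 E) E) = ((2 : InfiniteAdeleRing E), (1 : FiniteAdeleRing (𝓞 E) E)) := by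
    refine Prod.ext ?_ rfl
    have : (realVec fun _ => 2 : mixedSpace E) = 2 := by
      refine Prod.ext (funext fun w => rfl) (funext fun w => ?_)
      change ((2 : ℝ) : ℂ) = 2
      norm_num
    change (InfiniteAdeleRing.ringEquiv_mixedSpace E).symm (realVec fun _ => 2) = 2
    rw [this, map_ofNat]
  rw [h]
  exact Prod.ext (map_ofNat (galInf σ) 2) (map_one (galFin σ))

theorem torusInf_two_mem_unitaryTwo (σ : E ≃+* E) :
    torusInf (2 : ℝ) ∈ unitaryTwo (galAdele σ) := by
  rw [torusInf_eq_diagGL two_pos]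
  have h1 : Matrix.GeneralLinearGroup.map (galAdele σ)
      (diagGL (tIdele (E := E) 2 two_pos) (tIdele 2 two_pos)⁻¹)
      = diagGL (tIdele 2 two_pos) (tIdele 2 two_pos)⁻¹ := by
    have h2 : Units.map (galAdele σ).toMonoidHom (tIdele (E := E) 2 two_pos) = tIdele 2 two_pos :=
      Units.ext (galAdele_tAdele_two σ)
    have h3 : galAdele σ (((tIdele (E := E) 2 two_pos)⁻¹ : (AdeleRing (𝓞 E) E)ˣ) : AdeleRing (𝓞 E) E)
        = (((tIdele (E := E) 2 two_pos)⁻¹ : (AdeleRing (𝓞 E) E)ˣ) : AdeleRing (𝓞 E) E) := by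
      have := congrArg Units.val (congrArg (·⁻¹) h2)
      rwa [← map_inv] at this
    refine Units.ext ?_
    ext1 i j
    change galAdele σ (diagGL _ _ i j) = _
    fin_cases i <;> fin_cases j
    exacts [galAdele_tAdele_two σ, map_zero _, map_zero _, h3]
  have h4 : ∀ a b : AdeleRing (𝓞 E) E, (!![a, 0; 0, b] : Matrix (Fin 2) (Fin 2) _).transpose
      = !![a, 0; 0, b] := fun a b => by
    ext1 i j
    fin_cases i <;> fin_cases j <;> rfl
  change _ = antiDiag _ * _ * antiDiag _
  rw [h1, diagGL_inv, inv_inv, coe_diagGL, coe_diagGL, antiDiag, h4, Matrix.mul_fin_two, Matrix.mul_fin_two]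
  simp only [zero_mul, mul_zero, one_mul, mul_one, zero_add, add_zero]

section Siegel

variable {F : Type*} [Field F] [Algebra F E]

-- The piece of the Siegel set with `2 ^ j T ≤ t < 2 ^ (j + 1) T` is moved into a fixed compact set
-- `Z` by the `j`-th inverse power of `diag(2, 1/2)`, an element of `H(𝔸_F)`. By left invariance
-- these pieces have bounded measure, and on them `f` decays geometrically in `j`.
open scoped Pointwise in
theorem lintegral_siegel_lt_top (ι : E ≃ₐ[F] E) (η : Measure (HA ι)) [η.IsHaarMeasure]
    {𝔉 : Set (HA ι)} (h𝔉 : MeasurableSet 𝔉) {Ω : Set (GA E)} (hΩ : IsCompact Ω)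
    (hΩ0 : ∀ b ∈ Ω, b 1 0 = 0) {T : ℝ} (hT : 0 < T) {f : HA ι → ENNReal} {B : ENNReal} (hB : B ≠ ⊤)
    {Q : ℕ} (hQ : Q ≠ 0)
    (hS : ∀ h ∈ 𝔉, ∃ b ∈ Ω, ∃ t : ℝ, T < t ∧ ∃ k ∈ KA E, (h : GA E) = b * torusInf t * k ∧
      f h ≤ B * ENNReal.ofReal ((t ^ 2)⁻¹ ^ Q)) :
    ∫⁻ h in 𝔉, f h ∂η < ⊤ := by
  have hcl : IsClosed (HA ι : Set (GA E)) := isClosed_unitaryTwo (continuous_galAdele (ι : E ≃+* E))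
  let Z : Set (GA E) := (fun p : GA E × ℝ => contract p.1 p.2) '' (Ω ×ˢ Set.Icc 0 1) *
    torusInf '' Set.Icc T (2 * T) * KA E
  have hZ : IsCompact Z := (((hΩ.prod isCompact_Icc).image continuous_contract).mul
    (isCompact_Icc.image_of_continuousOn (continuousOn_torusInf.mono fun t ht =>
      hT.trans_le ht.1))).mul isCompact_KA
  let ZH : Set (HA ι) := Subtype.val ⁻¹' Z
  have hZH : IsCompact ZH := hcl.isClosedEmbedding_subtypeVal.isCompact_preimage hZ
  let τ : HA ι := ⟨torusInf 2, torusInf_two_mem_unitaryTwo _⟩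
  have hτ : ∀ j : ℕ, ((τ ^ j : HA ι) : GA E) = torusInf (2 ^ j) := by
    intro j
    induction j with
    | zero =>
      rw [pow_zero, pow_zero, torusInf_eq_diagGL one_pos]
      have : tIdele (E := E) 1 one_pos = 1 := Units.ext
        (Prod.ext (map_one (InfiniteAdeleRing.ringEquiv_mixedSpace E).symm) rfl)
      rw [this, inv_one, diagGL_one]
      rfl
    | succ j ih =>
      rw [pow_succ, Subgroup.coe_mul, ih, pow_succ, torusInf_mul (by positivity) two_pos]
  let P : ℕ → Set (HA ι) := fun j => (fun h => (τ ^ j)⁻¹ * h) ⁻¹' ZH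
  have hP : ∀ j, MeasurableSet (P j) := fun j =>
    (hZH.isClosed.preimage (continuous_const.mul continuous_id)).measurableSet
  have hηP : ∀ j, η (P j) = η ZH := fun j => measure_preimage_mul η _ _
  let c : ℕ → ENNReal := fun j => B * ENNReal.ofReal ((T ^ 2)⁻¹ ^ Q) * ENNReal.ofReal ((1 / 2) ^ j)
  have hpt : ∀ h, 𝔉.indicator f h ≤ ∑' j, (P j).indicator (fun _ => c j) h := by
    intro h
    by_cases hh : h ∈ 𝔉
    swap
    · rw [Set.indicator_of_notMem hh]; exact zero_le
    obtain ⟨b, hb, t, ht, k, hk, e, hfh⟩ := hS h hh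
    have ht0 : 0 < t := hT.trans ht
    obtain ⟨j, hj1, hj2⟩ := exists_nat_pow_near (x := t / T) (y := 2)
      ((one_le_div hT).2 ht.le) one_lt_two
    have h2j : (0 : ℝ) < 2 ^ j := by positivity
    have h2j1 : (1 : ℝ) ≤ 2 ^ j := one_le_pow₀ one_le_two
    rw [le_div_iff₀ hT] at hj1
    rw [div_lt_iff₀ hT, pow_succ] at hj2
    have hmem : h ∈ P j := by
      change (((τ ^ j)⁻¹ * h : HA ι) : GA E) ∈ Z
      rw [Subgroup.coe_mul, Subgroup.coe_inv, hτ, e]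
      have e2 : (torusInf (2 ^ j))⁻¹ * (b * torusInf t * k)
          = contract b (((2 ^ j : ℝ) ^ 2)⁻¹) * torusInf (t / 2 ^ j) * k := by
        rw [← torusInf_inv_mul_mul (hΩ0 b hb) h2j]
        have : torusInf (E := E) t = torusInf (2 ^ j) * torusInf (t / 2 ^ j) := by
          rw [← torusInf_mul h2j (by positivity), mul_div_cancel₀ _ h2j.ne']
        rw [this]
        group
      rw [e2]
      refine Set.mul_mem_mul (Set.mul_mem_mul ⟨(b, _), ⟨hb, by positivity, ?_⟩, rfl⟩
        ⟨_, ⟨?_, ?_⟩, rfl⟩) hk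
      · exact inv_le_one_of_one_le₀ (one_le_pow₀ h2j1)
      · rw [le_div_iff₀ h2j]; linarith
      · rw [div_le_iff₀ h2j]; linarith
    rw [Set.indicator_of_mem hh]
    refine le_trans ?_ (ENNReal.le_tsum j)
    rw [Set.indicator_of_mem hmem]
    refine hfh.trans ?_
    simp only [c]
    rw [mul_assoc, ← ENNReal.ofReal_mul (by positivity)]
    gcongr
    calc (t ^ 2)⁻¹ ^ Q ≤ ((2 ^ j * T) ^ 2)⁻¹ ^ Q := by gcongr
      _ = (T ^ 2)⁻¹ ^ Q * (((2 ^ j : ℝ) ^ 2)⁻¹) ^ Q := by rw [mul_pow, mul_inv, mul_pow]; ring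
      _ ≤ (T ^ 2)⁻¹ ^ Q * (1 / 2) ^ j := by
        gcongr
        calc (((2 ^ j : ℝ) ^ 2)⁻¹) ^ Q ≤ ((2 ^ j : ℝ) ^ 2)⁻¹ :=
              pow_le_of_le_one (by positivity) (inv_le_one_of_one_le₀ (one_le_pow₀ h2j1)) hQ
          _ ≤ (2 ^ j : ℝ)⁻¹ := by
              gcongr
              exact le_self_pow₀ h2j1 two_ne_zero
          _ = (1 / 2) ^ j := by rw [one_div, inv_pow]
  have hsum : Summable fun j : ℕ => ((1 : ℝ) / 2) ^ j := summable_geometric_two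
  calc ∫⁻ h in 𝔉, f h ∂η = ∫⁻ h, 𝔉.indicator f h ∂η := (lintegral_indicator h𝔉 f).symm
    _ ≤ ∫⁻ h, ∑' j, (P j).indicator (fun _ => c j) h ∂η := lintegral_mono hpt
    _ = ∑' j, c j * η ZH := by
        rw [lintegral_tsum fun j => (measurable_const.indicator (hP j)).aemeasurable]
        exact tsum_congr fun j => by rw [lintegral_indicator_const (hP j), hηP]
    _ = B * ENNReal.ofReal ((T ^ 2)⁻¹ ^ Q) * (∑' j : ℕ, ENNReal.ofReal ((1 / 2) ^ j)) * η ZH := by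
        rw [ENNReal.tsum_mul_right, ENNReal.tsum_mul_left]
    _ < ⊤ := ENNReal.mul_lt_top (ENNReal.mul_lt_top (ENNReal.mul_lt_top hB.lt_top
        ENNReal.ofReal_lt_top) hsum.tsum_ofReal_ne_top.lt_top) hZH.measure_lt_top

end Siegel

/-! ### The function `V` as an average -/

theorem IsHeckeFunction.right_inv {Ψ : GA E → ℂ} (hΨ : IsHeckeFunction Ψ) (k : GA E) (hk : k ∈ KA E)
    (g : GA E) : Ψ (g * k) = Ψ g := by
  have := hΨ.bi_inv 1 one_mem_KA k hk g
  rwa [one_mul] at this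

theorem IsHeckeFunction.isTest {Ψ : GA E → ℂ} (hΨ : IsHeckeFunction Ψ) : IsTest Ψ where
  scalar := hΨ.scalar
  smooth := hΨ.smooth
  right_inv k hk g := hΨ.right_inv _ (ofFin_mem_KA hk) g
  support := ⟨_, hΨ.compact_support, fun g hg => subset_tsupport _ (by
    rwa [Function.mem_support, apply_projOne hΨ.scalar])⟩

theorem finAbs_pos (x : (AdeleRing (𝓞 E) E)ˣ) : 0 < finAbs (x : AdeleRing (𝓞 E) E).2 := by
  refine lt_of_le_of_ne (finAbs_nonneg _) fun h => ?_
  have := ideleNorm_pos x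
  change 0 < (∏ w : InfinitePlace E, ‖(x : AdeleRing (𝓞 E) E).1 w‖ ^ w.mult) *
    finAbs (x : AdeleRing (𝓞 E) E).2 at this
  rw [← h, mul_zero] at this
  exact lt_irrefl _ this

theorem wCoeff_ne_zero {δ : (AdeleRing (𝓞 E) E)ˣ} {h : GA E}
    (hm : ((finCoord δ h).m : AdeleRing (𝓞 E) E).2 ∈ intFin E) : wCoeff δ h ≠ 0 := by
  classical
  unfold wCoeff
  rw [if_pos (show ∀ v : HeightOneSpectrum (𝓞 E),
    Valued.v (((finCoord δ h).m : AdeleRing (𝓞 E) E).2 v) ≤ 1 from hm)]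
  refine mul_ne_zero (mul_ne_zero (mul_ne_zero (Complex.exp_ne_zero _) ?_) ?_) ?_
  · rw [← norm_ne_zero_iff, norm_psiFin]; exact one_ne_zero
  · refine Complex.ofReal_ne_zero.2 (Finset.prod_ne_zero_iff.2 fun w _ => ?_)
    have := Real.rpow_pos_of_pos (pow_pos (mAbs_pos h w) w.mult) (1 / 2)
    positivity
  · exact Complex.ofReal_ne_zero.2 (finAbs_pos _).ne'

theorem heckeIndicator_eq_zero {m : FiniteAdeleRing (𝓞 E) E} (hm : m ∉ intFin E)
    (x : GL (Fin 2) (FiniteAdeleRing (𝓞 E) E)) : heckeIndicator m x = 0 := by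
  by_contra h
  obtain ⟨h1, h2⟩ := of_heckeIndicator_ne_zero h
  exact hm fun v => (h2 v).symm.trans_le (det_mem_intFin h1 v)

theorem convWhittaker_eq {δ : (AdeleRing (𝓞 E) E)ˣ} (hδ : IsDifferentIdele δ)
    (ν : Measure (GAArchOne E)) {h : GA E} (hc : ∃ c : IwasawaCoord E, c.IsFor δ h) {Ψ : GA E → ℂ}
    (hΨ : IsHeckeFunction Ψ) (g : GA E) :
    convWhittaker δ ν Ψ h g = ∫ x : GAArchOne E, wWeight δ h x * Ψ (g * wPoint δ h x) ∂ν := by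
  have hc' : (iwasawaCoord δ h).IsFor δ h := Classical.epsilon_spec hc
  unfold convWhittaker whittakerDist
  rw [wCoeff_eq hδ hc', ← integral_const_mul]
  refine integral_congr_ae (Filter.Eventually.of_forall fun x => ?_)
  simp only
  rw [coeff_mul_integrand hδ hc' hΨ.right_inv, wWeight]
  ring

/-- The weight is the coefficient times the integrand without `Ψ`. For integral `m` the coefficient
is nonzero and can be divided out; otherwise the Hecke indicator vanishes identically, because an
integral matrix has integral determinant. -/
theorem integrable_integrand {δ : (AdeleRing (𝓞 E) E)ˣ} (hδ : IsDifferentIdele δ)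
    (ν : Measure (GAArchOne E)) {h : GA E} (hc : ∃ c : IwasawaCoord E, c.IsFor δ h) {Ψ : GA E → ℂ}
    (hΨ : IsHeckeFunction Ψ) (g : GA E)
    (hi : Integrable (fun x : GAArchOne E => wWeight δ h x * Ψ (g * wPoint δ h x)) ν) :
    Integrable (fun x : GAArchOne E =>
      (iwasawaCoord δ h).integrand (fun x => Ψ (g * x⁻¹)) (x : GA E)) ν := by
  have hc' : (iwasawaCoord δ h).IsFor δ h := Classical.epsilon_spec hc
  by_cases hm : ((finCoord δ h).m : AdeleRing (𝓞 E) E).2 ∈ intFin E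
  · refine (hi.const_mul (wCoeff δ h)⁻¹).congr (Filter.Eventually.of_forall fun x => ?_)
    simp only
    rw [coeff_mul_integrand hδ hc' hΨ.right_inv, wWeight, mul_assoc, inv_mul_cancel_left₀
      (wCoeff_ne_zero hm)]
  · refine (integrable_zero _ _ _).congr (Filter.Eventually.of_forall fun x => ?_)
    simp only
    rw [coeff_mul_integrand hδ hc' hΨ.right_inv, heckeIndicator_eq_zero hm, Complex.ofReal_zero,
      mul_zero, zero_mul]
    rfl

theorem mem_GAArchOne_of_toInf_eq_one {k : GA E} (hk : toInf k = 1) : k ∈ GAArchOne E := by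
  intro w
  rw [fst_det, hk, map_one]
  exact norm_one (α := w.Completion)

/-- Substitute `x k⁻¹` for `x`, using right invariance of `ν`: the density is unchanged, since the
Gaussian sees only infinity and the Hecke indicator is right `K^∞`-invariant, while the argument of
`Ψ` acquires the factor `k`. -/
theorem convWhittaker_mul_right {δ : (AdeleRing (𝓞 E) E)ˣ} (hδ : IsDifferentIdele δ)
    (ν : Measure (GAArchOne E)) [ν.IsHaarMeasure] {h : GA E}
    (hc : ∃ c : IwasawaCoord E, c.IsFor δ h) {Ψ : GA E → ℂ} (hΨ : IsHeckeFunction Ψ)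
    {k : GA E} (hk1 : toInf k = 1) (hk : toFin k ∈ KFin E) (g : GA E) :
    convWhittaker δ ν Ψ h (g * k) = convWhittaker δ ν Ψ h g := by
  have := isMulRightInvariant_GAArchOne ν
  rw [convWhittaker_eq hδ ν hc hΨ, convWhittaker_eq hδ ν hc hΨ]
  let κ : GAArchOne E := ⟨k, mem_GAArchOne_of_toInf_eq_one hk1⟩
  rw [← integral_mul_right_eq_self (fun x : GAArchOne E =>
    wWeight δ h x * Ψ (g * wPoint δ h x)) κ⁻¹]
  refine integral_congr_ae (Filter.Eventually.of_forall fun x => ?_)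
  have e : ((x * κ⁻¹ : GAArchOne E) : GA E) = (x : GA E) * k⁻¹ := rfl
  have h1 : wPoint δ h ((x : GA E) * k⁻¹) = k * wPoint δ h x := by
    unfold wPoint; group
  have h2 : wWeight δ h ((x : GA E) * k⁻¹) = wWeight δ h x := by
    have h3 : toInf (mRadius h * ((x : GA E) * k⁻¹)) = toInf (mRadius h * (x : GA E)) := by
      rw [← mul_assoc, map_mul toInf (mRadius h * (x : GA E)), map_inv, hk1, inv_one, mul_one]
    unfold wWeight
    rw [map_mul toFin (x : GA E), heckeIndicator_mul_right _ _ (by rw [map_inv]; exact inv_mem_KFin hk),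
      h3]
  simp only
  rw [e, h1, h2, mul_assoc]

/-! ### Measurability and Fubini on `𝔉 × Eˣ × GAArchOne E` -/

section Assembly

/-- With the discrete structure, the sum over `Eˣ` becomes an integral against counting measure and
Fubini applies. -/
instance : MeasurableSpace Eˣ := ⊤

instance : DiscreteMeasurableSpace Eˣ := ⟨fun _ => trivial⟩

instance : Countable Eˣ := Units.val_injective.countable

instance (Γ : Subgroup (GA E)) : SecondCountableTopology Γ :=
  TopologicalSpace.Subtype.secondCountableTopology _

variable {F : Type*} [Field F] [Algebra F E]

instance (ι : E ≃ₐ[F] E) : LocallyCompactSpace (HA ι) :=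
  (isClosed_unitaryTwo (continuous_galAdele (ι : E ≃+* E))).isClosedEmbedding_subtypeVal.locallyCompactSpace

/-- The pair formed by `(y 0; 0 1) h` and `x`. -/
def shiftPair (ι : E ≃ₐ[F] E) (q : HA ι × (Eˣ × GAArchOne E)) : GA E × GA E :=
  (ofRat (diagGL q.2.1 1) * (q.1 : GA E), (q.2.2 : GA E))

/-- As `Eˣ` is countable, measurability may be checked for each `y` separately, where the map is
continuous. -/
theorem measurable_comp_shiftPair (ι : E ≃ₐ[F] E) {Y : Type*} [TopologicalSpace Y]
    [MeasurableSpace Y] [BorelSpace Y] {f : GA E × GA E → Y} (hf : Continuous f) :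
    Measurable fun q => f (shiftPair ι q) := by
  have h0 : ∀ y : Eˣ, Measurable fun p : HA ι × GAArchOne E =>
      f (ofRat (diagGL y 1) * (p.1 : GA E), (p.2 : GA E)) := fun y => by
    have h2 : Continuous fun p : HA ι × GAArchOne E =>
        (ofRat (diagGL y 1) * (p.1 : GA E), (p.2 : GA E)) :=
      (continuous_const.mul (continuous_subtype_val.comp continuous_fst)).prodMk
        (continuous_subtype_val.comp continuous_snd)
    exact (hf.comp h2).measurable
  have h1 : Measurable fun p : Eˣ × (HA ι × GAArchOne E) =>
      f (ofRat (diagGL p.1 1) * (p.2.1 : GA E), (p.2.2 : GA E)) :=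
    measurable_from_prod_countable_right h0
  have h3 : Measurable fun q : HA ι × (Eˣ × GAArchOne E) => (q.2.1, (q.1, q.2.2)) :=
    (measurable_fst.comp measurable_snd).prodMk
      (measurable_fst.prodMk (measurable_snd.comp measurable_snd))
  have h4 := h1.comp h3
  exact h4

variable (ι : E ≃ₐ[F] E) (δ : (AdeleRing (𝓞 E) E)ˣ) (ν : Measure (GAArchOne E)) (η : Measure (HA ι))
  (𝔉 : Set (HA ι))

theorem isControlled_shiftPair : IsControlled
    (fun q => wPoint δ (shiftPair ι q).1 (shiftPair ι q).2) (fun q => size (q.2.2 : GA E)) where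
  measurable := measurable_comp_shiftPair ι (continuous_wPoint δ)
  one_le q := one_le_size q.2.2
  measurable_bound := (continuous_size.measurable.comp measurable_subtype_coe).comp
    (measurable_snd.comp measurable_snd)
  bound := ⟨4, by norm_num, fun q V => norm_adInv_wPoint_le δ _ q.2.2 V⟩

/-- Tonelli's theorem turns the iterated moments, with counting measure on `Eˣ`, into moments for
the product measure. -/
theorem isWeight_shiftPair [SFinite ν] (h : ∀ N : ℕ, ∫⁻ h in 𝔉, ∑' y : Eˣ, ∫⁻ x : GAArchOne E,
      ‖wWeight δ (ofRat (diagGL y 1) * (h : GA E)) x‖ₑ * ENNReal.ofReal (size (x : GA E) ^ N) ∂ν ∂η < ⊤) :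
    IsWeight ((η.restrict 𝔉).prod (Measure.count.prod ν)) (fun q => size (q.2.2 : GA E))
      (fun q => wWeight δ (shiftPair ι q).1 (shiftPair ι q).2) where
  measurable := measurable_comp_shiftPair ι (continuous_wWeight δ)
  integrable N := by
    have hA : Measurable fun q => wWeight δ (shiftPair ι q).1 (shiftPair ι q).2 :=
      measurable_comp_shiftPair ι (continuous_wWeight δ)
    have hX : Measurable fun q : HA ι × (Eˣ × GAArchOne E) => size (q.2.2 : GA E) :=
      (isControlled_shiftPair ι δ).measurable_bound
    refine ⟨(hA.norm.mul (hX.pow_const N)).aestronglyMeasurable, ?_⟩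
    have hm : Measurable fun q : HA ι × (Eˣ × GAArchOne E) =>
        ‖wWeight δ (shiftPair ι q).1 (shiftPair ι q).2‖ₑ * ENNReal.ofReal (size (q.2.2 : GA E) ^ N) :=
      hA.enorm.mul (hX.pow_const N).ennreal_ofReal
    have e : ∀ q : HA ι × (Eˣ × GAArchOne E),
        ‖‖wWeight δ (shiftPair ι q).1 (shiftPair ι q).2‖ * size (q.2.2 : GA E) ^ N‖ₑ
        = ‖wWeight δ (shiftPair ι q).1 (shiftPair ι q).2‖ₑ * ENNReal.ofReal (size (q.2.2 : GA E) ^ N) :=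
      fun q => by
        rw [enorm_mul, enorm_norm, Real.enorm_of_nonneg
          (pow_nonneg (zero_le_one.trans (one_le_size q.2.2)) N)]
    rw [HasFiniteIntegral, lintegral_congr e, lintegral_prod _ hm.aemeasurable]
    refine lt_of_eq_of_lt (lintegral_congr fun h => ?_) (h N)
    have hm' : Measurable fun p : Eˣ × GAArchOne E =>
        ‖wWeight δ (shiftPair ι (h, p)).1 (shiftPair ι (h, p)).2‖ₑ *
          ENNReal.ofReal (size (p.2 : GA E) ^ N) := hm.comp measurable_prodMk_left
    refine (lintegral_prod _ hm'.aemeasurable).trans ?_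
    rw [lintegral_count]
    rfl

variable {ι δ 𝔉}

/-- For fixed `h` the weight is integrable over `Eˣ × GAArchOne E` and `Ψ` is bounded, so Fubini
with counting measure gives all the claims at once. -/
theorem sum_eq_integral [SFinite ν] {h : HA ι} {Ψ : GA E → ℂ} {g : GA E} (hδ : IsDifferentIdele δ)
    (hΨ : IsHeckeFunction Ψ) (hc : ∀ y : Eˣ, ∃ c : IwasawaCoord E,
      c.IsFor δ (ofRat (diagGL y 1) * (h : GA E)))
    (hfin : ∑' y : Eˣ, ∫⁻ x : GAArchOne E,
      ‖wWeight δ (ofRat (diagGL y 1) * (h : GA E)) x‖ₑ ∂ν < ⊤) :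
    (∀ y : Eˣ, Integrable (fun x : GAArchOne E =>
      (iwasawaCoord δ (ofRat (diagGL y 1) * (h : GA E))).integrand (fun x => Ψ (g * x⁻¹)) x) ν) ∧
    (Summable fun y : Eˣ => ‖vTerm δ ν Ψ y (h : GA E) g‖) ∧
    ∑' y : Eˣ, vTerm δ ν Ψ y (h : GA E) g = ∫ p : Eˣ × GAArchOne E,
      wWeight δ (shiftPair ι (h, p)).1 (shiftPair ι (h, p)).2 *
        Ψ (g * wPoint δ (shiftPair ι (h, p)).1 (shiftPair ι (h, p)).2) ∂(Measure.count.prod ν) := by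
  obtain ⟨B, hB⟩ := hΨ.isTest.exists_bound
  have hm : Measurable fun p : Eˣ × GAArchOne E =>
      wWeight δ (shiftPair ι (h, p)).1 (shiftPair ι (h, p)).2 :=
    (measurable_comp_shiftPair ι (continuous_wWeight δ)).comp measurable_prodMk_left
  have hm' : Measurable fun p : Eˣ × GAArchOne E =>
      Ψ (g * wPoint δ (shiftPair ι (h, p)).1 (shiftPair ι (h, p)).2) :=
    (measurable_comp_shiftPair ι (hΨ.isTest.continuous.comp
      (continuous_const.mul (continuous_wPoint δ)))).comp measurable_prodMk_left
  have hW : Integrable (fun p : Eˣ × GAArchOne E =>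
      wWeight δ (shiftPair ι (h, p)).1 (shiftPair ι (h, p)).2) (Measure.count.prod ν) := by
    refine ⟨hm.aestronglyMeasurable, ?_⟩
    rw [HasFiniteIntegral, lintegral_prod _ hm.enorm.aemeasurable, lintegral_count]
    exact hfin
  have hi : Integrable (fun p : Eˣ × GAArchOne E =>
      wWeight δ (shiftPair ι (h, p)).1 (shiftPair ι (h, p)).2 *
        Ψ (g * wPoint δ (shiftPair ι (h, p)).1 (shiftPair ι (h, p)).2)) (Measure.count.prod ν) :=
    hW.mul_bdd hm'.aestronglyMeasurable (Filter.Eventually.of_forall fun _ => hB _)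
  have hv : ∀ y : Eˣ, vTerm δ ν Ψ y (h : GA E) g = ∫ x : GAArchOne E,
      wWeight δ (shiftPair ι (h, (y, x))).1 (shiftPair ι (h, (y, x))).2 *
        Ψ (g * wPoint δ (shiftPair ι (h, (y, x))).1 (shiftPair ι (h, (y, x))).2) ∂ν := fun y =>
    convWhittaker_eq hδ ν (hc y) hΨ g
  have hint : Integrable (fun y => vTerm δ ν Ψ y (h : GA E) g) Measure.count := by
    simp only [hv]
    exact hi.integral_prod_left
  refine ⟨fun y => integrable_integrand hδ ν (hc y) hΨ g ?_, ?_, ?_⟩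
  -- Almost every `y` for counting measure means every `y`.
  · have h0 := hi.prod_right_ae
    rw [Measure.ae_count_iff] at h0
    exact h0 y
  · exact integrable_count_iff.1 hint
  · rw [integral_prod _ hi, integral_countable (by simpa only [hv] using hint)]
    refine tsum_congr fun y => ?_
    rw [hv, measureReal_def, Measure.count_singleton, ENNReal.toReal_one, one_smul]

end Assembly

/-- Convergence at each individual `h ∈ 𝔉` uses the moment of order zero at that point of the Siegel
set; integrability over `𝔉`, and with it membership in `𝒞`, uses all moments together with the decay
in `t`. -/
theorem vFunction_mem {F : Type*} [Field F] [Algebra F E] (ι : E ≃ₐ[F] E)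
    (δ : (AdeleRing (𝓞 E) E)ˣ) (hδ : IsDifferentIdele δ) (μ : Measure (GAOne E)) [μ.IsHaarMeasure]
    (ν : Measure (GAArchOne E)) [ν.IsHaarMeasure] (η : Measure (HA ι)) [η.IsHaarMeasure]
    (𝔉 : Set (HA ι)) (h𝔉 : MeasurableSet 𝔉) (hS : IsSiegelContained ι 𝔉)
    (Ψ : GA E → ℂ) (hΨ : IsHeckeFunction Ψ) :
    (∀ g : GA E,
      (∀ h ∈ 𝔉, ∀ y : Eˣ, Integrable (fun x : GAArchOne E =>
        (iwasawaCoord δ (ofRat (diagGL y 1) * (h : GA E))).integrand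
          (fun x => Ψ (g * x⁻¹)) x) ν) ∧
      (∀ h ∈ 𝔉, Summable fun y : Eˣ => ‖vTerm δ ν Ψ y (h : GA E) g‖) ∧
      IntegrableOn (fun h : HA ι => ∑' y : Eˣ, vTerm δ ν Ψ y (h : GA E) g) 𝔉 η) ∧
    MemC μ (vFunction ι δ ν η 𝔉 Ψ) := by
  have : SigmaCompactSpace (GAArchOne E) := inferInstance
  have : SigmaFinite ν := inferInstance
  have : SigmaCompactSpace (HA ι) := inferInstance
  have : SigmaFinite η := inferInstance
  obtain ⟨T, hT, Ω, hΩ, hΩ0, hS⟩ := hS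
  have hc : ∀ h ∈ 𝔉, ∀ y : Eˣ, ∃ c : IwasawaCoord E,
      c.IsFor δ (ofRat (diagGL y 1) * (h : GA E)) := by
    intro h hh y
    obtain ⟨b, hb, t, ht, k, hk, e⟩ := hS h hh
    rw [e]
    exact exists_isFor_siegel δ (hΩ0 b hb).2 (hT.trans ht) hk y
  have hfin : ∀ h ∈ 𝔉, ∑' y : Eˣ, ∫⁻ x : GAArchOne E,
      ‖wWeight δ (ofRat (diagGL y 1) * (h : GA E)) x‖ₑ ∂ν < ⊤ := by
    intro h hh
    obtain ⟨B, hB, Q, -, H⟩ := exists_tsum_lintegral_wWeight_le hδ.1 ν 0 hΩ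
      (fun b hb => (hΩ0 b hb).2) hT
    obtain ⟨b, hb, t, ht, k, hk, e⟩ := hS h hh
    have h1 := H b hb t ht k hk
    simp only [pow_zero, ENNReal.ofReal_one, mul_one] at h1
    rw [e]
    exact h1.trans_lt (ENNReal.mul_lt_top hB.lt_top ENNReal.ofReal_lt_top)
  have hA : IsWeight ((η.restrict 𝔉).prod (Measure.count.prod ν)) (fun q => size (q.2.2 : GA E))
      (fun q => wWeight δ (shiftPair ι q).1 (shiftPair ι q).2) := by
    refine isWeight_shiftPair ι δ ν η 𝔉 fun N => ?_
    obtain ⟨B, hB, Q, hQ, H⟩ := exists_tsum_lintegral_wWeight_le hδ.1 ν N hΩ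
      (fun b hb => (hΩ0 b hb).2) hT
    refine lintegral_siegel_lt_top ι η h𝔉 hΩ (fun b hb => (hΩ0 b hb).2) hT hB hQ fun h hh => ?_
    obtain ⟨b, hb, t, ht, k, hk, e⟩ := hS h hh
    exact ⟨b, hb, t, ht, k, hk, e, by rw [e]; exact H b hb t ht k hk⟩
  have hu := isControlled_shiftPair ι δ
  have hi := integrable_average hu hA hΨ.isTest
  have hae : ∀ g : GA E, ∀ᵐ h ∂(η.restrict 𝔉), ∫ p : Eˣ × GAArchOne E,
      wWeight δ (shiftPair ι (h, p)).1 (shiftPair ι (h, p)).2 *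
        Ψ (g * wPoint δ (shiftPair ι (h, p)).1 (shiftPair ι (h, p)).2) ∂(Measure.count.prod ν)
      = ∑' y : Eˣ, vTerm δ ν Ψ y (h : GA E) g := fun g => by
    filter_upwards [ae_restrict_mem h𝔉] with h hh
    exact (sum_eq_integral ν hδ hΨ (hc h hh) (hfin h hh)).2.2.symm
  refine ⟨fun g => ⟨fun h hh => (sum_eq_integral ν hδ hΨ (hc h hh) (hfin h hh)).1,
    fun h hh => (sum_eq_integral ν hδ hΨ (hc h hh) (hfin h hh)).2.1,
    (hi g).integral_prod_left.congr (hae g)⟩, ?_⟩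
  -- The identification with an average is needed for every `g`, as an equality of functions and not
  -- merely almost everywhere, because derivatives are taken afterwards.
  have hV : vFunction ι δ ν η 𝔉 Ψ = average ((η.restrict 𝔉).prod (Measure.count.prod ν))
      (fun q => wPoint δ (shiftPair ι q).1 (shiftPair ι q).2)
      (fun q => wWeight δ (shiftPair ι q).1 (shiftPair ι q).2) Ψ := by
    funext g
    rw [average, integral_prod _ (hi g)]
    exact (integral_congr_ae (hae g)).symm
  refine memC_of_mem_averages hu μ (hV ▸ average_mem hA hΨ.isTest) fun k hk1 hk g => ?_
  -- Right `K^∞`-invariance is read off from each term, not from the weighted average: `k` acts on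
  -- `x` and not on the test function.
  refine setIntegral_congr_fun h𝔉 fun h hh => tsum_congr fun y => ?_
  exact convWhittaker_mul_right hδ ν (hc h hh y) hΨ hk1 hk g

end GL2Adelic

end

open GL2Adelic in
theorem mainTheorem3 {F E : Type*} [Field F] [NumberField F] [Field E] [NumberField E]
    [Algebra F E] [IsGalois F E]
    -- `E/F` is unramified at all finite places and split at all infinite places
    [Algebra.FormallyUnramified (𝓞 F) (𝓞 E)] [IsUnramifiedAtInfinitePlaces F E]
    (ι τ : E ≃ₐ[F] E) (hgen : Subgroup.closure {ι, τ} = ⊤)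
    (hι : orderOf ι = 2) (hτ : Odd (orderOf τ))
    (δ : (AdeleRing (𝓞 E) E)ˣ) (hδ : IsDifferentIdele δ)
    -- Haar measures on `G(𝔸_F)^1`, on `∏_{w ∣ ∞} GL₂(E_w)^1 × GL₂(𝔸_E^∞)` and on `H(𝔸_F)`
    (μ : Measure (GAOne E)) [μ.IsHaarMeasure]
    (ν : Measure (GAArchOne E)) [ν.IsHaarMeasure]
    (η : Measure (HA ι)) [η.IsHaarMeasure]
    (𝔉 : Set (HA ι)) (h𝔉 : IsFundamentalDomainH ι 𝔉) (hS : IsSiegelContained ι 𝔉)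
    (Ψ : GA E → ℂ) (hΨ : IsHeckeFunction Ψ) :
    -- the integrals and the sum that define `V_Ψ` converge absolutely
    (∀ g : GA E,
      (∀ h ∈ 𝔉, ∀ y : Eˣ, Integrable (fun x : GAArchOne E =>
        (iwasawaCoord δ (ofRat (diagGL y 1) * (h : GA E))).integrand
          (fun x => Ψ (g * x⁻¹)) x) ν) ∧
      (∀ h ∈ 𝔉, Summable fun y : Eˣ => ‖vTerm δ ν Ψ y (h : GA E) g‖) ∧
      IntegrableOn (fun h : HA ι => ∑' y : Eˣ, vTerm δ ν Ψ y (h : GA E) g) 𝔉 η) ∧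
    -- and `V_Ψ` lies in `𝒞(G(𝔸_F)^1)`
    MemC μ (vFunction ι δ ν η 𝔉 Ψ) := by
  exact vFunction_mem ι δ hδ μ ν η 𝔉 h𝔉.measurable hS Ψ hΨ
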